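/- Let $k$ be an algebraically closed field and $G$ a group. A linear 2-representation $\varrho$ of $G$ on a $k$-linear category $\mathcal V$ consists of $k$-linear functors $\varrho(g):\mathcal V\to\mathcal V$ ($g\in G$), natural isomorphisms $\phi_{g,h}:\varrho(g)\varrho(h)\Rightarrow\varrho(gh)$ and a natural isomorphism $\phi_1:\varrho(1)\Rightarrow\mathrm{id}_{\mathcal V}$ such that $\phi_{gh,l}\,(\phi_{g,h}\varrho(l))=\phi_{g,hl}\,(\varrho(g)\phi_{h,l})$, $\phi_{1,g}=\phi_1\varrho(g)$ and $\phi_{g,1}=\varrho(g)\phi_1$. Its categorical character is the family of $k$-vector spaces $X_\varrho(g)=\mathrm{Nat}(\mathrm{id}_{\mathcal V},\varrho(g))$. For $s\in G$ there is an isomorphism $\psi_s:X_\varrho(g)\to X_\varrho(sgs^{-1})$ sending $\xi$ to the composite $\mathrm{id}\cong\varrho(1)\cong\varrho(s)\varrho(s^{-1})\xrightarrow{\ \varrho(s)\,\xi\,\varrho(s^{-1})\ }\varrho(s)\varrho(g)\varrho(s^{-1})\cong\varrho(sgs^{-1})$; through the $\psi_s$ the centralizer $C_g$ of $g$ acts on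 $X_\varrho(g)$. The category $\mathcal V^{\boxtimes n}$ has as objects the finite formal direct sums of formal tensor products $V_1\boxtimes\dots\boxtimes V_n$ of objects of $\mathcal V$; one has $\mathrm{Hom}(V_1\boxtimes\dots\boxtimes V_n,\,W_1\boxtimes\dots\boxtimes W_n)=\bigotimes_a\mathrm{Hom}(V_a,W_a)$, and morphisms between formal direct sums are matrices. The group $S_n$ acts by $\sigma(V_1\boxtimes\dots\boxtimes V_n)=V_{\sigma^{-1}(1)}\boxtimes\dots\boxtimes V_{\sigma^{-1}(n)}$, and $\mathrm{Sym}^n(\mathcal V)=(\mathcal V^{\boxtimes n})^{S_n}$ is the category of $S_n$-equivariant objects. The 2-representation $\mathrm{Sym}^n(\varrho)$ is the diagonal action of $G$ on $\mathrm{Sym}^n(\mathcal V)$ induced by $g(V_1\boxtimes\dots\boxtimes V_n)=\varrho(g)(V_1)\boxtimes\dots\boxtimes\varrho(g)(V_n)$. Let $m\ge 0$, let $\mathcal V=\mathrm{Vect}^m$ be the category of $m$-tuples of finite-dimensional $k$-vector spaces, let $\varrho$ be a linear 2-representation of $G$ on $\mathcal V$ and let $g\in G$. For $r\ge1$, the group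 $\mathbb Z/r$ acts on $X_\varrho(g^r)$, a generator acting by $\psi_g$. (If $(V_{i,j})$ is the matrix of vector spaces describing $\varrho(g)$, then $X_\varrho(g^r)\cong\bigoplus_{i_1,\dots,i_r}V_{i_1,i_2}\otimes V_{i_2,i_3}\otimes\dots\otimes V_{i_r,i_1}$, and this is the action by cyclic permutation of the tensor factors.) The subspace of invariants $X_\varrho(g^r)^{\mathbb Z/r}$ is a representation of $C_g\subseteq C_{g^r}$. Then there is an isomorphism of $\mathbb N$-graded representations of $C_g$ $$\bigoplus_{n\ge0}X_{\mathrm{Sym}^n(\varrho)}(g)\,q^n\;\cong\;\bigotimes_{r\ge1}S_{q^r}\!\left(X_\varrho(g^r)^{\mathbb Z/r}\right),\qquad S_{q^r}(W)=\bigoplus_{j\ge0}\mathrm{sym}^j(W)\,q^{rj},$$ where $q$ is a dummy variable recording the degree. That is, for every $n\ge 0$ there is an isomorphism of representations of $C_g$ $$X_{\mathrm{Sym}^n(\varrho)}(g)\;\cong\;\bigoplus_{\sum_{r} r\,n_r=n}\ \bigotimes_{r\ge1}\mathrm{sym}^{n_r}\!\left(X_\varrho(g^r)^{\mathbb Z/r}\right).$$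 -/

import Mathlib

open CategoryTheory

universe w v u

/-- A `k`-linear 2-representation (categorical representation) of `G` on the `k`-linear
category `V`: linear functors `F g`, isomorphisms `φ_{g,h} : F g ∘ F h ≅ F (g * h)` and
`φ_1 : F 1 ≅ id`, subject to associativity and the two unit conditions.  The morphisms
`eqToHom _` only identify, e.g., `F ((g * h) * l)` with `F (g * (h * l))`. -/
structure TwoRep (k : Type*) [Field k] (G : Type*) [Group G]
    (V : Type*) [Category V] [Preadditive V] [Linear k V] where
  F : G → V ⥤ V
  additive : ∀ g, (F g).Additive
  linear : ∀ g, (F g).Linear k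
  mulIso : ∀ g h, F h ⋙ F g ≅ F (g * h)
  oneIso : F 1 ≅ 𝟭 V
  assoc : ∀ (g h l : G) (X : V),
    (mulIso g h).hom.app ((F l).obj X) ≫ (mulIso (g * h) l).hom.app X =
      (F g).map ((mulIso h l).hom.app X) ≫ (mulIso g (h * l)).hom.app X ≫
        eqToHom (congrArg (fun x => (F x).obj X) (mul_assoc g h l).symm)
  one_left : ∀ (g : G) (X : V),
    (mulIso 1 g).hom.app X = oneIso.hom.app ((F g).obj X) ≫
      eqToHom (congrArg (fun x => (F x).obj X) (one_mul g).symm)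
  one_right : ∀ (g : G) (X : V),
    (mulIso g 1).hom.app X = (F g).map (oneIso.hom.app X) ≫
      eqToHom (congrArg (fun x => (F x).obj X) (mul_one g).symm)

namespace TwoRep

noncomputable section

section Basic

variable {k : Type*} [Field k] {G : Type*} [Group G]
  {V : Type*} [Category V] [Preadditive V] [Linear k V]

attribute [instance] TwoRep.additive TwoRep.linear

/-- The isomorphism `F g ∘ F h ≅ F p` for `g * h = p`. -/
def mulIso' (ρ : TwoRep k G V) {g h p : G} (e : g * h = p) : ρ.F h ⋙ ρ.F g ≅ ρ.F p :=
  ρ.mulIso g h ≪≫ eqToIso (congrArg ρ.F e)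

lemma mulIso'_rfl (ρ : TwoRep k G V) (g h : G) :
    ρ.mulIso' (rfl : g * h = g * h) = ρ.mulIso g h := by
  ext; simp [mulIso']

lemma assoc' (ρ : TwoRep k G V) {g h l p q r : G} (e₁ : g * h = p) (e₂ : p * l = r)
    (e₃ : h * l = q) (e₄ : g * q = r) (X : V) :
    (ρ.mulIso' e₁).hom.app ((ρ.F l).obj X) ≫ (ρ.mulIso' e₂).hom.app X =
      (ρ.F g).map ((ρ.mulIso' e₃).hom.app X) ≫ (ρ.mulIso' e₄).hom.app X := by
  subst e₁ e₃ e₄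
  have := ρ.assoc g h l X
  simp [mulIso', reassoc_of% this, eqToHom_app]

lemma one_left' (ρ : TwoRep k G V) {g : G} (e : 1 * g = g) (X : V) :
    (ρ.mulIso' e).hom.app X = ρ.oneIso.hom.app ((ρ.F g).obj X) := by
  simp [mulIso', ρ.one_left g X, eqToHom_app]

lemma one_right' (ρ : TwoRep k G V) {g : G} (e : g * 1 = g) (X : V) :
    (ρ.mulIso' e).hom.app X = (ρ.F g).map (ρ.oneIso.hom.app X) := by
  simp [mulIso', ρ.one_right g X, eqToHom_app]

/-- The categorical character `X_ρ(g) = Nat(id, ρ(g))`. -/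
abbrev Char (ρ : TwoRep k G V) (g : G) := 𝟭 V ⟶ ρ.F g

/-- For `s * g * s⁻¹ = p`, the conjugation map `ψ_s : X_ρ(g) → X_ρ(p)`, sending `ξ` to
`id ≅ ρ(1) ≅ ρ(s) ρ(s⁻¹) ⟶ ρ(s) ρ(g) ρ(s⁻¹) ≅ ρ(s g) ρ(s⁻¹) ≅ ρ(p)`. -/
def conj (ρ : TwoRep k G V) {s g p : G} (e : s * g * s⁻¹ = p) :
    ρ.Char g →ₗ[k] ρ.Char p where
  toFun ξ :=
    { app := fun X => ρ.oneIso.inv.app X ≫ (ρ.mulIso' (mul_inv_cancel s)).inv.app X ≫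
        (ρ.F s).map (ξ.app ((ρ.F s⁻¹).obj X)) ≫
        (ρ.mulIso s g).hom.app ((ρ.F s⁻¹).obj X) ≫ (ρ.mulIso' e).hom.app X
      naturality := fun X Y f => by
        have h1 := ρ.oneIso.inv.naturality f
        have h2 := (ρ.mulIso' (mul_inv_cancel s)).inv.naturality f
        have h3 := ξ.naturality ((ρ.F s⁻¹).map f)
        have h4 := (ρ.mulIso s g).hom.naturality ((ρ.F s⁻¹).map f)
        have h5 := (ρ.mulIso' e).hom.naturality f
        dsimp at h1 h2 h3 h4 h5 ⊢
        rw [reassoc_of% h1, reassoc_of% h2, ← Functor.map_comp_assoc, h3,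
          Functor.map_comp_assoc, reassoc_of% h4, h5]
        simp }
  map_add' ξ η := by ext X; simp
  map_smul' c ξ := by ext X; simp

/-- `ψ_s(ξ)` is characterized by its values on the objects `ρ(s)(Y)`. -/
lemma conj_app (ρ : TwoRep k G V) {s g p q : G} (e : s * g * s⁻¹ = p) (e₁ : p * s = q)
    (e₂ : s * g = q) (ξ : ρ.Char g) (Y : V) :
    (ρ.conj e ξ).app ((ρ.F s).obj Y) ≫ (ρ.mulIso' e₁).hom.app Y =
      (ρ.F s).map (ξ.app Y) ≫ (ρ.mulIso' e₂).hom.app Y := by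
  subst e₂
  have h1 := ρ.assoc' e e₁ (inv_mul_cancel s) (mul_one (s * g)) Y
  rw [one_right', ← Functor.map_comp] at h1
  have h2 := ρ.assoc' (mul_inv_cancel s) (one_mul s) (inv_mul_cancel s) (mul_one s) Y
  rw [one_right', one_left', ← Functor.map_comp] at h2
  set θ := (ρ.mulIso' (inv_mul_cancel s)).hom.app Y ≫ ρ.oneIso.hom.app Y with hθ
  have h3 := (ρ.mulIso s g).hom.naturality θ
  have h4 := ξ.naturality θ
  dsimp [conj] at h1 h2 h3 h4 ⊢
  simp only [Category.assoc]
  rw [h1, ← h3, ← Functor.map_comp_assoc, ← h4, Functor.map_comp_assoc, ← h2, mulIso'_rfl]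
  simp

/-- Two elements of `X_ρ(p)` agree if they agree on all objects `ρ(s)(Y)`. -/
lemma char_ext (ρ : TwoRep k G V) (s : G) {p : G} {ξ η : ρ.Char p}
    (h : ∀ Y, ξ.app ((ρ.F s).obj Y) = η.app ((ρ.F s).obj Y)) : ξ = η := by
  ext X
  let i : X ⟶ (ρ.F s).obj ((ρ.F s⁻¹).obj X) :=
    ρ.oneIso.inv.app X ≫ (ρ.mulIso' (mul_inv_cancel s)).inv.app X
  let j : (ρ.F s).obj ((ρ.F s⁻¹).obj X) ⟶ X :=
    (ρ.mulIso' (mul_inv_cancel s)).hom.app X ≫ ρ.oneIso.hom.app X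
  have hij : i ≫ j = 𝟙 X := by simp [i, j]
  have h1 := ξ.naturality j
  have h2 := η.naturality j
  dsimp at h1 h2
  have h3 : j ≫ ξ.app X = j ≫ η.app X := by rw [h1, h2, h]
  calc ξ.app X = i ≫ j ≫ ξ.app X := by rw [reassoc_of% hij]
    _ = i ≫ j ≫ η.app X := by rw [h3]
    _ = η.app X := by rw [reassoc_of% hij]

/-- `conj e ξ` is the only `η` with the values of `conj_app`. -/
lemma eq_conj (ρ : TwoRep k G V) {s g p q : G} (e : s * g * s⁻¹ = p) (e₁ : p * s = q)
    (e₂ : s * g = q) (ξ : ρ.Char g) (η : ρ.Char p)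
    (h : ∀ Y, η.app ((ρ.F s).obj Y) ≫ (ρ.mulIso' e₁).hom.app Y =
      (ρ.F s).map (ξ.app Y) ≫ (ρ.mulIso' e₂).hom.app Y) : η = ρ.conj e ξ := by
  refine ρ.char_ext s fun Y => ?_
  rw [← cancel_mono ((ρ.mulIso' e₁).hom.app Y), h, conj_app]

lemma conj_one (ρ : TwoRep k G V) {g : G} (e : 1 * g * 1⁻¹ = g) (ξ : ρ.Char g) :
    ρ.conj e ξ = ξ := by
  symm
  refine ρ.eq_conj e (mul_one g) (one_mul g) ξ ξ fun Y => ?_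
  rw [one_right', one_left']
  have h1 := ξ.naturality (ρ.oneIso.hom.app Y)
  have h2 := ρ.oneIso.hom.naturality (ξ.app Y)
  dsimp at h1 h2
  rw [← h1, h2]

lemma conj_conj (ρ : TwoRep k G V) {s t g p q : G} (e₁ : t * g * t⁻¹ = p)
    (e₂ : s * p * s⁻¹ = q) (e : s * t * g * (s * t)⁻¹ = q) (ξ : ρ.Char g) :
    ρ.conj e₂ (ρ.conj e₁ ξ) = ρ.conj e ξ := by
  refine ρ.eq_conj e (q := s * t * g) (by rw [← e]; group) rfl ξ _ fun Y => ?_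
  rw [← cancel_epi ((ρ.mulIso s t).hom.app Y)]
  have n1 := (ρ.conj e₂ (ρ.conj e₁ ξ)).naturality ((ρ.mulIso s t).hom.app Y)
  have n2 := (ρ.mulIso s t).hom.naturality (ξ.app Y)
  dsimp at n1 n2
  rw [reassoc_of% n1, reassoc_of% (n2).symm, ← mulIso'_rfl]
  have a1 := ρ.assoc' (g := q) (h := s) (l := t) (p := s * p) (q := s * t) (r := s * t * g)
    (by rw [← e₂]; group) (by rw [← e₁]; group) rfl (by rw [← e]; group) Y
  rw [← a1, reassoc_of% (ρ.conj_app e₂ (q := s * p) (by rw [← e₂]; group) rfl)]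
  have a2 := ρ.assoc' (g := s) (h := p) (l := t) (p := s * p) (q := t * g) (r := s * t * g)
    rfl (by rw [← e₁]; group) (by rw [← e₁]; group) (by group) Y
  rw [a2, ← Functor.map_comp_assoc, ρ.conj_app e₁ (q := t * g) (by rw [← e₁]; group) rfl,
    Functor.map_comp_assoc]
  rw [ρ.assoc' (g := s) (h := t) (l := g) rfl rfl rfl (by group) Y]

lemma conj_eq_of_mem {g : G} (s : Subgroup.centralizer ({g} : Set G)) :
    (s : G) * g * (s : G)⁻¹ = g := by
  have := Subgroup.mem_centralizer_singleton_iff.mp s.2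
  rw [this]; group

/-- The action of the centralizer `C_g` on `X_ρ(g)`, by `s ↦ ψ_s`. -/
def charRep (ρ : TwoRep k G V) (g : G) :
    Representation k (Subgroup.centralizer ({g} : Set G)) (ρ.Char g) where
  toFun s := ρ.conj (conj_eq_of_mem s)
  map_one' := by ext1 ξ; exact ρ.conj_one _ ξ
  map_mul' s t := by ext1 ξ; exact (ρ.conj_conj _ _ _ ξ).symm

end Basic

section VectPow

/-- The category `Vect^m` of `m`-tuples of finite-dimensional `k`-vector spaces, the product of
`m` copies of the category of finite-dimensional `k`-vector spaces. -/
structure _root_.VectPow (k : Type u) [Field k] (m : ℕ) : Type (u + 1) where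
  obj : Fin m → FGModuleCat.{u} k

variable (k : Type u) [Field k] (m : ℕ)

instance : Category.{u} (VectPow k m) where
  Hom X Y := ∀ i, X.obj i ⟶ Y.obj i
  id X := fun i => 𝟙 (X.obj i)
  comp f g := fun i => f i ≫ g i

instance (X Y : VectPow k m) : AddCommGroup (X ⟶ Y) :=
  inferInstanceAs (AddCommGroup (∀ i, X.obj i ⟶ Y.obj i))

instance (X Y : VectPow k m) : Module k (X ⟶ Y) :=
  inferInstanceAs (Module k (∀ i, X.obj i ⟶ Y.obj i))

instance : Preadditive (VectPow k m) where
  add_comp _ _ _ f f' g := funext fun i => Preadditive.add_comp _ _ _ (f i) (f' i) (g i)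
  comp_add _ _ _ f g g' := funext fun i => Preadditive.comp_add _ _ _ (f i) (g i) (g' i)

instance : Linear k (VectPow k m) where
  smul_comp _ _ _ r f g := funext fun i => Linear.smul_comp _ _ _ r (f i) (g i)
  comp_smul _ _ _ f r g := funext fun i => Linear.comp_smul _ _ _ (f i) r (g i)

variable {k m}

/-- The `i`-th simple object of `Vect^m`. -/
def simpleObj (k : Type u) [Field k] {m : ℕ} (i : Fin m) : VectPow k m where
  obj j := FGModuleCat.of k (PLift (j = i) → k)

/-- The morphism from the `i`-th simple object given by a vector. -/
def ofVec {Y : VectPow k m} {i : Fin m} (y : Y.obj i) : simpleObj k i ⟶ Y :=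
  fun j => FGModuleCat.ofHom (V := PLift (j = i) → k) (W := Y.obj j)
    (if h : j = i then
      (LinearMap.toSpanSingleton k (Y.obj j) (h ▸ y)).comp (LinearMap.proj (PLift.up h)) else 0)

/-- The morphism to the `i`-th simple object given by a linear functional. -/
def ofFun {Y : VectPow k m} {i : Fin m} (φ : Y.obj i →ₗ[k] k) : Y ⟶ simpleObj k i :=
  fun j => FGModuleCat.ofHom (V := Y.obj j) (W := PLift (j = i) → k)
    (LinearMap.pi fun h => by
      obtain ⟨rfl⟩ := h
      exact φ)

lemma vectPow_hom_ext {X Y : VectPow k m} {f g : X ⟶ Y}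
    (h : ∀ (i : Fin m) (x : X.obj i), (f i).hom.hom x = (g i).hom.hom x) : f = g :=
  funext fun i => FGModuleCat.hom_ext (LinearMap.ext (h i))

/-- Evaluation of a morphism at a vector, as an additive map. -/
def evalHom (X Y : VectPow k m) (i : Fin m) (x : X.obj i) : (X ⟶ Y) →+ Y.obj i where
  toFun f := (f i).hom.hom x
  map_zero' := rfl
  map_add' _ _ := rfl

lemma sum_ofFun_ofVec (Y : VectPow k m) :
    𝟙 Y = ∑ i : Fin m, ∑ a : Fin (Module.finrank k (Y.obj i)),
      ofFun ((Module.finBasis k (Y.obj i)).coord a) ≫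
        ofVec (Module.finBasis k (Y.obj i) a) := by
  refine vectPow_hom_ext fun j x => ?_
  refine show evalHom Y Y j x (𝟙 Y) = evalHom Y Y j x _ from ?_
  simp only [map_sum]
  rw [Finset.sum_eq_single j]
  · have : ∀ a, evalHom Y Y j x (ofFun ((Module.finBasis k (Y.obj j)).coord a) ≫
        ofVec (Module.finBasis k (Y.obj j) a)) =
        (Module.finBasis k (Y.obj j)).repr x a • Module.finBasis k (Y.obj j) a := by
      intro a
      change ((ofVec (Module.finBasis k (Y.obj j) a) : simpleObj k j ⟶ Y) j).hom.hom
        ((ofFun ((Module.finBasis k (Y.obj j)).coord a) j).hom.hom x) = _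
      change (if h : j = j then _ else _ : (PLift (j = j) → k) →ₗ[k] Y.obj j) _ = _
      rw [dif_pos rfl]
      rfl
    simp only [this]
    exact ((Module.finBasis k (Y.obj j)).sum_repr x).symm
  · intro i _ hi
    refine Finset.sum_eq_zero fun a _ => ?_
    change (if h : j = i then _ else 0 : (PLift (j = i) → k) →ₗ[k] Y.obj j) _ = _
    rw [dif_neg (Ne.symm hi)]
    rfl
  · simp

/-- A nonzero morphism from a simple object is a split monomorphism. -/
lemma exists_retraction {i : Fin m} {T : VectPow k m} (f : simpleObj k i ⟶ T) (hf : f ≠ 0) :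
    ∃ r : T ⟶ simpleObj k i, f ≫ r = 𝟙 _ := by
  have key : ∃ x : (simpleObj k i).obj i, (f i).hom.hom x ≠ 0 := by
    by_contra! hcon
    apply hf
    refine vectPow_hom_ext fun j x => ?_
    by_cases hj : j = i
    · subst hj
      exact hcon x
    · have : x = 0 := by
        funext h
        exact absurd h.down hj
      rw [this]
      exact (map_zero _).trans (map_zero _).symm
  let e : (simpleObj k i).obj i := (fun _ => (1 : k) : PLift (i = i) → k)
  have hx : ∀ x : (simpleObj k i).obj i,
      x = (show PLift (i = i) → k from x) ⟨rfl⟩ • e := by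
    intro x
    funext h
    exact (mul_one _).symm
  obtain ⟨x, hx0⟩ := key
  have he : (f i).hom.hom e ≠ 0 := by
    intro h0
    apply hx0
    rw [hx x, map_smul, h0, smul_zero]
  obtain ⟨φ, hφ⟩ := Module.Projective.exists_dual_eq_one k he
  refine ⟨ofFun φ, vectPow_hom_ext fun j x => ?_⟩
  by_cases hj : j = i
  · subst hj
    funext h
    change φ ((f j).hom.hom x) = (show PLift (j = j) → k from x) ⟨rfl⟩
    conv_lhs => rw [hx x, map_smul, map_smul, hφ]
    simp
  · funext h
    exact absurd h.down hj

/-- The endomorphisms of a simple object are scalars. -/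
lemma end_simpleObj {i : Fin m} (f : simpleObj k i ⟶ simpleObj k i) :
    ∃ c : k, f = c • 𝟙 (simpleObj k i) := by
  let e : (simpleObj k i).obj i := (fun _ => (1 : k) : PLift (i = i) → k)
  have hx : ∀ x : (simpleObj k i).obj i,
      x = (show PLift (i = i) → k from x) ⟨rfl⟩ • e := by
    intro x
    funext h
    exact (mul_one _).symm
  refine ⟨(show PLift (i = i) → k from (f i).hom.hom e) ⟨rfl⟩, vectPow_hom_ext fun j x => ?_⟩
  by_cases hj : j = i
  · subst hj
    conv_lhs => rw [hx x, map_smul, hx ((f j).hom.hom e)]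
    conv_rhs => rw [hx x]
    rw [smul_smul, mul_comm, mul_smul, map_smul, smul_comm]
    rfl
  · funext h
    exact absurd h.down hj

end VectPow

section Self

variable {k : Type u} [Field k] {m : ℕ} {G : Type*} [Group G]

/-- The functors of a 2-representation are equivalences. -/
lemma isEquivalence {V : Type*} [Category V] [Preadditive V] [Linear k V]
    (ρ : TwoRep k G V) (g : G) : (ρ.F g).IsEquivalence :=
  Functor.IsEquivalence.mk' (ρ.F g⁻¹)
    (ρ.oneIso.symm ≪≫ (ρ.mulIso' (inv_mul_cancel g)).symm)
    (ρ.mulIso' (mul_inv_cancel g) ≪≫ ρ.oneIso)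

/-- For a 2-representation on `Vect^m`, an element `ξ` of `X_ρ(g)` commutes with `ρ(g)`. -/
lemma char_comm (ρ : TwoRep k G (VectPow k m)) {g : G} (ξ : ρ.Char g) (Y : VectPow k m) :
    ξ.app ((ρ.F g).obj Y) = (ρ.F g).map (ξ.app Y) := by
  have := ρ.isEquivalence g
  -- first the simple objects
  have simple : ∀ i : Fin m, ξ.app ((ρ.F g).obj (simpleObj k i)) =
      (ρ.F g).map (ξ.app (simpleObj k i)) := by
    intro i
    have iso : ∀ α : simpleObj k i ⟶ (ρ.F g).obj (simpleObj k i), α ≠ 0 →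
        ∃ r, r ≫ α = 𝟙 _ := by
      intro α hα
      obtain ⟨r, hr⟩ := exists_retraction α hα
      obtain ⟨f, hf⟩ := (ρ.F g).map_surjective (r ≫ α)
      obtain ⟨c, rfl⟩ := end_simpleObj f
      rw [Functor.map_smul, CategoryTheory.Functor.map_id] at hf
      refine ⟨r, ?_⟩
      have h1 : α = c • α := by
        calc α = α ≫ r ≫ α := by rw [reassoc_of% hr]
          _ = c • α := by rw [← hf]; simp
      have h2 : c = 1 := by
        have h3 : (c - 1) • α = 0 := by rw [sub_smul, one_smul, ← h1, sub_self]
        rcases smul_eq_zero.mp h3 with h | h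
        · exact sub_eq_zero.mp h
        · exact absurd h hα
      rw [← hf, h2, one_smul]
    obtain ⟨β, hβ⟩ := (ρ.F g).map_surjective (ξ.app ((ρ.F g).obj (simpleObj k i)))
    by_cases h0 : ξ.app (simpleObj k i) = 0
    · rw [h0, Functor.map_zero]
      by_cases hb : β = 0
      · rw [← hβ, hb, Functor.map_zero]
      · obtain ⟨r, hr⟩ := iso β hb
        have n := ξ.naturality β
        dsimp at n
        rw [h0, Limits.zero_comp] at n
        calc ξ.app ((ρ.F g).obj (simpleObj k i))
            = (r ≫ β) ≫ ξ.app ((ρ.F g).obj (simpleObj k i)) := by rw [hr, Category.id_comp]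
          _ = 0 := by rw [Category.assoc, n, Limits.comp_zero]
    · obtain ⟨r, hr⟩ := iso _ h0
      have n := ξ.naturality (ξ.app (simpleObj k i))
      dsimp at n
      calc ξ.app ((ρ.F g).obj (simpleObj k i))
          = (r ≫ ξ.app (simpleObj k i)) ≫ ξ.app ((ρ.F g).obj (simpleObj k i)) := by
            rw [hr, Category.id_comp]
        _ = (r ≫ ξ.app (simpleObj k i)) ≫ (ρ.F g).map (ξ.app (simpleObj k i)) := by
            rw [Category.assoc, n, Category.assoc]
        _ = _ := by rw [hr, Category.id_comp]
  have nat : ∀ {Z : VectPow k m} (f : Y ⟶ Z), (ρ.F g).map f ≫ ξ.app ((ρ.F g).obj Z) =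
      ξ.app ((ρ.F g).obj Y) ≫ (ρ.F g).map ((ρ.F g).map f) := fun f => ξ.naturality _
  have nat' : ∀ {Z : VectPow k m} (f : Y ⟶ Z), (ρ.F g).map f ≫ (ρ.F g).map (ξ.app Z) =
      (ρ.F g).map (ξ.app Y) ≫ (ρ.F g).map ((ρ.F g).map f) := fun f => by
    rw [← Functor.map_comp, ← Functor.map_comp]
    exact congrArg _ (ξ.naturality f)
  rw [← Category.comp_id (ξ.app ((ρ.F g).obj Y)), ← Category.comp_id ((ρ.F g).map (ξ.app Y)),
    ← CategoryTheory.Functor.map_id, ← CategoryTheory.Functor.map_id, sum_ofFun_ofVec Y]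
  simp only [Functor.map_sum, Preadditive.comp_sum, Functor.map_comp]
  refine Finset.sum_congr rfl fun i _ => Finset.sum_congr rfl fun a _ => ?_
  rw [← reassoc_of% (nat (ofFun _)), ← reassoc_of% (nat' (ofFun _)), simple]

/-- On `Vect^m`, the element `ψ_g` acts trivially on `X_ρ(g)`. -/
lemma conj_self (ρ : TwoRep k G (VectPow k m)) {g : G} (e : g * g * g⁻¹ = g) (ξ : ρ.Char g) :
    ρ.conj e ξ = ξ := by
  symm
  refine ρ.eq_conj e rfl rfl ξ ξ fun Y => ?_
  rw [char_comm]

/-- `g` as an element of the centralizer of `g ^ r`. -/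
def genC (g : G) (r : ℕ) : Subgroup.centralizer ({g ^ r} : Set G) :=
  ⟨g, Subgroup.mem_centralizer_singleton_iff.mpr (by rw [← pow_succ, ← pow_succ'])⟩

/-- The action of `ψ_g` on `X_ρ(g^r)`, as an invertible operator. -/
def genOp (ρ : TwoRep k G (VectPow k m)) (g : G) (r : ℕ) : (Module.End k (ρ.Char (g ^ r)))ˣ :=
  (ρ.charRep (g ^ r)).toHomUnits (genC g r)

lemma genOp_pow (ρ : TwoRep k G (VectPow k m)) (g : G) (r : ℕ) : genOp ρ g r ^ r = 1 := by
  rw [genOp, ← map_pow]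
  ext1
  refine LinearMap.ext fun ξ => ?_
  exact ρ.conj_self (g := g ^ r) (by group) ξ

/-- The action of `ℤ/r` on `X_ρ(g^r)`: the generator acts by `ψ_g`.  In terms of the matrix
`(V_{i,j})` of `ρ(g)` one has `X_ρ(g^r) ≅ ⨁ V_{i₁,i₂} ⊗ V_{i₂,i₃} ⊗ ⋯ ⊗ V_{i_r,i₁}` and `ψ_g`
is the cyclic permutation of the tensor factors. -/
def cyclicRep (ρ : TwoRep k G (VectPow k m)) (g : G) (r : ℕ) :
    Representation k (Multiplicative (ZMod r)) (ρ.Char (g ^ r)) :=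
  (Units.coeHom _).comp (AddMonoidHom.toMultiplicativeLeft (ZMod.lift r
    ⟨(zmultiplesHom (Additive (Module.End k (ρ.Char (g ^ r)))ˣ)) (Additive.ofMul (genOp ρ g r)), by
      change ((r : ℤ) • Additive.ofMul (genOp ρ g r) : Additive _) = 0
      rw [natCast_zsmul, ← ofMul_pow, genOp_pow, ofMul_one]⟩))

lemma cyclicRep_one (ρ : TwoRep k G (VectPow k m)) (g : G) (r : ℕ) :
    cyclicRep ρ g r (Multiplicative.ofAdd 1) = ρ.charRep (g ^ r) (genC g r) := by
  have h1 : (1 : ZMod r) = ((1 : ℤ) : ZMod r) := by simp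
  rw [h1, cyclicRep, MonoidHom.comp_apply, AddMonoidHom.toMultiplicativeLeft_apply_apply,
    toAdd_ofAdd, ZMod.lift_coe]
  simp [genOp]

end Self

section Equivariant

variable {k : Type*} [Field k] {H : Type*} [Group H] {G : Type*} [Group G]
  {V : Type*} [Category V] [Preadditive V] [Linear k V]

/-- The category `V^H` of `H`-equivariant objects: objects `X` with isomorphisms
`ε_s : X ≅ τ(s)(X)` such that `ε_{st} = φ_{s,t} ∘ τ(s)(ε_t) ∘ ε_s`. -/
structure Equivariant (τ : TwoRep k H V) where
  obj : V
  ε : ∀ s : H, obj ≅ (τ.F s).obj obj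
  ε_mul : ∀ s t : H,
    (ε (s * t)).hom = (ε s).hom ≫ (τ.F s).map (ε t).hom ≫ (τ.mulIso s t).hom.app obj

namespace Equivariant

variable {τ : TwoRep k H V}

/-- Morphisms of equivariant objects: morphisms compatible with the `ε_s`. -/
@[ext]
structure Hom (X Y : Equivariant τ) where
  hom : X.obj ⟶ Y.obj
  comm : ∀ s, hom ≫ (Y.ε s).hom = (X.ε s).hom ≫ (τ.F s).map hom

instance : Category (Equivariant τ) where
  Hom := Hom
  id X := ⟨𝟙 X.obj, fun s => by simp⟩
  comp f g := ⟨f.hom ≫ g.hom, fun s => by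
    rw [Category.assoc, g.comm, ← Category.assoc, f.comm, Functor.map_comp, Category.assoc]⟩

@[ext]
lemma hom_ext {X Y : Equivariant τ} {f g : X ⟶ Y} (h : f.hom = g.hom) : f = g := Hom.ext h

@[simp] lemma id_hom (X : Equivariant τ) : Hom.hom (𝟙 X) = 𝟙 X.obj := rfl

@[simp] lemma comp_hom {X Y Z : Equivariant τ} (f : X ⟶ Y) (g : Y ⟶ Z) :
    (f ≫ g).hom = f.hom ≫ g.hom := rfl

/-- The morphisms `X ⟶ Y` as a linear subspace of the morphisms of underlying objects. -/
def homSubmodule (X Y : Equivariant τ) : Submodule k (X.obj ⟶ Y.obj) where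
  carrier := {f | ∀ s, f ≫ (Y.ε s).hom = (X.ε s).hom ≫ (τ.F s).map f}
  add_mem' hf hg s := by simp [hf s, hg s]
  zero_mem' s := by simp
  smul_mem' c f hf s := by simp [hf s]

/-- Morphisms of equivariant objects are the elements of `homSubmodule`. -/
def homEquiv (X Y : Equivariant τ) : (X ⟶ Y) ≃ homSubmodule X Y where
  toFun f := ⟨f.hom, f.comm⟩
  invFun f := ⟨f.1, f.2⟩

instance (X Y : Equivariant τ) : AddCommGroup (X ⟶ Y) := (homEquiv X Y).addCommGroup

instance (X Y : Equivariant τ) : Module k (X ⟶ Y) := (homEquiv X Y).module k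

@[simp] lemma add_hom {X Y : Equivariant τ} (f g : X ⟶ Y) : (f + g).hom = f.hom + g.hom := rfl

@[simp] lemma smul_hom {X Y : Equivariant τ} (c : k) (f : X ⟶ Y) :
    (c • f).hom = c • f.hom := rfl

instance : Preadditive (Equivariant τ) where
  add_comp _ _ _ f f' g := hom_ext (Preadditive.add_comp _ _ _ f.hom f'.hom g.hom)
  comp_add _ _ _ f g g' := hom_ext (Preadditive.comp_add _ _ _ f.hom g.hom g'.hom)

instance : Linear k (Equivariant τ) where
  smul_comp _ _ _ r f g := hom_ext (Linear.smul_comp _ _ _ r f.hom g.hom)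
  comp_smul _ _ _ f r g := hom_ext (Linear.comp_smul _ _ _ f.hom r g.hom)

/-- An isomorphism of underlying objects that is compatible with the `ε_s`. -/
@[simps]
def isoMk {X Y : Equivariant τ} (e : X.obj ≅ Y.obj)
    (h : ∀ s, e.hom ≫ (Y.ε s).hom = (X.ε s).hom ≫ (τ.F s).map e.hom) : X ≅ Y where
  hom := ⟨e.hom, h⟩
  inv := ⟨e.inv, fun s => by
    rw [← cancel_epi e.hom, reassoc_of% (h s), ← Functor.map_comp]
    simp⟩
  hom_inv_id := by ext; simp
  inv_hom_id := by ext; simp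

end Equivariant

/-- Commutation data for an action `τ` of `H` and an action `ρ` of `G` on the same category:
isomorphisms `ρ(g) τ(s) ≅ τ(s) ρ(g)` compatible with all structure isomorphisms. -/
structure Commuting (τ : TwoRep k H V) (ρ : TwoRep k G V) where
  c : ∀ s g, τ.F s ⋙ ρ.F g ≅ ρ.F g ⋙ τ.F s
  mul_left : ∀ s t g X, (ρ.F g).map ((τ.mulIso s t).hom.app X) ≫ (c (s * t) g).hom.app X =
    (c s g).hom.app ((τ.F t).obj X) ≫ (τ.F s).map ((c t g).hom.app X) ≫
      (τ.mulIso s t).hom.app ((ρ.F g).obj X)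
  mul_right : ∀ s g h X, (ρ.mulIso g h).hom.app ((τ.F s).obj X) ≫ (c s (g * h)).hom.app X =
    (ρ.F g).map ((c s h).hom.app X) ≫ (c s g).hom.app ((ρ.F h).obj X) ≫
      (τ.F s).map ((ρ.mulIso g h).hom.app X)
  one_right : ∀ s X, (c s 1).hom.app X ≫ (τ.F s).map (ρ.oneIso.hom.app X) =
    ρ.oneIso.hom.app ((τ.F s).obj X)

namespace Commuting

variable {τ : TwoRep k H V} {ρ : TwoRep k G V} (C : Commuting τ ρ)

/-- The functor `(X, ε) ↦ (ρ(g)(X), ρ(g)(ε))` on equivariant objects. -/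
@[simps]
def functor (g : G) : Equivariant τ ⥤ Equivariant τ where
  obj X :=
    { obj := (ρ.F g).obj X.obj
      ε := fun s => (ρ.F g).mapIso (X.ε s) ≪≫ (C.c s g).app X.obj
      ε_mul := fun s t => by
        have n := (C.c s g).hom.naturality (X.ε t).hom
        dsimp at n ⊢
        rw [X.ε_mul, Functor.map_comp, Functor.map_comp, Functor.map_comp]
        simp only [Category.assoc]
        rw [C.mul_left, reassoc_of% n] }
  map {X Y} f :=
    { hom := (ρ.F g).map f.hom
      comm := fun s => by
        have n := (C.c s g).hom.naturality f.hom
        dsimp at n ⊢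
        rw [← Functor.map_comp_assoc, f.comm, Functor.map_comp_assoc, n, Category.assoc] }
  map_id X := by ext; simp
  map_comp f g := by ext; simp

lemma eqToHom_hom {ι : Type*} (Y : ι → Equivariant τ) {a b : ι} (e : a = b) :
    Equivariant.Hom.hom (eqToHom (congrArg Y e)) =
      eqToHom (congrArg (fun i => (Y i).obj) e) := by
  subst e; rfl

lemma mul_comm_ε (g h : G) (s : H) (X : Equivariant τ) :
    (ρ.mulIso g h).hom.app X.obj ≫ (ρ.F (g * h)).map (X.ε s).hom ≫
        (C.c s (g * h)).hom.app X.obj =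
      ((ρ.F g).map ((ρ.F h).map (X.ε s).hom ≫ (C.c s h).hom.app X.obj) ≫
        (C.c s g).hom.app ((ρ.F h).obj X.obj)) ≫
          (τ.F s).map ((ρ.mulIso g h).hom.app X.obj) := by
  have n := (ρ.mulIso g h).hom.naturality (X.ε s).hom
  dsimp at n
  rw [← reassoc_of% n, C.mul_right]
  simp

lemma one_comm_ε (s : H) (X : Equivariant τ) :
    ρ.oneIso.hom.app X.obj ≫ (X.ε s).hom =
      ((ρ.F 1).map (X.ε s).hom ≫ (C.c s 1).hom.app X.obj) ≫
        (τ.F s).map (ρ.oneIso.hom.app X.obj) := by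
  have n := ρ.oneIso.hom.naturality (X.ε s).hom
  dsimp at n
  rw [← n, Category.assoc, C.one_right]

/-- The residual action of `G` on the category of `H`-equivariant objects. -/
def residual : TwoRep k G (Equivariant τ) where
  F := C.functor
  additive g := { map_add := Equivariant.hom_ext (ρ.F g).map_add }
  linear g := { map_smul := fun f r => Equivariant.hom_ext ((ρ.F g).map_smul r f.hom) }
  mulIso g h := NatIso.ofComponents
    (fun X => Equivariant.isoMk ((ρ.mulIso g h).app X.obj) fun s => C.mul_comm_ε g h s X)
    (fun f => Equivariant.hom_ext ((ρ.mulIso g h).hom.naturality f.hom))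
  oneIso := NatIso.ofComponents
    (fun X => Equivariant.isoMk (ρ.oneIso.app X.obj) fun s => C.one_comm_ε s X)
    (fun f => Equivariant.hom_ext (ρ.oneIso.hom.naturality f.hom))
  assoc g h l X := by
    ext
    simp only [NatIso.ofComponents_hom_app, Equivariant.comp_hom]
    rw [eqToHom_hom (fun x => (C.functor x).obj X) (mul_assoc g h l).symm]
    exact ρ.assoc g h l X.obj
  one_left g X := by
    ext
    simp only [NatIso.ofComponents_hom_app, Equivariant.comp_hom]
    rw [eqToHom_hom (fun x => (C.functor x).obj X) (one_mul g).symm]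
    exact ρ.one_left g X.obj
  one_right g X := by
    ext
    simp only [NatIso.ofComponents_hom_app, Equivariant.comp_hom]
    rw [eqToHom_hom (fun x => (C.functor x).obj X) (mul_one g).symm]
    exact ρ.one_right g X.obj

end Commuting

end Equivariant

section Mat

variable {k : Type*} [Field k] {C : Type*} [Category C] [Preadditive C] [Linear k C]

instance (M N : Mat_ C) : Module k (M ⟶ N) :=
  inferInstanceAs (Module k (∀ (i : M.ι) (j : N.ι), M.X i ⟶ N.X j))

lemma mat_smul_apply {M N : Mat_ C} (c : k) (f : M ⟶ N) (i j) : (c • f) i j = c • f i j := rfl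

instance : Linear k (Mat_ C) where
  smul_comp _ _ _ r f g := by
    ext i j
    simp [mat_smul_apply, Finset.smul_sum]
  comp_smul _ _ _ f r g := by
    ext i j
    simp [mat_smul_apply, Finset.smul_sum]

open scoped Classical in
/-- The diagonal matrix with entries `f i`. -/
def diag {ι : Type} [Fintype ι] {X Y : ι → C} (f : ∀ i, X i ⟶ Y i) :
    (Mat_.mk ι X : Mat_ C) ⟶ Mat_.mk ι Y :=
  fun i j => if h : i = j then f i ≫ eqToHom (congrArg Y h) else 0

variable {ι : Type} [Fintype ι] {X Y Z : ι → C}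

lemma comp_diag (M : Mat_ C) (A : M ⟶ Mat_.mk ι X) (f : ∀ i, X i ⟶ Y i) (i : M.ι) (j : ι) :
    (A ≫ diag f) i j = A i j ≫ f j := by
  classical
  rw [Mat_.comp_apply, Finset.sum_eq_single j]
  · simp [diag]
  · intro b _ hb
    simp [diag, hb]
  · simp

lemma diag_comp (M : Mat_ C) (f : ∀ i, X i ⟶ Y i) (A : Mat_.mk ι Y ⟶ M) (i : ι) (j : M.ι) :
    (diag f ≫ A) i j = f i ≫ A i j := by
  classical
  rw [Mat_.comp_apply, Finset.sum_eq_single i]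
  · simp [diag]
  · intro b _ hb
    simp [diag, Ne.symm hb]
  · simp

lemma diag_comp_diag (f : ∀ i, X i ⟶ Y i) (g : ∀ i, Y i ⟶ Z i) :
    (diag f ≫ diag g : (Mat_.mk ι X : Mat_ C) ⟶ Mat_.mk ι Z) = diag fun i => f i ≫ g i := by
  ext i j
  rw [comp_diag]
  by_cases h : i = j
  · subst h; simp [diag]
  · simp [diag, h]

lemma diag_id : diag (fun i => 𝟙 (X i)) = 𝟙 (Mat_.mk ι X : Mat_ C) := by
  ext i j
  by_cases h : i = j
  · subst h; simp [diag]
  · simp [diag, h]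

lemma map_diag {D : Type*} [Category D] [Preadditive D] (F : C ⥤ D) [F.Additive]
    (f : ∀ i, X i ⟶ Y i) :
    F.mapMat_.map (diag f) = diag fun i => F.map (f i) := by
  refine Mat_.hom_ext _ _ fun i j => ?_
  change ι at i j
  change F.map (diag f i j) = diag (fun i => F.map (f i)) i j
  by_cases h : i = j
  · subst h; simp [diag]
  · simp [diag, h]

lemma eqToHom_diag {J : Type*} (Y : J → ι → C) {a b : J} (e : a = b) :
    (eqToHom (congrArg (fun x => (Mat_.mk ι (Y x) : Mat_ C)) e)) =
      diag fun i => eqToHom (congrArg (fun x => Y x i) e) := by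
  subst e; simp [diag_id]

/-- A diagonal matrix of isomorphisms. -/
@[simps]
def diagIso (f : ∀ i, X i ≅ Y i) : (Mat_.mk ι X : Mat_ C) ≅ Mat_.mk ι Y where
  hom := diag fun i => (f i).hom
  inv := diag fun i => (f i).inv
  hom_inv_id := by rw [diag_comp_diag]; simp [diag_id]
  inv_hom_id := by rw [diag_comp_diag]; simp [diag_id]

/-- The extension of a 2-representation to formal direct sums, by additivity. -/
def mat {G : Type*} [Group G] (ρ : TwoRep k G C) : TwoRep k G (Mat_ C) where
  F g := (ρ.F g).mapMat_
  additive g := { map_add := Mat_.hom_ext _ _ fun _ _ => (ρ.F g).map_add }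
  linear g := { map_smul := fun f r => Mat_.hom_ext _ _ fun i j => (ρ.F g).map_smul r (f i j) }
  mulIso g h := NatIso.ofComponents (fun M => diagIso fun i => (ρ.mulIso g h).app (M.X i))
    fun {M N} f => by
      ext i j
      refine (comp_diag _ _ _ i j).trans (Eq.trans ?_ (diag_comp _ _ _ i j).symm)
      exact (ρ.mulIso g h).hom.naturality (f i j)
  oneIso := NatIso.ofComponents (fun M => diagIso fun i => ρ.oneIso.app (M.X i))
    fun {M N} f => by
      ext i j
      refine (comp_diag _ _ _ i j).trans (Eq.trans ?_ (diag_comp _ _ _ i j).symm)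
      exact ρ.oneIso.hom.naturality (f i j)
  assoc g h l M := by
    refine (diag_comp_diag _ _).trans ?_
    refine Eq.trans ?_ (congrArg₂ (· ≫ ·) (map_diag (ρ.F g) _).symm
      (congrArg₂ (· ≫ ·) rfl
        (eqToHom_diag (fun x i => (ρ.F x).obj (M.X i)) (mul_assoc g h l).symm).symm))
    refine Eq.trans ?_ (congrArg₂ (· ≫ ·) rfl (diag_comp_diag _ _).symm)
    refine Eq.trans ?_ (diag_comp_diag _ _).symm
    exact congrArg diag (funext fun i => ρ.assoc g h l (M.X i))
  one_left g M := by
    refine Eq.trans ?_ (congrArg₂ (· ≫ ·) rfl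
        (eqToHom_diag (fun x i => (ρ.F x).obj (M.X i)) (one_mul g).symm).symm)
    refine Eq.trans ?_ (diag_comp_diag _ _).symm
    exact congrArg diag (funext fun i => ρ.one_left g (M.X i))
  one_right g M := by
    refine Eq.trans ?_ (congrArg₂ (· ≫ ·) (map_diag (ρ.F g) _).symm
        (eqToHom_diag (fun x i => (ρ.F x).obj (M.X i)) (mul_one g).symm).symm)
    refine Eq.trans ?_ (diag_comp_diag _ _).symm
    exact congrArg diag (funext fun i => ρ.one_right g (M.X i))

/-- The extension of commutation isomorphisms to formal direct sums. -/
def matComm {F F' E E' : C ⥤ C} [F.Additive] [F'.Additive] [E.Additive] [E'.Additive]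
    (α : F ⋙ F' ≅ E ⋙ E') : F.mapMat_ ⋙ F'.mapMat_ ≅ E.mapMat_ ⋙ E'.mapMat_ :=
  NatIso.ofComponents (fun M => diagIso fun i => α.app (M.X i))
    fun {M N} f => by
      ext i j
      refine (comp_diag _ _ _ i j).trans (Eq.trans ?_ (diag_comp _ _ _ i j).symm)
      exact α.hom.naturality (f i j)

/-- The extension of commutation data to formal direct sums. -/
def Commuting.mat {H G : Type*} [Group H] [Group G] {τ : TwoRep k H C} {ρ : TwoRep k G C}
    (K : Commuting τ ρ) : Commuting τ.mat ρ.mat where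
  c s g := matComm (K.c s g)
  mul_left s t g M := by
    refine (congrArg₂ (· ≫ ·) (map_diag (ρ.F g) _) rfl).trans ?_
    refine (diag_comp_diag _ _).trans ?_
    refine Eq.trans ?_ (congrArg₂ (· ≫ ·) rfl
      (congrArg₂ (· ≫ ·) (map_diag (τ.F s) _).symm rfl))
    refine Eq.trans ?_ (congrArg₂ (· ≫ ·) rfl (diag_comp_diag _ _).symm)
    refine Eq.trans ?_ (diag_comp_diag _ _).symm
    exact congrArg diag (funext fun i => K.mul_left s t g (M.X i))
  mul_right s g h M := by
    refine (diag_comp_diag _ _).trans ?_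
    refine Eq.trans ?_ (congrArg₂ (· ≫ ·) (map_diag (ρ.F g) _).symm
      (congrArg₂ (· ≫ ·) rfl (map_diag (τ.F s) _).symm))
    refine Eq.trans ?_ (congrArg₂ (· ≫ ·) rfl (diag_comp_diag _ _).symm)
    refine Eq.trans ?_ (diag_comp_diag _ _).symm
    exact congrArg diag (funext fun i => K.mul_right s g h (M.X i))
  one_right s M := by
    refine (congrArg₂ (· ≫ ·) rfl (map_diag (τ.F s) _)).trans ?_
    refine (diag_comp_diag _ _).trans ?_
    exact congrArg diag (funext fun i => K.one_right s (M.X i))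

end Mat

section TensorWord

open scoped TensorProduct

/-- Formal tensor products `V₁ ⊠ ⋯ ⊠ V_n` of objects of `V`. -/
@[ext]
structure _root_.TensorWord (k : Type*) (V : Type*) (n : ℕ) where
  X : Fin n → V

variable {k : Type*} [Field k] {V : Type*} [Category V] [Preadditive V] [Linear k V] {n : ℕ}

/-- Composition in `V` as a bilinear map. -/
def compBilin (k : Type*) [Field k] {V : Type*} [Category V] [Preadditive V] [Linear k V]
    (X Y Z : V) : (X ⟶ Y) →ₗ[k] (Y ⟶ Z) →ₗ[k] (X ⟶ Z) :=
  LinearMap.mk₂ k (fun f g => f ≫ g) (by simp) (by simp) (by simp) (by simp)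

/-- Composition `(⨂ f_a) ≫ (⨂ g_a) = ⨂ (f_a ≫ g_a)` of tensors of morphisms. -/
def wordComp (X Y Z : Fin n → V) :
    (⨂[k] a, (X a ⟶ Y a)) →ₗ[k] (⨂[k] a, (Y a ⟶ Z a)) →ₗ[k] (⨂[k] a, (X a ⟶ Z a)) :=
  PiTensorProduct.map₂ fun a => compBilin k (X a) (Y a) (Z a)

@[simp] lemma wordComp_tprod {X Y Z : Fin n → V} (f : ∀ a, X a ⟶ Y a) (g : ∀ a, Y a ⟶ Z a) :
    wordComp X Y Z (PiTensorProduct.tprod k f) (PiTensorProduct.tprod k g) =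
      PiTensorProduct.tprod k fun a => f a ≫ g a :=
  PiTensorProduct.map₂_tprod_tprod _ _ _

lemma word_ind {ι : Type*} {M : ι → Type*} [∀ a, AddCommGroup (M a)] [∀ a, Module k (M a)]
    {N : Type*} [AddCommGroup N] [Module k N] {p q : (⨂[k] a, M a) →ₗ[k] N}
    (h : ∀ f, p (PiTensorProduct.tprod k f) = q (PiTensorProduct.tprod k f))
    (x : ⨂[k] a, M a) : p x = q x :=
  LinearMap.congr_fun (PiTensorProduct.ext (MultilinearMap.ext h)) x

lemma word_ind₂ {ι : Type*} {M M' : ι → Type*} [∀ a, AddCommGroup (M a)] [∀ a, Module k (M a)]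
    [∀ a, AddCommGroup (M' a)] [∀ a, Module k (M' a)]
    {N : Type*} [AddCommGroup N] [Module k N] {p q : (⨂[k] a, M a) →ₗ[k] (⨂[k] a, M' a) →ₗ[k] N}
    (h : ∀ f g, p (PiTensorProduct.tprod k f) (PiTensorProduct.tprod k g) =
      q (PiTensorProduct.tprod k f) (PiTensorProduct.tprod k g))
    (x : ⨂[k] a, M a) (y : ⨂[k] a, M' a) : p x y = q x y := by
  have : p = q := PiTensorProduct.ext (MultilinearMap.ext fun f =>
    PiTensorProduct.ext (MultilinearMap.ext fun g => h f g))
  rw [this]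

lemma wordComp_assoc {W X Y Z : Fin n → V} (f : ⨂[k] a, (W a ⟶ X a)) (g : ⨂[k] a, (X a ⟶ Y a))
    (h : ⨂[k] a, (Y a ⟶ Z a)) :
    wordComp W Y Z (wordComp W X Y f g) h = wordComp W X Z f (wordComp X Y Z g h) := by
  have h1 : ∀ f : ∀ a, W a ⟶ X a, wordComp W Y Z (wordComp W X Y (PiTensorProduct.tprod k f) g) h =
      wordComp W X Z (PiTensorProduct.tprod k f) (wordComp X Y Z g h) := fun f =>
    word_ind₂ (p := wordComp W Y Z ∘ₗ wordComp W X Y (PiTensorProduct.tprod k f))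
      (q := (wordComp X Y Z).compr₂ (wordComp W X Z (PiTensorProduct.tprod k f)))
      (fun g h => by simp) g h
  exact word_ind (p := (wordComp W Y Z).flip h ∘ₗ (wordComp W X Y).flip g)
    (q := (wordComp W X Z).flip (wordComp X Y Z g h)) (fun f => h1 f) f

lemma wordComp_id_left {X Y : Fin n → V} (f : ⨂[k] a, (X a ⟶ Y a)) :
    wordComp X X Y (PiTensorProduct.tprod k fun a => 𝟙 (X a)) f = f :=
  word_ind (p := wordComp X X Y _) (q := LinearMap.id) (fun f => by simp) f

lemma wordComp_id_right {X Y : Fin n → V} (f : ⨂[k] a, (X a ⟶ Y a)) :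
    wordComp X Y Y f (PiTensorProduct.tprod k fun a => 𝟙 (Y a)) = f :=
  word_ind (p := (wordComp X Y Y).flip _) (q := LinearMap.id) (fun f => by simp) f

/-- `Hom(V₁ ⊠ ⋯ ⊠ V_n, W₁ ⊠ ⋯ ⊠ W_n) = Hom(V₁, W₁) ⊗ ⋯ ⊗ Hom(V_n, W_n)`. -/
instance : Category (TensorWord k V n) where
  Hom X Y := ⨂[k] a, (X.X a ⟶ Y.X a)
  id X := PiTensorProduct.tprod k fun a => 𝟙 (X.X a)
  comp f g := wordComp _ _ _ f g
  id_comp f := wordComp_id_left f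
  comp_id f := wordComp_id_right f
  assoc f g h := wordComp_assoc f g h

instance (X Y : TensorWord k V n) : AddCommGroup (X ⟶ Y) :=
  inferInstanceAs (AddCommGroup (⨂[k] a, (X.X a ⟶ Y.X a)))

instance (X Y : TensorWord k V n) : Module k (X ⟶ Y) :=
  inferInstanceAs (Module k (⨂[k] a, (X.X a ⟶ Y.X a)))

instance : Preadditive (TensorWord k V n) where
  add_comp X Y Z f f' g := by
    change wordComp X.X Y.X Z.X (f + f') g = wordComp X.X Y.X Z.X f g + wordComp X.X Y.X Z.X f' g
    rw [map_add]; rfl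
  comp_add X Y Z f g g' := (wordComp X.X Y.X Z.X f).map_add g g'

instance : Linear k (TensorWord k V n) where
  smul_comp X Y Z r f g := by
    change wordComp X.X Y.X Z.X (r • f) g = r • wordComp X.X Y.X Z.X f g
    rw [map_smul]; rfl
  comp_smul X Y Z f r g := (wordComp X.X Y.X Z.X f).map_smul r g

/-- The pure tensor of a family of morphisms. -/
def pureHom {X Y : TensorWord k V n} (f : ∀ a, X.X a ⟶ Y.X a) : X ⟶ Y :=
  PiTensorProduct.tprod k f

lemma pureHom_comp {X Y Z : TensorWord k V n} (f : ∀ a, X.X a ⟶ Y.X a)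
    (g : ∀ a, Y.X a ⟶ Z.X a) : pureHom f ≫ pureHom g = pureHom fun a => f a ≫ g a :=
  wordComp_tprod f g

lemma pureHom_id (X : TensorWord k V n) : pureHom (fun a => 𝟙 (X.X a)) = 𝟙 X := rfl

lemma pureHom_square {W X Y Z : TensorWord k V n} {f : ∀ a, W.X a ⟶ X.X a}
    {g : ∀ a, X.X a ⟶ Z.X a} {f' : ∀ a, W.X a ⟶ Y.X a} {g' : ∀ a, Y.X a ⟶ Z.X a}
    (h : ∀ a, f a ≫ g a = f' a ≫ g' a) : pureHom f ≫ pureHom g = pureHom f' ≫ pureHom g' := by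
  rw [pureHom_comp, pureHom_comp]
  exact congrArg pureHom (funext h)

lemma eqToHom_pureHom {J : Type*} (Y : J → Fin n → V) {a b : J} (e : a = b) :
    eqToHom (congrArg (fun x => (⟨Y x⟩ : TensorWord k V n)) e) =
      pureHom fun i => eqToHom (congrArg (fun x => Y x i) e) := by
  subst e; rfl

/-- The functor `V₁ ⊠ ⋯ ⊠ V_n ↦ F(V₁) ⊠ ⋯ ⊠ F(V_n)`. -/
def wordMap (F : V ⥤ V) [F.Additive] [F.Linear k] : TensorWord k V n ⥤ TensorWord k V n where
  obj X := ⟨fun a => F.obj (X.X a)⟩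
  map {X Y} f := PiTensorProduct.map (fun a => F.mapLinearMap k (X := X.X a) (Y := Y.X a)) f
  map_id X := by
    refine (PiTensorProduct.map_tprod _ _).trans ?_
    exact congrArg _ (funext fun a => F.map_id _)
  map_comp {X Y Z} f g :=
    word_ind₂ (p := (wordComp X.X Y.X Z.X).compr₂ (PiTensorProduct.map
        (fun a => F.mapLinearMap k (X := X.X a) (Y := Z.X a))))
      (q := (wordComp (fun a => F.obj (X.X a)) (fun a => F.obj (Y.X a))
        (fun a => F.obj (Z.X a))).compl₁₂
        (PiTensorProduct.map (fun a => F.mapLinearMap k (X := X.X a) (Y := Y.X a)))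
        (PiTensorProduct.map (fun a => F.mapLinearMap k (X := Y.X a) (Y := Z.X a))))
      (fun f g => by simp) f g

lemma wordMap_pureHom (F : V ⥤ V) [F.Additive] [F.Linear k] {X Y : TensorWord k V n}
    (f : ∀ a, X.X a ⟶ Y.X a) :
    (wordMap F).map (pureHom f) = pureHom (X := (wordMap F).obj X) (Y := (wordMap F).obj Y)
      fun a => F.map (f a) :=
  PiTensorProduct.map_tprod _ _

instance (F : V ⥤ V) [F.Additive] [F.Linear k] :
    (wordMap F : TensorWord k V n ⥤ _).Additive where
  map_add {_ _ f g} := map_add (PiTensorProduct.map fun _ => F.mapLinearMap k) f g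

instance (F : V ⥤ V) [F.Additive] [F.Linear k] :
    (wordMap F : TensorWord k V n ⥤ _).Linear k where
  map_smul f r := map_smul (PiTensorProduct.map fun _ => F.mapLinearMap k) r f

/-- The functor `V₁ ⊠ ⋯ ⊠ V_n ↦ V_{σ⁻¹(1)} ⊠ ⋯ ⊠ V_{σ⁻¹(n)}`. -/
def wordPerm (σ : Equiv.Perm (Fin n)) : TensorWord k V n ⥤ TensorWord k V n where
  obj X := ⟨fun a => X.X (σ⁻¹ a)⟩
  map {X Y} f := PiTensorProduct.reindex k (fun a => X.X a ⟶ Y.X a) σ f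
  map_id X := PiTensorProduct.reindex_tprod _ _
  map_comp {X Y Z} f g :=
    word_ind₂ (p := (wordComp X.X Y.X Z.X).compr₂
        (PiTensorProduct.reindex k (fun a => X.X a ⟶ Z.X a) σ).toLinearMap)
      (q := (wordComp (fun a => X.X (σ.symm a)) (fun a => Y.X (σ.symm a))
        (fun a => Z.X (σ.symm a))).compl₁₂
          (PiTensorProduct.reindex k (fun a => X.X a ⟶ Y.X a) σ).toLinearMap
          (PiTensorProduct.reindex k (fun a => Y.X a ⟶ Z.X a) σ).toLinearMap)
      (fun f g => by simp) f g

lemma wordPerm_pureHom (σ : Equiv.Perm (Fin n)) {X Y : TensorWord k V n}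
    (f : ∀ a, X.X a ⟶ Y.X a) :
    (wordPerm σ).map (pureHom f) = pureHom (X := (wordPerm σ).obj X)
      (Y := (wordPerm σ).obj Y) fun a => f (σ⁻¹ a) :=
  PiTensorProduct.reindex_tprod _ _

instance (σ : Equiv.Perm (Fin n)) : (wordPerm σ : TensorWord k V n ⥤ _).Additive where
  map_add {X Y f g} := map_add (PiTensorProduct.reindex k (fun a => X.X a ⟶ Y.X a) σ) f g

instance (σ : Equiv.Perm (Fin n)) : (wordPerm σ : TensorWord k V n ⥤ _).Linear k where
  map_smul {X Y} f r := map_smul (PiTensorProduct.reindex k (fun a => X.X a ⟶ Y.X a) σ) r f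

/-- To compare two linear functors on formal tensor products it is enough to consider pure
tensors of morphisms. -/
lemma word_natural {F F' : TensorWord k V n ⥤ TensorWord k V n} [F.Additive] [F.Linear k]
    [F'.Additive] [F'.Linear k] (α : ∀ X, F.obj X ⟶ F'.obj X)
    (h : ∀ (X Y : TensorWord k V n) (f : ∀ a, X.X a ⟶ Y.X a),
      F.map (pureHom f) ≫ α Y = α X ≫ F'.map (pureHom f))
    {X Y : TensorWord k V n} (f : X ⟶ Y) : F.map f ≫ α Y = α X ≫ F'.map f :=
  word_ind (p := (compBilin k _ _ _).flip (α Y) ∘ₗ F.mapLinearMap k)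
    (q := compBilin k _ _ _ (α X) ∘ₗ F'.mapLinearMap k) (fun f => h X Y f) f

/-- A family of isomorphisms as an isomorphism of formal tensor products. -/
def pureIso {X Y : TensorWord k V n} (f : ∀ a, X.X a ≅ Y.X a) : X ≅ Y where
  hom := pureHom fun a => (f a).hom
  inv := pureHom fun a => (f a).inv
  hom_inv_id := by rw [pureHom_comp]; simp [pureHom_id]
  inv_hom_id := by rw [pureHom_comp]; simp [pureHom_id]

/-- Natural isomorphisms of linear functors on formal tensor products, given factor by factor. -/
def wordNatIso (F F' : TensorWord k V n ⥤ TensorWord k V n) [F.Additive] [F.Linear k]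
    [F'.Additive] [F'.Linear k] (α : ∀ X a, (F.obj X).X a ≅ (F'.obj X).X a)
    (h : ∀ (X Y : TensorWord k V n) (f : ∀ a, X.X a ⟶ Y.X a),
      F.map (pureHom f) ≫ pureHom (fun a => (α Y a).hom) =
        pureHom (fun a => (α X a).hom) ≫ F'.map (pureHom f)) : F ≅ F' :=
  NatIso.ofComponents (fun X => pureIso (α X))
    (word_natural (F := F) (F' := F') (fun X => (pureIso (α X)).hom) h)

/-- An isomorphism `F' ∘ F ≅ E` applied to all factors of formal tensor products. -/
def wordIso (n : ℕ) {F F' E : V ⥤ V} [F.Additive] [F.Linear k] [F'.Additive] [F'.Linear k]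
    [E.Additive] [E.Linear k] (α : F ⋙ F' ≅ E) :
    (wordMap F ⋙ wordMap F' : TensorWord k V n ⥤ TensorWord k V n) ≅ wordMap E :=
  wordNatIso (wordMap F ⋙ wordMap F') (wordMap E) (fun X a => α.app (X.X a)) fun X Y f => by
    refine (congrArg₂ (· ≫ ·) ((congrArg (wordMap F').map (wordMap_pureHom F f)).trans
      (wordMap_pureHom F' _)) rfl).trans
        (Eq.trans ?_ (congrArg₂ (· ≫ ·) rfl (wordMap_pureHom E f).symm))
    exact pureHom_square fun a => α.hom.naturality (f a)

/-- An isomorphism `F ≅ id` applied to all factors of formal tensor products. -/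
def wordIsoId (n : ℕ) {F : V ⥤ V} [F.Additive] [F.Linear k] (α : F ≅ 𝟭 V) :
    (wordMap F : TensorWord k V n ⥤ TensorWord k V n) ≅ 𝟭 (TensorWord k V n) :=
  wordNatIso (wordMap F) (𝟭 (TensorWord k V n)) (fun X a => α.app (X.X a)) fun X Y f => by
    rw [Functor.id_map, wordMap_pureHom]
    exact pureHom_square fun a => α.hom.naturality (f a)

/-- The diagonal action of `G` on formal tensor products,
`g (V₁ ⊠ ⋯ ⊠ V_n) = ρ(g)(V₁) ⊠ ⋯ ⊠ ρ(g)(V_n)`. -/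
def wordRep {G : Type*} [Group G] (ρ : TwoRep k G V) (n : ℕ) :
    TwoRep k G (TensorWord k V n) where
  F g := wordMap (ρ.F g)
  additive g := inferInstance
  linear g := inferInstance
  mulIso g h := wordIso n (ρ.mulIso g h)
  oneIso := wordIsoId n ρ.oneIso
  assoc g h l X := by
    refine (pureHom_comp _ _).trans ?_
    refine Eq.trans ?_ (congrArg₂ (· ≫ ·) (wordMap_pureHom (ρ.F g) _).symm
      (congrArg₂ (· ≫ ·) rfl
        (eqToHom_pureHom (fun x i => (ρ.F x).obj (X.X i)) (mul_assoc g h l).symm).symm))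
    refine Eq.trans ?_ (congrArg₂ (· ≫ ·) rfl (pureHom_comp _ _).symm)
    refine Eq.trans ?_ (pureHom_comp _ _).symm
    exact congrArg pureHom (funext fun i => ρ.assoc g h l (X.X i))
  one_left g X := by
    refine Eq.trans ?_ (congrArg₂ (· ≫ ·) rfl
        (eqToHom_pureHom (fun x i => (ρ.F x).obj (X.X i)) (one_mul g).symm).symm)
    refine Eq.trans ?_ (pureHom_comp _ _).symm
    exact congrArg pureHom (funext fun i => ρ.one_left g (X.X i))
  one_right g X := by
    refine Eq.trans ?_ (congrArg₂ (· ≫ ·) (wordMap_pureHom (ρ.F g) _).symm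
        (eqToHom_pureHom (fun x i => (ρ.F x).obj (X.X i)) (mul_one g).symm).symm)
    refine Eq.trans ?_ (pureHom_comp _ _).symm
    exact congrArg pureHom (funext fun i => ρ.one_right g (X.X i))

/-- The isomorphism `σ ∘ τ ≅ σ τ`, consisting of identities. -/
def permMul (k : Type*) [Field k] (V : Type*) [Category V] [Preadditive V] [Linear k V] {n : ℕ}
    (σ τ : Equiv.Perm (Fin n)) :
    (wordPerm τ ⋙ wordPerm σ : TensorWord k V n ⥤ TensorWord k V n) ≅ wordPerm (σ * τ) :=
  wordNatIso (wordPerm τ ⋙ wordPerm σ) (wordPerm (σ * τ))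
    (fun X a => Iso.refl (X.X (τ⁻¹ (σ⁻¹ a)))) fun X Y f => by
      refine (congrArg₂ (· ≫ ·) ((congrArg (wordPerm σ).map (wordPerm_pureHom τ f)).trans
        (wordPerm_pureHom σ _)) rfl).trans
          (Eq.trans ?_ (congrArg₂ (· ≫ ·) rfl (wordPerm_pureHom (σ * τ) f).symm))
      exact pureHom_square fun a => (Category.comp_id (f _)).trans (Category.id_comp (f _)).symm

/-- The isomorphism of the action of the trivial permutation with the identity, consisting of
identities. -/
def permOne (k : Type*) [Field k] (V : Type*) [Category V] [Preadditive V] [Linear k V] (n : ℕ) :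
    (wordPerm 1 : TensorWord k V n ⥤ TensorWord k V n) ≅ 𝟭 (TensorWord k V n) :=
  wordNatIso (wordPerm 1) (𝟭 (TensorWord k V n)) (fun X a => Iso.refl (X.X a)) fun X Y f => by
    rw [Functor.id_map, wordPerm_pureHom]
    exact pureHom_square fun a => (Category.comp_id (f _)).trans (Category.id_comp (f _)).symm

lemma permMul_app (σ τ : Equiv.Perm (Fin n)) (X : TensorWord k V n) :
    (permMul k V σ τ).hom.app X = 𝟙 ((wordPerm (σ * τ)).obj X) := rfl

lemma permOne_app (X : TensorWord k V n) : (permOne k V n).hom.app X = 𝟙 X := rfl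

lemma eqToHom_perm (X : TensorWord k V n) {σ τ : Equiv.Perm (Fin n)} (e : σ = τ) :
    eqToHom (congrArg (fun x => (wordPerm x).obj X) e) =
      pureHom (X := (wordPerm σ).obj X) (Y := (wordPerm τ).obj X)
        fun a => eqToHom (congrArg (fun x : Equiv.Perm (Fin n) => X.X (x⁻¹ a)) e) := by
  subst e; rfl

/-- The action of `S_n` on formal tensor products by
`σ (V₁ ⊠ ⋯ ⊠ V_n) = V_{σ⁻¹(1)} ⊠ ⋯ ⊠ V_{σ⁻¹(n)}`; all structure isomorphisms are identities. -/
def permRep (k : Type*) [Field k] (V : Type*) [Category V] [Preadditive V] [Linear k V] (n : ℕ) :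
    TwoRep k (Equiv.Perm (Fin n)) (TensorWord k V n) where
  F σ := wordPerm σ
  additive σ := inferInstance
  linear σ := inferInstance
  mulIso σ τ := permMul k V σ τ
  oneIso := permOne k V n
  assoc σ τ υ X := by
    rw [eqToHom_perm X (mul_assoc σ τ υ).symm]
    refine (pureHom_comp _ _).trans ?_
    refine Eq.trans ?_ (congrArg₂ (· ≫ ·) (wordPerm_pureHom σ _).symm (pureHom_comp _ _).symm)
    refine Eq.trans ?_ (pureHom_comp _ _).symm
    refine congrArg pureHom (funext fun a => ?_)
    refine (Category.id_comp (X := X.X (υ⁻¹ (τ⁻¹ (σ⁻¹ a)))) _).trans ?_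
    refine Eq.trans ?_ (Category.id_comp (X := X.X (υ⁻¹ (τ⁻¹ (σ⁻¹ a)))) _).symm
    exact (Category.id_comp (X := X.X (υ⁻¹ (τ⁻¹ (σ⁻¹ a)))) _).symm
  one_left σ X := by
    rw [eqToHom_perm X (one_mul σ).symm]
    refine Eq.trans ?_ (pureHom_comp _ _).symm
    refine congrArg pureHom (funext fun a => ?_)
    exact (Category.id_comp (X := X.X (σ⁻¹ a)) _).symm
  one_right σ X := by
    rw [eqToHom_perm X (mul_one σ).symm]
    refine Eq.trans ?_ (congrArg₂ (· ≫ ·) (wordPerm_pureHom σ _).symm rfl)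
    refine Eq.trans ?_ (pureHom_comp _ _).symm
    refine congrArg pureHom (funext fun a => ?_)
    exact (Category.id_comp (X := X.X (σ⁻¹ a)) _).symm

/-- The isomorphism `ρ(g) ∘ σ ≅ σ ∘ ρ(g)`, consisting of identities. -/
def permComm {G : Type*} [Group G] (ρ : TwoRep k G V) {n : ℕ} (σ : Equiv.Perm (Fin n)) (g : G) :
    (wordPerm σ ⋙ wordMap (ρ.F g) : TensorWord k V n ⥤ TensorWord k V n) ≅
      wordMap (ρ.F g) ⋙ wordPerm σ :=
  wordNatIso (wordPerm σ ⋙ wordMap (ρ.F g)) (wordMap (ρ.F g) ⋙ wordPerm σ)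
    (fun X a => Iso.refl ((ρ.F g).obj (X.X (σ⁻¹ a)))) fun X Y f => by
      refine (congrArg₂ (· ≫ ·) ((congrArg (wordMap (ρ.F g)).map (wordPerm_pureHom σ f)).trans
        (wordMap_pureHom (ρ.F g) _)) rfl).trans (Eq.trans ?_ (congrArg₂ (· ≫ ·) rfl
          ((congrArg (wordPerm σ).map (wordMap_pureHom (ρ.F g) f)).trans
            (wordPerm_pureHom σ _)).symm))
      exact pureHom_square fun a => (Category.comp_id ((ρ.F g).map (f _))).trans
        (Category.id_comp ((ρ.F g).map (f _))).symm

/-- The diagonal action of `G` commutes strictly with the action of `S_n`. -/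
def wordCommuting {G : Type*} [Group G] (ρ : TwoRep k G V) (n : ℕ) :
    Commuting (permRep k V n) (wordRep ρ n) where
  c σ g := permComm ρ σ g
  mul_left σ τ g X := by
    refine (congrArg₂ (· ≫ ·) (wordMap_pureHom (ρ.F g) _) rfl).trans ?_
    refine (pureHom_comp _ _).trans ?_
    refine Eq.trans ?_ (congrArg₂ (· ≫ ·) rfl
      (congrArg₂ (· ≫ ·) (wordPerm_pureHom σ _).symm rfl))
    refine Eq.trans ?_ (congrArg₂ (· ≫ ·) rfl (pureHom_comp _ _).symm)
    refine Eq.trans ?_ (pureHom_comp _ _).symm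
    refine congrArg pureHom (funext fun a => ?_)
    refine (Category.comp_id _).trans (((ρ.F g).map_id _).trans ?_)
    refine Eq.trans ?_ (Category.id_comp (X := (ρ.F g).obj (X.X (τ⁻¹ (σ⁻¹ a)))) _).symm
    exact (Category.id_comp (X := (ρ.F g).obj (X.X (τ⁻¹ (σ⁻¹ a)))) _).symm
  mul_right σ g h X := by
    refine (pureHom_comp _ _).trans ?_
    refine Eq.trans ?_ (congrArg₂ (· ≫ ·) (wordMap_pureHom (ρ.F g) _).symm
      (congrArg₂ (· ≫ ·) rfl (wordPerm_pureHom σ _).symm))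
    refine Eq.trans ?_ (congrArg₂ (· ≫ ·) rfl (pureHom_comp _ _).symm)
    refine Eq.trans ?_ (pureHom_comp _ _).symm
    refine congrArg pureHom (funext fun a => ?_)
    refine (Category.comp_id _).trans ?_
    refine Eq.trans ?_ (congrArg₂ (· ≫ ·) ((ρ.F g).map_id _).symm
      (Category.id_comp (X := (ρ.F g).obj ((ρ.F h).obj (X.X (σ⁻¹ a)))) _).symm)
    exact (Category.id_comp (X := (ρ.F g).obj ((ρ.F h).obj (X.X (σ⁻¹ a)))) _).symm
  one_right σ X := by
    refine (congrArg₂ (· ≫ ·) rfl (wordPerm_pureHom σ _)).trans ?_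
    refine (pureHom_comp _ _).trans ?_
    refine congrArg pureHom (funext fun a => ?_)
    exact Category.id_comp (X := (ρ.F 1).obj (X.X (σ⁻¹ a))) _

end TensorWord

section Sym

variable {k : Type*} [Field k] {G : Type*} [Group G]
  {V : Type*} [Category V] [Preadditive V] [Linear k V]

/-- The tensor power `V^{⊠n}`: its objects are formal direct sums of formal tensor products
`V₁ ⊠ ⋯ ⊠ V_n`, its morphisms are matrices of elements of
`Hom(V₁, W₁) ⊗ ⋯ ⊗ Hom(V_n, W_n)`. -/
abbrev BoxPow (k : Type*) [Field k] (V : Type*) [Category V] [Preadditive V] [Linear k V]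
    (n : ℕ) :=
  Mat_ (TensorWord k V n)

/-- The action of `S_n` on `V^{⊠n}`. -/
abbrev boxPerm (k : Type*) [Field k] (V : Type*) [Category V] [Preadditive V] [Linear k V]
    (n : ℕ) : TwoRep k (Equiv.Perm (Fin n)) (BoxPow k V n) :=
  (permRep k V n).mat

/-- The symmetric power `Sym^n(V) = (V^{⊠n})^{S_n}`. -/
abbrev SymCat (k : Type*) [Field k] (V : Type*) [Category V] [Preadditive V] [Linear k V]
    (n : ℕ) :=
  Equivariant (boxPerm k V n)

/-- The symmetric power `Sym^n(ρ)`: the diagonal action of `G` on `Sym^n(V)`. -/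
def symPow (ρ : TwoRep k G V) (n : ℕ) : TwoRep k G (SymCat k V n) :=
  (wordCommuting ρ n).mat.residual

end Sym

section Graded

open scoped TensorProduct DirectSum

variable {k : Type u} [Field k] {H : Type v} [Group H]

/-- The submodule of the `m`-th tensor power of `W` generated by `σ(x) - x`, `σ ∈ S_m`. -/
def symRel (k : Type u) [Field k] (W : Type w) [AddCommGroup W] [Module k W] (m : ℕ) :
    Submodule k (⨂[k] _ : Fin m, W) :=
  Submodule.span k (Set.range fun p : Equiv.Perm (Fin m) × (⨂[k] _ : Fin m, W) =>
    PiTensorProduct.reindex k (fun _ => W) p.1 p.2 - p.2)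

lemma symRel_le_comap {W : Type w} [AddCommGroup W] [Module k W] (m : ℕ) (f : W →ₗ[k] W) :
    symRel k W m ≤ (symRel k W m).comap (PiTensorProduct.map fun _ => f) := by
  refine Submodule.span_le.mpr ?_
  rintro _ ⟨⟨σ, x⟩, rfl⟩
  refine Submodule.subset_span ⟨(σ, PiTensorProduct.map (fun _ => f) x), ?_⟩
  rw [map_sub]
  exact congrArg (· - _) (PiTensorProduct.map_reindex (fun _ => f) σ x).symm

/-- The `m`-th symmetric power `sym^m(W)` of a representation `W`: the quotient of the
`m`-th tensor power by the action of `S_m`. -/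
def symRep (W : Rep.{w} k H) (m : ℕ) : Rep.{max u w} k H :=
  Rep.of (X := (⨂[k] _ : Fin m, W) ⧸ symRel k W m)
    { toFun := fun h => (symRel k W m).mapQ _ (PiTensorProduct.map fun _ => W.ρ h)
        (symRel_le_comap m (W.ρ h))
      map_one' := by
        refine Submodule.linearMap_qext _ ?_
        refine PiTensorProduct.ext (MultilinearMap.ext fun x => ?_)
        simp
      map_mul' := fun g h => by
        refine Submodule.linearMap_qext _ ?_
        refine PiTensorProduct.ext (MultilinearMap.ext fun x => ?_)
        simp }

/-- The direct sum of a family of representations. -/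
def sumRep {ι : Type} (W : ι → Rep.{w} k H) : Rep.{w} k H :=
  Rep.of (X := ⨁ i, W i) (Representation.directSum fun i => (W i).ρ)

/-- The tensor product of a finite family of representations. -/
def tensorRep {ι : Type} [Finite ι] (W : ι → Rep.{w} k H) : Rep.{max u w} k H :=
  Rep.of (X := ⨂[k] i, W i)
    { toFun := fun h => PiTensorProduct.map fun i => (W i).ρ h
      map_one' := by simp [PiTensorProduct.map_one]
      map_mul' := fun g h => by simp [PiTensorProduct.map_mul] }

/-- The total symmetric power `S_{q^r}(W) = ⨁_m sym^m(W) q^{rm}` as an `ℕ`-graded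
representation: its component of degree `d` is the sum of the `sym^m(W)` with `r * m = d`. -/
def totalSym (r : ℕ+) (W : Rep.{w} k H) : GradedObject ℕ (Rep.{max u w} k H) :=
  fun d => sumRep fun m : {m : ℕ // (r : ℕ) * m = d} => symRep W m.1

/-- The tensor product `⨂_{r ≥ 1} A_r` of a sequence of `ℕ`-graded representations whose
components of degree `0` are the trivial representation `k`, i.e. the colimit of the finite tensor
products: its component of degree `n` is the sum over all finitely supported families of
degrees `d_r` with `∑ d_r = n` of the tensor products of the components `(A_r)_{d_r}` over
those `r` with `d_r ≠ 0`. -/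
def gradedTensor (A : ℕ+ → GradedObject ℕ (Rep.{w} k H)) : GradedObject ℕ (Rep.{max u w} k H) :=
  fun n => sumRep fun d : {d : ℕ+ →₀ ℕ // (d.sum fun _ e => e) = n} =>
    tensorRep fun r : d.1.support => A r (d.1 r)

end Graded

section Main

variable {k : Type u} [Field k] {m : ℕ} {G : Type v} [Group G]

/-- The inclusion of centralizers `C_g ≤ C_{g^r}`. -/
def centralizerPow (g : G) (r : ℕ) :
    Subgroup.centralizer ({g} : Set G) →* Subgroup.centralizer ({g ^ r} : Set G) :=
  Subgroup.inclusion fun _ hs => Subgroup.mem_centralizer_singleton_iff.mpr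
    ((Commute.pow_right (Subgroup.mem_centralizer_singleton_iff.mp hs) r).eq)

lemma mem_cyclic_invariants (ρ : TwoRep k G (VectPow k m)) (g : G) (r : ℕ)
    (ξ : ρ.Char (g ^ r)) : ξ ∈ (cyclicRep ρ g r).invariants ↔
      ρ.charRep (g ^ r) (genC g r) ξ = ξ := by
  rw [Representation.mem_invariants, ← cyclicRep_one]
  refine ⟨fun h => h _, fun h j => ?_⟩
  obtain ⟨z, hz⟩ := ZMod.intCast_surjective j.toAdd
  have hj : j = (Multiplicative.ofAdd (1 : ZMod r)) ^ z := by
    apply Multiplicative.toAdd.injective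
    rw [toAdd_zpow, toAdd_ofAdd, ← hz]
    simp
  have h' : (cyclicRep ρ g r).toHomUnits (Multiplicative.ofAdd (1 : ZMod r)) ∈
      MulAction.stabilizer (Module.End k (ρ.Char (g ^ r)))ˣ ξ := h
  have h2 := zpow_mem h' z
  rw [← map_zpow, ← hj] at h2
  exact h2

lemma charRep_mem_invariants (ρ : TwoRep k G (VectPow k m)) (g : G) (r : ℕ)
    (s : Subgroup.centralizer ({g} : Set G)) (ξ : ρ.Char (g ^ r))
    (h : ξ ∈ (cyclicRep ρ g r).invariants) :
    ρ.charRep (g ^ r) (centralizerPow g r s) ξ ∈ (cyclicRep ρ g r).invariants := by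
  rw [mem_cyclic_invariants] at h ⊢
  rw [← Module.End.mul_apply, ← map_mul]
  have : genC g r * centralizerPow g r s = centralizerPow g r s * genC g r :=
    Subtype.ext (Subgroup.mem_centralizer_singleton_iff.mp s.2).symm
  rw [this, map_mul, Module.End.mul_apply, h]

/-- The representation `X_ρ(g^r)^{ℤ/r}` of `C_g`. -/
def cyclicInvariants (ρ : TwoRep k G (VectPow k m)) (g : G) (r : ℕ) :
    Rep.{u + 1} k (Subgroup.centralizer ({g} : Set G)) :=
  Rep.of (X := (cyclicRep ρ g r).invariants)
    { toFun := fun s => (ρ.charRep (g ^ r) (centralizerPow g r s)).restrict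
        (charRep_mem_invariants ρ g r s)
      map_one' := LinearMap.ext fun ξ => Subtype.ext <| by
        change ρ.charRep (g ^ r) (centralizerPow g r 1) ξ.1 = ξ.1
        rw [map_one, map_one, Module.End.one_apply]
      map_mul' := fun s t => LinearMap.ext fun ξ => Subtype.ext <| by
        change ρ.charRep (g ^ r) (centralizerPow g r (s * t)) ξ.1 =
          ρ.charRep (g ^ r) (centralizerPow g r s) (ρ.charRep (g ^ r) (centralizerPow g r t) ξ.1)
        rw [map_mul, map_mul, Module.End.mul_apply] }

/-- The `ℕ`-graded representation `⨁_n X_{Sym^n(ρ)}(g) q^n` of `C_g`. -/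
def symCharacters (ρ : TwoRep k G (VectPow k m)) (g : G) :
    GradedObject ℕ (Rep.{u + 1} k (Subgroup.centralizer ({g} : Set G))) :=
  fun n => Rep.of ((symPow ρ n).charRep g)

end Main

end

end TwoRep

/-! Both sides have bases that the centralizer `C_g` permutes up to scalars, and the index sets, the
permutations and the scalars agree.

Each `ρ(h)` is an equivalence, so it permutes the simple objects `S_j` of `Vect^m` up to
isomorphism, by a permutation `π_h` (`idxPerm`). The space `Hom(S_i, ρ(h) S_j)` is a line if `i =
π_h(j)` and zero otherwise. Choose a generator of each line (`basisHom`). For `s ∈ C_g` the two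
composites of generators of degrees `s` and `g` ending in `S_j` differ by a scalar `c_s(j)`
(`twist`), and `c_g = 1`. Write `π = π_g`.

An element of `X_ρ(g^r)` is an arbitrary function on the fixed points of `π^r`. The action of `s`
moves the point `i` to `π_s(i)` and multiplies by `∏_{a<r} c_s(π^a i)`. As `c_g = 1`, the operator
`ψ_g` only shifts along `π`, so the invariants of `ℤ/r` are the functions constant on `π`-orbits.
Hence they have a monomial basis indexed by `Label π r` (`exists_basis_cyclicInvariants`). Symmetric
powers, tensor products and direct sums inherit monomial bases. In degree `n` the right-hand side is
thus indexed by multisets of labels of total length `n` (`isMonomial_gradedTensor`).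

For the left-hand side, a natural transformation `ζ` on equivariant objects amounts to an
`S_n`-invariant family `Θ_σ : id ⟶ ρ(g) σ` on formal tensor products. The family is read off from
`ζ` on the induced objects `⨁ σ(Y)`, starting at the summand `σ = 1` (`charEntry_eq`,
`indComp_conj`). Conversely `ζ` is the sum of the `Θ_σ` followed by the inverses of `ε_σ`
(`exists_indComp_eq`). On words of simple objects each `Θ_σ` can be prescribed freely. So `ζ` is a
function on the pairs `(w, σ)` with `w ∘ σ = π ∘ w` that is constant under simultaneous conjugation
by `S_n`. Up to conjugation such a pair is the multiset of its cycles: a cycle of length `r` mapped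
equivariantly to the index set is a fixed point of `π^r` up to `π`, that is, a label
(`exists_conj_of_cycleLabels_eq`, `exists_cycleLabels_eq`). Here `s` acts with the scalar `∏_a
c_s(w(a))`, which splits as a product over the cycles (`prod_cycleLabels`), so
`hasMonomialBasis_symPow` has the same shape and `IsMonomial.nonempty_iso` applies. No averaging
over `S_n` or `ℤ/r` occurs, so the characteristic plays no role. -/

namespace TwoRep

noncomputable section

/-! ### Morphisms of degree `g` and their composition. -/

section Graded

variable {k : Type*} [Field k] {G : Type*} [Group G]
  {V : Type*} [Category V] [Preadditive V] [Linear k V]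

/-- The composition of a morphism `X ⟶ ρ(g)(Y)` of degree `g` with a morphism `Y ⟶ ρ(h)(Z)` of
degree `h`, a morphism of degree `p = g * h`. -/
def gcomp (ρ : TwoRep k G V) {g h p : G} (e : g * h = p) {X Y Z : V} (f : X ⟶ (ρ.F g).obj Y)
    (f' : Y ⟶ (ρ.F h).obj Z) : X ⟶ (ρ.F p).obj Z :=
  f ≫ (ρ.F g).map f' ≫ (ρ.mulIso' e).hom.app Z

variable (ρ : TwoRep k G V)

/-- The coherence of the `φ_{g,h}` turns the morphisms `X ⟶ ρ(g)(Y)` into a `G`-graded category. The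
products of group elements are free variables with equations, so that no transport along equalities
in `G` appears in later computations. -/
lemma gcomp_assoc {g h l p q r : G} (e₁ : g * h = p) (e₂ : p * l = r) (e₃ : h * l = q)
    (e₄ : g * q = r) {X Y Z W : V} (a : X ⟶ (ρ.F g).obj Y) (b : Y ⟶ (ρ.F h).obj Z)
    (c : Z ⟶ (ρ.F l).obj W) :
    ρ.gcomp e₂ (ρ.gcomp e₁ a b) c = ρ.gcomp e₄ a (ρ.gcomp e₃ b c) := by
  have n := (ρ.mulIso' e₁).hom.naturality c
  have h := ρ.assoc' e₁ e₂ e₃ e₄ W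
  dsimp [gcomp] at n ⊢
  simp only [Category.assoc, Functor.map_comp]
  rw [← reassoc_of% n, h]

lemma gcomp_smul_left {g h p : G} (e : g * h = p) {X Y Z : V} (c : k)
    (f : X ⟶ (ρ.F g).obj Y) (f' : Y ⟶ (ρ.F h).obj Z) :
    ρ.gcomp e (c • f) f' = c • ρ.gcomp e f f' := by
  simp [gcomp]

lemma gcomp_smul_right {g h p : G} (e : g * h = p) {X Y Z : V} (c : k)
    (f : X ⟶ (ρ.F g).obj Y) (f' : Y ⟶ (ρ.F h).obj Z) :
    ρ.gcomp e f (c • f') = c • ρ.gcomp e f f' := by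
  simp [gcomp]

lemma gcomp_zero_left {g h p : G} (e : g * h = p) {X Y Z : V} (f' : Y ⟶ (ρ.F h).obj Z) :
    ρ.gcomp e (0 : X ⟶ (ρ.F g).obj Y) f' = 0 := by
  simp [gcomp]

lemma gcomp_one_left {h : G} (e : 1 * h = h) {X Y Z : V} (f : X ⟶ Y)
    (f' : Y ⟶ (ρ.F h).obj Z) :
    ρ.gcomp e (f ≫ ρ.oneIso.inv.app Y) f' = f ≫ f' := by
  have n := ρ.oneIso.inv.naturality f'
  dsimp at n
  simp [gcomp, one_left']

lemma gcomp_one_right {g : G} (e : g * 1 = g) {X Y Z : V} (f : X ⟶ (ρ.F g).obj Y)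
    (f' : Y ⟶ Z) :
    ρ.gcomp e f (f' ≫ ρ.oneIso.inv.app Z) = f ≫ (ρ.F g).map f' := by
  simp [gcomp, one_right', ← Functor.map_comp]

/-- Naturality of `ψ_s(ξ)` with respect to morphisms of degree `s`. -/
lemma conj_gcomp {s g p q : G} (e : s * g * s⁻¹ = p) (e₁ : p * s = q)
    (e₂ : s * g = q) (ξ : ρ.Char g) {X Y : V} (f : X ⟶ (ρ.F s).obj Y) :
    ρ.gcomp e₁ ((ρ.conj e ξ).app X) f = ρ.gcomp e₂ f (ξ.app Y) := by
  have n := (ρ.conj e ξ).naturality f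
  dsimp [gcomp] at n ⊢
  rw [← reassoc_of% n, conj_app ρ e e₁ e₂]

end Graded

/-! ### Natural transformations determined by simple objects. -/

section Simple

variable {k : Type*} [Field k] {C : Type*} [Category C] [Preadditive C] [Linear k C]

/-- A family of objects such that the morphisms between them are scalars, and such that all
identities are sums of morphisms which factor through them. -/
structure SimpleFamily (k : Type*) [Field k] {C : Type*} [Category C] [Preadditive C] [Linear k C]
    {W : Type*} (S : W → C) : Prop where
  hom_eq_zero : ∀ {w w' : W}, w ≠ w' → ∀ f : S w ⟶ S w', f = 0
  exists_smul : ∀ (w : W) (f : S w ⟶ S w), ∃ c : k, f = c • 𝟙 (S w)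
  decomp : ∀ Y : C, ∃ (ι : Type) (_ : Fintype ι) (w : ι → W) (p : ∀ i, Y ⟶ S (w i))
    (q : ∀ i, S (w i) ⟶ Y), 𝟙 Y = ∑ i, p i ≫ q i

variable {W : Type*} {S : W → C} (hS : SimpleFamily k S)

include hS in
-- Writing `1_Y = ∑ p_i q_i`, naturality expresses `α_Y` as the sum of the `F'(p_i)`, the values of
-- `α` on the family and the `F(q_i)`.
lemma SimpleFamily.app_ext {D : Type*} [Category D] [Preadditive D] {F F' : C ⥤ D}
    [F'.Additive] (α β : F' ⟶ F)
    (h : ∀ w, α.app (S w) = β.app (S w)) (Y : C) : α.app Y = β.app Y := by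
  obtain ⟨ι, _, w, p, q, hY⟩ := hS.decomp Y
  rw [← Category.id_comp (α.app Y), ← Category.id_comp (β.app Y), ← F'.map_id, hY]
  simp [Functor.map_sum, Preadditive.sum_comp, h]

variable {F : C ⥤ C} [F.Additive] [F.Linear k]

include hS in
-- Morphisms inside the family are zero or scalars, so naturality on the family is automatic for any
-- choice of `θ`.
lemma SimpleFamily.natural (θ : ∀ w, S w ⟶ F.obj (S w)) {w w' : W} (f : S w ⟶ S w') :
    f ≫ θ w' = θ w ≫ F.map f := by
  by_cases h : w = w'
  · subst h
    obtain ⟨c, rfl⟩ := hS.exists_smul w f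
    simp
  · rw [hS.hom_eq_zero h f]
    simp

include hS in
/-- A natural transformation `id ⟶ F` can be prescribed on the members of a simple family. -/
lemma SimpleFamily.exists_nat (θ : ∀ w, S w ⟶ F.obj (S w)) :
    ∃ α : 𝟭 C ⟶ F, ∀ w, α.app (S w) = θ w := by
  choose ι hι w p q hY using hS.decomp
  -- Decompose the identities of both `Y` and `Z`. The middle factor `q_i f p_l` is then a morphism
  -- inside the family, and `θ` may be moved past it.
  have key : ∀ {Y Z : C} (f : Y ⟶ Z), f ≫ (∑ l, p Z l ≫ θ (w Z l) ≫ F.map (q Z l)) =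
      (∑ i, p Y i ≫ θ (w Y i) ≫ F.map (q Y i)) ≫ F.map f := by
    intro Y Z f
    calc f ≫ (∑ l, p Z l ≫ θ (w Z l) ≫ F.map (q Z l))
        = 𝟙 Y ≫ f ≫ (∑ l, p Z l ≫ θ (w Z l) ≫ F.map (q Z l)) := by simp
      _ = ∑ i, ∑ l, p Y i ≫ (q Y i ≫ f ≫ p Z l) ≫ θ (w Z l) ≫ F.map (q Z l) := by
        rw [hY Y]
        simp only [Preadditive.sum_comp, Preadditive.comp_sum, Category.assoc]
        exact Finset.sum_comm
      _ = ∑ i, p Y i ≫ θ (w Y i) ≫ F.map (q Y i) ≫ F.map f ≫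
            F.map (∑ l, p Z l ≫ q Z l) := by
        refine Finset.sum_congr rfl fun i _ => ?_
        rw [Functor.map_sum, Preadditive.comp_sum, Preadditive.comp_sum, Preadditive.comp_sum,
          Preadditive.comp_sum]
        refine Finset.sum_congr rfl fun l _ => ?_
        have h := congrArg (p Y i ≫ · ≫ F.map (q Z l)) (hS.natural θ (q Y i ≫ f ≫ p Z l))
        simpa using h
      _ = _ := by
        rw [← hY Z]
        simp [Preadditive.sum_comp]
  refine ⟨{ app := fun Y => ∑ i, p Y i ≫ θ (w Y i) ≫ F.map (q Y i)
            naturality := fun Y Z f => key f }, fun x => ?_⟩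
  change ∑ i, p (S x) i ≫ θ (w (S x) i) ≫ F.map (q (S x) i) = θ x
  calc _ = ∑ i, p (S x) i ≫ q (S x) i ≫ θ x := by
        refine Finset.sum_congr rfl fun i _ => ?_
        rw [hS.natural θ (q (S x) i)]
    _ = (∑ i, p (S x) i ≫ q (S x) i) ≫ θ x := by simp [Preadditive.sum_comp]
    _ = θ x := by rw [← hY]; simp

end Simple

/-! ### Induced equivariant objects and the components of a natural transformation. -/

section Induction

variable {k : Type*} [Field k] {H : Type} [Group H] [Fintype H] {G : Type*} [Group G]
  {C : Type*} [Category C] [Preadditive C] [Linear k C]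

lemma mat_mulIso'_hom (τ : TwoRep k G C) {s t p : G} (h : s * t = p) (M : Mat_ C) :
    (τ.mat.mulIso' h).hom.app M = diag fun i => (τ.mulIso' h).hom.app (M.X i) := by
  subst h
  simp only [mulIso'_rfl]
  rfl

lemma mat_mulIso'_inv (τ : TwoRep k G C) {s t p : G} (h : s * t = p) (M : Mat_ C) :
    (τ.mat.mulIso' h).inv.app M = diag fun i => (τ.mulIso' h).inv.app (M.X i) := by
  subst h
  simp only [mulIso'_rfl]
  rfl

lemma Equivariant.ε_mul' {τ : TwoRep k G C} (X : Equivariant τ) {s t p : G} (h : s * t = p) :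
    (X.ε p).hom = (X.ε s).hom ≫ (τ.F s).map (X.ε t).hom ≫ (τ.mulIso' h).hom.app X.obj := by
  subst h
  rw [mulIso'_rfl, X.ε_mul]

lemma Equivariant.inv_hom_ε {τ : TwoRep k G C} (X : Equivariant τ) {s t p : G} (h : s * t = p) :
    (X.ε p).inv ≫ (X.ε s).hom = (τ.mulIso' h).inv.app X.obj ≫ (τ.F s).map (X.ε t).inv := by
  rw [Iso.inv_comp_eq, X.ε_mul' h]
  simp [← Functor.map_comp]

/-- The definition of an equivariant object does not normalize `ε_1`. The cocycle condition for `1 *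
1` together with invertibility of `ε_1` forces it to be the unit isomorphism. -/
lemma Equivariant.ε_one_inv {τ : TwoRep k G C} (X : Equivariant τ) :
    (X.ε 1).inv = τ.oneIso.hom.app X.obj := by
  have e := X.ε_mul' (mul_one (1 : G))
  have n := τ.oneIso.hom.naturality (X.ε 1).hom
  dsimp at n
  rw [one_left', n, ← Category.assoc] at e
  have e' : (X.ε 1).hom ≫ τ.oneIso.hom.app X.obj = 𝟙 _ := by
    rw [← cancel_mono (X.ε 1).hom, ← e, Category.id_comp]
  rw [← cancel_epi (X.ε 1).hom, e', Iso.hom_inv_id]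

lemma mat_comp_single {L M N : Mat_ C} (A : L ⟶ M) (B : M ⟶ N) {i : L.ι} {l : N.ι} (j : M.ι)
    (h : ∀ b, b ≠ j → A i b ≫ B b l = 0) : (A ≫ B) i l = A i j ≫ B j l :=
  (Mat_.comp_apply _ _ _ _).trans (Finset.sum_eq_single j (fun b _ hb => h b hb) (by simp))

/-- A family of morphisms as a matrix. -/
def matOf {ι κ : Type} [Fintype ι] [Fintype κ] {X : ι → C} {Y : κ → C} (f : ∀ i j, X i ⟶ Y j) :
    (Mat_.mk ι X : Mat_ C) ⟶ Mat_.mk κ Y :=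
  f

variable (τ : TwoRep k H C)

open scoped Classical in
/-- The matrix of the isomorphisms `τ(σ) ≅ τ(s) τ(σ')`, `σ = s * σ'`. -/
def indHom (Y : C) (s : H) :
    (Mat_.mk H fun σ => (τ.F σ).obj Y : Mat_ C) ⟶ Mat_.mk H fun σ => (τ.F s).obj ((τ.F σ).obj Y) :=
  matOf fun σ σ' => if h : s * σ' = σ then (τ.mulIso' h).inv.app Y else 0

open scoped Classical in
/-- The inverse matrix of `indHom`. -/
def indInv (Y : C) (s : H) :
    (Mat_.mk H fun σ => (τ.F s).obj ((τ.F σ).obj Y) : Mat_ C) ⟶ Mat_.mk H fun σ => (τ.F σ).obj Y :=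
  matOf fun σ' σ => if h : s * σ' = σ then (τ.mulIso' h).hom.app Y else 0

lemma indHom_pos (Y : C) {s σ σ' : H} (h : s * σ' = σ) :
    τ.indHom Y s σ σ' = (τ.mulIso' h).inv.app Y := dif_pos h

lemma indHom_neg (Y : C) {s σ σ' : H} (h : s * σ' ≠ σ) : τ.indHom Y s σ σ' = 0 := dif_neg h

lemma indInv_pos (Y : C) {s σ σ' : H} (h : s * σ' = σ) :
    τ.indInv Y s σ' σ = (τ.mulIso' h).hom.app Y := dif_pos h

lemma indInv_neg (Y : C) {s σ σ' : H} (h : s * σ' ≠ σ) : τ.indInv Y s σ' σ = 0 := dif_neg h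

lemma indHom_comp (Y : C) (s : H) {N : Mat_ C}
    (B : Mat_.mk H (fun σ => (τ.F s).obj ((τ.F σ).obj Y)) ⟶ N) {σ σ' : H} (h : s * σ' = σ)
    (l : N.ι) : (τ.indHom Y s ≫ B) σ l = (τ.mulIso' h).inv.app Y ≫ B σ' l := by
  rw [← indHom_pos]
  refine mat_comp_single (M := Mat_.mk H fun σ => (τ.F s).obj ((τ.F σ).obj Y)) _ _ σ'
    fun b hb => ?_
  rw [indHom_neg, Limits.zero_comp]
  exact fun h' => hb (mul_left_cancel (h'.trans h.symm))

lemma indInv_comp (Y : C) (s : H) {N : Mat_ C}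
    (B : Mat_.mk H (fun σ => (τ.F σ).obj Y) ⟶ N) {σ σ' : H} (h : s * σ' = σ)
    (l : N.ι) : (τ.indInv Y s ≫ B) σ' l = (τ.mulIso' h).hom.app Y ≫ B σ l := by
  rw [← indInv_pos]
  refine mat_comp_single (M := Mat_.mk H fun σ => (τ.F σ).obj Y) _ _ σ fun b hb => ?_
  rw [indInv_neg, Limits.zero_comp]
  exact fun h' => hb (h'.symm.trans h)

/-- The structure isomorphisms of the equivariant object induced from `Y`. -/
def indIso (Y : C) (s : H) :
    (Mat_.mk H fun σ => (τ.F σ).obj Y : Mat_ C) ≅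
      Mat_.mk H fun σ => (τ.F s).obj ((τ.F σ).obj Y) where
  hom := τ.indHom Y s
  inv := τ.indInv Y s
  hom_inv_id := by
    refine Mat_.hom_ext _ _ fun (σ : H) (σ' : H) => ?_
    have h : s * (s⁻¹ * σ) = σ := by group
    refine (τ.indHom_comp Y s (τ.indInv Y s) h σ').trans ?_
    by_cases h' : σ = σ'
    · subst h'
      rw [indInv_pos _ _ h]
      refine Eq.trans ?_ (Mat_.id_apply_self (Mat_.mk H fun σ => (τ.F σ).obj Y) σ).symm
      simp
    · rw [indInv_neg _ _ (by rwa [h]), Limits.comp_zero]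
      exact (Mat_.id_apply_of_ne (Mat_.mk H fun σ => (τ.F σ).obj Y) σ σ' h').symm
  inv_hom_id := by
    refine Mat_.hom_ext _ _ fun (σ : H) (σ' : H) => ?_
    refine (τ.indInv_comp Y s (τ.indHom Y s) rfl σ').trans ?_
    by_cases h' : σ = σ'
    · subst h'
      rw [indHom_pos _ _ rfl]
      refine Eq.trans ?_
        (Mat_.id_apply_self (Mat_.mk H fun σ => (τ.F s).obj ((τ.F σ).obj Y)) σ).symm
      simp
    · rw [indHom_neg _ _ fun h => h' (mul_left_cancel h).symm, Limits.comp_zero]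
      exact (Mat_.id_apply_of_ne (Mat_.mk H fun σ => (τ.F s).obj ((τ.F σ).obj Y)) σ σ' h').symm

/-- The equivariant object `⨁ τ(σ)(Y)` induced from an object `Y`. -/
def ind (Y : C) : Equivariant τ.mat where
  obj := Mat_.mk H fun σ => (τ.F σ).obj Y
  ε s := τ.indIso Y s
  ε_mul s t := by
    refine Mat_.hom_ext _ _ fun (σ : H) (σ' : H) => ?_
    have h1 : s * (s⁻¹ * σ) = σ := by group
    let B : (Mat_.mk H fun σ => (τ.F s).obj ((τ.F σ).obj Y) : Mat_ C) ⟶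
        Mat_.mk H fun σ => (τ.F (s * t)).obj ((τ.F σ).obj Y) :=
      (τ.mat.F s).map (τ.indHom Y t) ≫ diag fun σ => (τ.mulIso s t).hom.app ((τ.F σ).obj Y)
    refine Eq.trans ?_ (τ.indHom_comp Y s B h1 σ').symm
    refine Eq.trans ?_ (congrArg ((τ.mulIso' h1).inv.app Y ≫ ·) (comp_diag
      (Mat_.mk H fun σ => (τ.F s).obj ((τ.F σ).obj Y)) ((τ.mat.F s).map (τ.indHom Y t))
      (fun σ => (τ.mulIso s t).hom.app ((τ.F σ).obj Y)) (s⁻¹ * σ) σ').symm)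
    change τ.indHom Y (s * t) σ σ' = _ ≫ (τ.F s).map (τ.indHom Y t (s⁻¹ * σ : H) σ') ≫
      (τ.mulIso s t).hom.app ((τ.F σ').obj Y)
    by_cases h : s * t * σ' = σ
    · have h' : t * σ' = s⁻¹ * σ := by rw [← h]; group
      rw [indHom_pos _ _ h, indHom_pos _ _ h']
      have a := τ.assoc' (rfl : s * t = s * t) h h' (by group) Y
      rw [← cancel_mono ((τ.mulIso' h).hom.app Y)]
      rw [mulIso'_rfl] at a
      simp only [Category.assoc, a]
      simp [← Functor.map_comp_assoc]
    · have h' : t * σ' ≠ s⁻¹ * σ := fun h' => h (by rw [mul_assoc, h']; group)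
      rw [indHom_neg _ _ h, indHom_neg _ _ h']
      simp

variable {τ}

/-- The morphism from an induced object to an equivariant object `X` given by the inclusion of a
summand of `X`. -/
def fromInd (X : Equivariant τ.mat) (i : X.obj.ι) : τ.ind (X.obj.X i) ⟶ X where
  -- On the summand `σ` this is `τ(σ)` of the inclusion of `X_i`, followed by the inverse of `ε_σ`.
  -- Equivariance is row `i` of `Equivariant.inv_hom_ε`.
  hom := matOf (Y := X.obj.X) fun σ j => (X.ε σ).inv i j
  comm s := by
    refine Mat_.hom_ext _ _ fun (σ : H) j => ?_
    have h : s * (s⁻¹ * σ) = σ := by group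
    have e := congrFun (congrFun (X.inv_hom_ε h) i) j
    rw [mat_mulIso'_inv] at e
    refine Eq.trans (Eq.trans ?_ (e.trans (diag_comp _ _ _ _ _))) (τ.indHom_comp (X.obj.X i) s
      (N := (τ.mat.F s).obj X.obj) (matOf (Y := fun j => (τ.F s).obj (X.obj.X j))
        fun (σ : H) j => (τ.F s).map ((X.ε σ).inv i j)) h j).symm
    exact (Mat_.comp_apply _ _ _ _).trans (Mat_.comp_apply _ _ _ _).symm

/-- The entries of the inverses of the structure isomorphisms of an equivariant object. -/
def invEntry (X : Equivariant τ.mat) (s : H) (i j : X.obj.ι) :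
    (τ.F s).obj (X.obj.X i) ⟶ X.obj.X j :=
  (X.ε s).inv i j

variable {ρ : TwoRep k G C} {K : Commuting τ ρ} {g : G}

/-- The entries of a natural transformation on equivariant objects. -/
def charEntry (ζ : K.mat.residual.Char g) (X : Equivariant τ.mat) (i j : X.obj.ι) :
    X.obj.X i ⟶ (ρ.F g).obj (X.obj.X j) :=
  Equivariant.Hom.hom (ζ.app X) i j

omit [Fintype H] in
lemma char_ext_entry {ζ ζ' : K.mat.residual.Char g}
    (h : ∀ X i j, charEntry ζ X i j = charEntry ζ' X i j) : ζ = ζ' :=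
  NatTrans.ext (funext fun X => Equivariant.hom_ext (Mat_.hom_ext _ _ fun i j => h X i j))

/-- The entries of a natural transformation on an induced object. -/
def indEntry (ζ : K.mat.residual.Char g) (Y : C) (σ σ' : H) :
    (τ.F σ).obj Y ⟶ (ρ.F g).obj ((τ.F σ').obj Y) :=
  charEntry ζ (τ.ind Y) σ σ'

/-- The component `Y ⟶ ρ(g) τ(σ) (Y)` of a natural transformation on equivariant objects. -/
def indComp (ζ : K.mat.residual.Char g) (σ : H) (Y : C) : Y ⟶ (ρ.F g).obj ((τ.F σ).obj Y) :=
  τ.oneIso.inv.app Y ≫ indEntry ζ Y 1 σ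

lemma oneIso_indComp (ζ : K.mat.residual.Char g) (σ : H) (Y : C) :
    τ.oneIso.hom.app Y ≫ indComp ζ σ Y = indEntry ζ Y 1 σ := by
  simp [indComp]

/-- Naturality of `ζ` along `fromInd X i` reduces every `X` to induced objects. Only the row of `σ =
1` is needed, because there `fromInd` is the inverse of `ε_1`, hence the unit isomorphism followed
by the inclusion of the summand. -/
lemma charEntry_eq (ζ : K.mat.residual.Char g) (X : Equivariant τ.mat) (i j : X.obj.ι) :
    charEntry ζ X i j =
      ∑ σ : H, indComp ζ σ (X.obj.X i) ≫ (ρ.F g).map (invEntry X σ i j) := by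
  have n := congrFun (congrFun (congrArg Equivariant.Hom.hom (ζ.naturality (fromInd X i)))
    (1 : H)) j
  have n1 : ((X.ε 1).inv ≫ Equivariant.Hom.hom (ζ.app X)) i j =
      ∑ σ : H, indEntry ζ (X.obj.X i) 1 σ ≫ (ρ.F g).map (invEntry X σ i j) :=
    (Mat_.comp_apply _ _ _ _).trans (((Mat_.comp_apply _ _ _ _).symm.trans n).trans
      (Mat_.comp_apply _ _ _ _))
  have n2 : τ.oneIso.hom.app (X.obj.X i) ≫ charEntry ζ X i j =
      ∑ σ : H, indEntry ζ (X.obj.X i) 1 σ ≫ (ρ.F g).map (invEntry X σ i j) := by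
    rw [← n1, Equivariant.ε_one_inv]
    exact (diag_comp ((ρ.mat.F g).obj X.obj) (fun i => τ.oneIso.hom.app (X.obj.X i))
      (Equivariant.Hom.hom (ζ.app X)) i j).symm
  refine (cancel_epi (τ.oneIso.hom.app (X.obj.X i))).mp (n2.trans ?_)
  rw [Preadditive.comp_sum]
  refine Finset.sum_congr rfl fun σ _ => ?_
  rw [← oneIso_indComp, Category.assoc]

/-- Entries of `ζ` on an induced object. -/
lemma indEntry_eq (ζ : K.mat.residual.Char g) (Y : C) {π σ σ' : H} (h : σ' * π = σ) :
    indEntry ζ Y π σ =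
      indComp ζ σ' ((τ.F π).obj Y) ≫ (ρ.F g).map ((τ.mulIso' h).hom.app Y) := by
  rw [← indInv_pos]
  -- On an induced object the entry `(π, σ)` of the inverse of `ε_b` vanishes unless `b * π = σ`.
  refine (charEntry_eq ζ (τ.ind Y) (π : H) σ).trans
    (Finset.sum_eq_single σ' (fun b _ hb => ?_) (by simp))
  have h0 : invEntry (τ.ind Y) b (π : H) σ = 0 :=
    τ.indInv_neg Y fun h' => hb (mul_right_cancel (h'.trans h.symm))
  rw [h0, Functor.map_zero, Limits.comp_zero]

/-- A morphism `f` induces the diagonal morphism of induced objects with entries `τ(σ)(f)`. The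
claim is the entry `(1, σ)` of the naturality square of `ζ` along it, moved from `τ(1)(Y)` to `Y`.
-/
lemma indComp_natural (ζ : K.mat.residual.Char g) (σ : H) {Y Z : C} (f : Y ⟶ Z) :
    f ≫ indComp ζ σ Z = indComp ζ σ Y ≫ (ρ.F g).map ((τ.F σ).map f) := by
  let u : τ.ind Y ⟶ τ.ind Z :=
    { hom := diag fun σ : H => (τ.F σ).map f
      comm := fun s => by
        refine Mat_.hom_ext _ _ fun (σ : H) (σ' : H) => ?_
        have h : s * (s⁻¹ * σ) = σ := by group
        refine (diag_comp (Mat_.mk H fun σ => (τ.F s).obj ((τ.F σ).obj Z))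
          (fun σ : H => (τ.F σ).map f) (τ.indHom Z s) σ σ').trans
            (Eq.trans ?_ (τ.indHom_comp Y s (N := Mat_.mk H fun σ => (τ.F s).obj ((τ.F σ).obj Z))
              ((τ.mat.F s).map (diag fun σ : H => (τ.F σ).map f)) h σ').symm)
        change (τ.F σ).map f ≫ τ.indHom Z s σ σ' =
          _ ≫ (τ.F s).map (diag (fun σ : H => (τ.F σ).map f) (s⁻¹ * σ : H) σ')
        by_cases h' : s⁻¹ * σ = σ'
        · subst h'
          rw [indHom_pos _ _ h]
          simp only [diag, dite_true, eqToHom_refl, Category.comp_id]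
          exact (τ.mulIso' h).inv.naturality f
        · rw [indHom_neg _ _ fun h2 => h' (by rw [← h2]; group)]
          simp [diag, h'] }
  have n := congrFun (congrFun (congrArg Equivariant.Hom.hom (ζ.naturality u)) (1 : H)) σ
  have n1 : (τ.F 1).map f ≫ indEntry ζ Z 1 σ =
      indEntry ζ Y 1 σ ≫ (ρ.F g).map ((τ.F σ).map f) := by
    let Z' : Mat_ C := Mat_.mk H fun σ => (ρ.F g).obj ((τ.F σ).obj Z)
    refine (diag_comp Z' (fun σ : H => (τ.F σ).map f) (Equivariant.Hom.hom (ζ.app (τ.ind Z)))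
      (1 : H) σ).symm.trans (n.trans ?_)
    refine (congrFun (congrFun (congrArg (Equivariant.Hom.hom (ζ.app (τ.ind Y)) ≫ ·)
      (map_diag (ρ.F g) fun σ : H => (τ.F σ).map f)) (1 : H)) σ).trans ?_
    exact comp_diag (Mat_.mk H fun σ => (τ.F σ).obj Y) (Equivariant.Hom.hom (ζ.app (τ.ind Y)))
      (fun σ => (ρ.F g).map ((τ.F σ).map f)) (1 : H) σ
  have n2 := τ.oneIso.inv.naturality f
  dsimp [indComp] at n2 ⊢
  rw [reassoc_of% n2, n1, Category.assoc]

/-- The structure isomorphisms of `ρ(g)(X)` in terms of entries. -/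
lemma charEntry_comm (ζ : K.mat.residual.Char g) (Y : C) {π σ q : H} (h : π * σ = q) :
    indEntry ζ Y π q ≫ (ρ.F g).map ((τ.mulIso' h).inv.app Y) ≫ (K.c π g).hom.app ((τ.F σ).obj Y) =
      (τ.mulIso' (mul_one π)).inv.app Y ≫ (τ.F π).map (indEntry ζ Y 1 σ) := by
  let A : (Mat_.mk H fun σ => (τ.F σ).obj Y : Mat_ C) ⟶
    Mat_.mk H fun σ => (ρ.F g).obj ((τ.F σ).obj Y) := Equivariant.Hom.hom (ζ.app (τ.ind Y))
  let B : (Mat_.mk H fun σ => (ρ.F g).obj ((τ.F σ).obj Y) : Mat_ C) ⟶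
    Mat_.mk H fun σ => (ρ.F g).obj ((τ.F π).obj ((τ.F σ).obj Y)) :=
      (ρ.mat.F g).map (τ.indHom Y π)
  let D : (Mat_.mk H fun σ => (ρ.F g).obj ((τ.F π).obj ((τ.F σ).obj Y)) : Mat_ C) ⟶
    Mat_.mk H fun σ => (τ.F π).obj ((ρ.F g).obj ((τ.F σ).obj Y)) :=
      diag fun σ => (K.c π g).hom.app ((τ.F σ).obj Y)
  -- This is the entry `(π, σ)` of the equivariance of `ζ` on the induced object with respect to
  -- `π`. On each side a single summand survives.
  have c : (A ≫ B ≫ D) π σ =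
      (τ.indHom Y π ≫ (τ.mat.F π).map (Equivariant.Hom.hom (ζ.app (τ.ind Y)))) π σ :=
    congrFun (congrFun ((ζ.app (τ.ind Y)).comm π) (π : H)) σ
  refine Eq.trans ?_ (c.trans (τ.indHom_comp Y π
    (N := Mat_.mk H fun σ => (τ.F π).obj ((ρ.F g).obj ((τ.F σ).obj Y)))
      ((τ.mat.F π).map (Equivariant.Hom.hom (ζ.app (τ.ind Y)))) (mul_one π) σ))
  refine Eq.trans ?_ (mat_comp_single A (B ≫ D) q fun b hb => ?_).symm
  · rw [← indHom_pos]
    exact congrArg (A π q ≫ ·) (comp_diag (Mat_.mk H fun σ => (ρ.F g).obj ((τ.F σ).obj Y)) B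
      (fun σ => (K.c π g).hom.app ((τ.F σ).obj Y)) q σ).symm
  · refine (congrArg (A π b ≫ ·) (comp_diag (Mat_.mk H fun σ => (ρ.F g).obj ((τ.F σ).obj Y)) B
      (fun σ => (K.c π g).hom.app ((τ.F σ).obj Y)) b σ)).trans ?_
    have h0 : B b σ = (ρ.F g).map (τ.indHom Y π b σ) := rfl
    rw [h0, indHom_neg _ _ fun h2 => hb (h2.symm.trans h), Functor.map_zero, Limits.zero_comp]
    exact Limits.comp_zero

omit [Fintype H] in
lemma mulIso'_mul_one_inv (s : H) (Y : C) :
    (τ.mulIso' (mul_one s)).inv.app Y = (τ.F s).map (τ.oneIso.inv.app Y) := by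
  rw [← cancel_mono ((τ.mulIso' (mul_one s)).hom.app Y)]
  nth_rw 2 [one_right']
  simp [← Functor.map_comp]

/-- Compatibility of the components with the action of `H`. -/
lemma indComp_conj (ζ : K.mat.residual.Char g) {π σ σ' q : H} (h : σ' * π = q) (h' : π * σ = q)
    (Y : C) :
    indComp ζ σ' ((τ.F π).obj Y) ≫ (ρ.F g).map ((τ.mulIso' h).hom.app Y) =
      (τ.F π).map (indComp ζ σ Y) ≫ (K.c π g).inv.app ((τ.F σ).obj Y) ≫
        (ρ.F g).map ((τ.mulIso' h').hom.app Y) := by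
  rw [← indEntry_eq, indComp, Functor.map_comp, ← mulIso'_mul_one_inv, Category.assoc,
    ← reassoc_of% charEntry_comm ζ Y h']
  simp [← Functor.map_comp]

end Induction

/-! ### From invariant families to natural transformations on equivariant objects. -/

section Residual

variable {k : Type*} [Field k] {H : Type*} [Group H] [Fintype H] {G : Type*} [Group G]
  {B : Type*} [Category B] [Preadditive B] [Linear k B] {τ : TwoRep k H B} {ρ : TwoRep k G B}
  (K : Commuting τ ρ) {g : G}

/-- A family of natural transformations `id ⟶ ρ(g) τ(σ)` that is invariant under `H`. -/
def Invariant (Θ : ∀ σ : H, 𝟭 B ⟶ τ.F σ ⋙ ρ.F g) : Prop :=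
  ∀ {π σ σ' q : H} (h : σ' * π = q) (h' : π * σ = q) (Y : B),
    (Θ σ').app ((τ.F π).obj Y) ≫ (ρ.F g).map ((τ.mulIso' h).hom.app Y) =
      (τ.F π).map ((Θ σ).app Y) ≫ (K.c π g).inv.app ((τ.F σ).obj Y) ≫
        (ρ.F g).map ((τ.mulIso' h').hom.app Y)

/-- Reindexing the sum by `σ ↦ π σ π⁻¹` matches the two sides term by term. Invariance of `Θ`
compares the summands, and the cocycle condition for `π σ π⁻¹ * π = π * σ` compares the structure
isomorphisms. -/
lemma sum_comm_ε {Θ : ∀ σ : H, 𝟭 B ⟶ τ.F σ ⋙ ρ.F g} (hΘ : Invariant K Θ) (X : Equivariant τ)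
    (π : H) :
    (∑ σ, (Θ σ).app X.obj ≫ (ρ.F g).map (X.ε σ).inv) ≫ (ρ.F g).map (X.ε π).hom ≫
        (K.c π g).hom.app X.obj =
      (X.ε π).hom ≫ (τ.F π).map (∑ σ, (Θ σ).app X.obj ≫ (ρ.F g).map (X.ε σ).inv) := by
  rw [Preadditive.sum_comp, Functor.map_sum, Preadditive.comp_sum,
    ← Equiv.sum_comp ((Equiv.mulLeft π).trans (Equiv.mulRight π⁻¹))]
  refine Finset.sum_congr rfl fun σ _ => ?_
  simp only [Equiv.trans_apply, Equiv.coe_mulLeft, Equiv.coe_mulRight]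
  set σ' := π * σ * π⁻¹ with hσ'
  have h : σ' * π = π * σ := by rw [hσ']; group
  have i := hΘ h rfl X.obj
  have n := (Θ σ').naturality (X.ε π).hom
  have nc := (K.c π g).hom.naturality (X.ε σ).inv
  have e1 := X.ε_mul' h
  have e2 := X.ε_mul' (rfl : π * σ = π * σ)
  dsimp at n nc
  have i' : (τ.F π).map ((Θ σ).app X.obj) = (Θ σ').app ((τ.F π).obj X.obj) ≫
      (ρ.F g).map ((τ.mulIso' h).hom.app X.obj) ≫
        (ρ.F g).map ((τ.mulIso' (rfl : π * σ = π * σ)).inv.app X.obj) ≫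
          (K.c π g).hom.app ((τ.F σ).obj X.obj) := by
    rw [reassoc_of% i]
    simp [← Functor.map_comp_assoc]
  rw [Functor.map_comp, i']
  simp only [Category.assoc]
  rw [← nc, reassoc_of% n]
  simp only [← Functor.map_comp_assoc]
  congr 3
  -- Both sides come from expanding the same `ε_{πσ}`, once along `σ' * π` and once along `π * σ`.
  have e3 : (τ.F σ').map (X.ε π).hom ≫ (τ.mulIso' h).hom.app X.obj =
      (X.ε σ').inv ≫ (X.ε π).hom ≫ (τ.F π).map (X.ε σ).hom ≫
        (τ.mulIso' (rfl : π * σ = π * σ)).hom.app X.obj := by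
    rw [← e2, e1]
    simp
  rw [reassoc_of% e3]
  simp [← Functor.map_comp]

/-- The natural transformation on equivariant objects given by an invariant family. -/
def charOf {Θ : ∀ σ : H, 𝟭 B ⟶ τ.F σ ⋙ ρ.F g} (hΘ : Invariant K Θ) : K.residual.Char g where
  app X :=
    { hom := ∑ σ, (Θ σ).app X.obj ≫ (ρ.F g).map (X.ε σ).inv
      comm := fun π => sum_comm_ε K hΘ X π }
  naturality X Y f := by
    refine Equivariant.hom_ext ?_
    change f.hom ≫ (∑ σ, (Θ σ).app Y.obj ≫ (ρ.F g).map (Y.ε σ).inv) =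
      (∑ σ, (Θ σ).app X.obj ≫ (ρ.F g).map (X.ε σ).inv) ≫ (ρ.F g).map f.hom
    rw [Preadditive.comp_sum, Preadditive.sum_comp]
    refine Finset.sum_congr rfl fun σ _ => ?_
    have n := (Θ σ).naturality f.hom
    have c : (X.ε σ).inv ≫ f.hom = (τ.F σ).map f.hom ≫ (Y.ε σ).inv := by
      rw [Iso.inv_comp_eq, ← Category.assoc, ← f.comm σ]
      simp
    dsimp at n ⊢
    rw [reassoc_of% n, Category.assoc, ← Functor.map_comp, ← Functor.map_comp, c]

omit [Fintype H] in
lemma residual_mulIso'_hom {g h p : G} (e : g * h = p) (X : Equivariant τ) :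
    Equivariant.Hom.hom ((K.residual.mulIso' e).hom.app X) = (ρ.mulIso' e).hom.app X.obj := by
  subst e
  simp only [mulIso'_rfl]
  rfl

end Residual

/-! ### Realizing invariant families, and the action of `ψ_s` on components. -/

section Induction

variable {k : Type*} [Field k] {H : Type} [Group H] [Fintype H] {G : Type*} [Group G]
  {C : Type*} [Category C] [Preadditive C] [Linear k C] {τ : TwoRep k H C} {ρ : TwoRep k G C}
  {K : Commuting τ ρ} {g : G}

/-- The extension of a natural transformation to formal direct sums. -/
def matNat {E F : C ⥤ C} [E.Additive] [F.Additive] (θ : 𝟭 C ⟶ E ⋙ F) :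
    𝟭 (Mat_ C) ⟶ E.mapMat_ ⋙ F.mapMat_ where
  app M := diag fun i => θ.app (M.X i)
  naturality M N f := by
    refine Mat_.hom_ext _ _ fun i j => ?_
    refine (comp_diag M f (fun i => θ.app (N.X i)) i j).trans
      (Eq.trans ?_ (diag_comp ((E.mapMat_ ⋙ F.mapMat_).obj N) (fun i => θ.app (M.X i))
        ((E.mapMat_ ⋙ F.mapMat_).map f) i j).symm)
    exact θ.naturality (f i j)

omit [Fintype H] in
lemma Invariant.mat {Θ : ∀ σ : H, 𝟭 C ⟶ τ.F σ ⋙ ρ.F g} (hΘ : Invariant K Θ) :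
    Invariant K.mat fun σ => (matNat (Θ σ) : 𝟭 (Mat_ C) ⟶ τ.mat.F σ ⋙ ρ.mat.F g) := by
  intro π σ σ' q h h' M
  rw [mat_mulIso'_hom, mat_mulIso'_hom]
  refine (congrArg (_ ≫ ·) (map_diag (ρ.F g) _)).trans ?_
  refine (diag_comp_diag _ _).trans ?_
  refine Eq.trans ?_ (congrArg₂ (· ≫ ·) (map_diag (τ.F π) _).symm
    (congrArg₂ (· ≫ ·) rfl (map_diag (ρ.F g) _).symm))
  refine Eq.trans ?_ (congrArg₂ (· ≫ ·) rfl (diag_comp_diag _ _).symm)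
  refine Eq.trans ?_ (diag_comp_diag _ _).symm
  exact congrArg diag (funext fun i => hΘ h h' (M.X i))

/-- Every invariant family of natural transformations comes from a natural transformation on
equivariant objects. -/
lemma exists_indComp_eq {Θ : ∀ σ : H, 𝟭 C ⟶ τ.F σ ⋙ ρ.F g} (hΘ : Invariant K Θ) :
    ∃ ζ : K.mat.residual.Char g, ∀ σ Y, indComp ζ σ Y = (Θ σ).app Y := by
  refine ⟨charOf K.mat hΘ.mat, fun σ Y => ?_⟩
  have h1 : ∀ π : H, ((matNat (Θ π)).app (τ.ind Y).obj ≫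
      (ρ.mat.F g).map ((τ.ind Y).ε π).inv) (1 : H) σ =
      (Θ π).app ((τ.F 1).obj Y) ≫ (ρ.F g).map (τ.indInv Y π 1 σ) := fun π =>
    diag_comp (Mat_.mk H fun σ => (ρ.F g).obj ((τ.F σ).obj Y))
      (fun s : H => (Θ π).app ((τ.F s).obj Y)) ((ρ.mat.F g).map (τ.indInv Y π)) (1 : H) σ
  have h2 : indEntry (charOf K.mat hΘ.mat) Y 1 σ =
      ∑ π : H, (Θ π).app ((τ.F 1).obj Y) ≫ (ρ.F g).map (τ.indInv Y π 1 σ) := by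
    refine Eq.trans ?_ (Finset.sum_congr rfl fun π _ => h1 π)
    exact map_sum (AddMonoidHom.mk' (fun A : (τ.ind Y).obj ⟶ (ρ.mat.F g).obj (τ.ind Y).obj =>
      A (1 : H) σ) fun _ _ => rfl) _ _
  -- In the row of `1` only the summand `π = σ` is nonzero. It is `Θ_σ` at `τ(1)(Y)`, which
  -- naturality along the unit isomorphism moves to `Y`.
  have n := (Θ σ).naturality (τ.oneIso.inv.app Y)
  dsimp at n
  rw [indComp, h2, Finset.sum_eq_single σ, indInv_pos _ _ (mul_one σ), one_right',
    reassoc_of% n, ← Functor.map_comp, ← Functor.map_comp]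
  · simp
  · intro π _ hπ
    rw [indInv_neg _ _ fun h => hπ (by simpa using h), Functor.map_zero, Limits.comp_zero]
  · simp

lemma indComp_add (ζ ζ' : K.mat.residual.Char g) (σ : H) (Y : C) :
    indComp (ζ + ζ') σ Y = indComp ζ σ Y + indComp ζ' σ Y :=
  Preadditive.comp_add _ _ _ _ _ _

lemma indComp_smul (c : k) (ζ : K.mat.residual.Char g) (σ : H) (Y : C) :
    indComp (c • ζ) σ Y = c • indComp ζ σ Y :=
  Linear.comp_smul _ _ _ _ _ _

/-- The entries of a natural transformation on `ρ(s)` of an induced object. -/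
def resEntry (ζ : K.mat.residual.Char g) (s : G) (Y : C) (σ σ' : H) :
    (ρ.F s).obj ((τ.F σ).obj Y) ⟶ (ρ.F g).obj ((ρ.F s).obj ((τ.F σ').obj Y)) :=
  charEntry ζ ((K.mat.residual.F s).obj (τ.ind Y)) σ σ'

/-- The transformation `ψ_s(ζ)` is only controlled on objects of the form `ρ(s)(X)`, hence the
evaluation at `ρ(s)` of an induced object. -/
lemma resEntry_conj {s p q : G} (e : s * g * s⁻¹ = p) (e₁ : p * s = q) (e₂ : s * g = q)
    (ζ : K.mat.residual.Char g) (σ : H) (Y : C) :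
    resEntry (K.mat.residual.conj e ζ) s Y 1 σ ≫ (ρ.mulIso' e₁).hom.app ((τ.F σ).obj Y) =
      (ρ.F s).map (indEntry ζ Y 1 σ) ≫ (ρ.mulIso' e₂).hom.app ((τ.F σ).obj Y) := by
  have c := congrArg Equivariant.Hom.hom (K.mat.residual.conj_app e e₁ e₂ ζ (τ.ind Y))
  rw [Equivariant.comp_hom, Equivariant.comp_hom, residual_mulIso'_hom, residual_mulIso'_hom,
    mat_mulIso'_hom, mat_mulIso'_hom] at c
  have c' := congrFun (congrFun c (1 : H)) σ
  exact (comp_diag (Mat_.mk H fun σ => (ρ.F s).obj ((τ.F σ).obj Y)) _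
    (fun σ => (ρ.mulIso' e₁).hom.app ((τ.F σ).obj Y)) (1 : H) σ).symm.trans (c'.trans
      (comp_diag (Mat_.mk H fun σ => (ρ.F s).obj ((τ.F σ).obj Y)) _
        (fun σ => (ρ.mulIso' e₂).hom.app ((τ.F σ).obj Y)) (1 : H) σ))

lemma invEntry_residual (s : G) (Y : C) (π σ : H) :
    invEntry ((K.mat.residual.F s).obj (τ.ind Y)) π (1 : H) σ =
      (K.c π s).inv.app ((τ.F 1).obj Y) ≫ (ρ.F s).map (τ.indInv Y π 1 σ) :=
  diag_comp (Mat_.mk H fun σ => (ρ.F s).obj ((τ.F σ).obj Y))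
    (fun σ : H => (K.c π s).inv.app ((τ.F σ).obj Y)) ((ρ.mat.F s).map (τ.indInv Y π)) (1 : H) σ

/-- The object `ρ(s)(τ.ind Y)` is not literally an induced object, but `charEntry_eq` holds for
every equivariant object. The commutation isomorphism `K.c σ s` enters through its structure
isomorphisms. -/
lemma resEntry_eq (ζ : K.mat.residual.Char g) (s : G) (Y : C) (σ : H) :
    resEntry ζ s Y 1 σ = indComp ζ σ ((ρ.F s).obj ((τ.F 1).obj Y)) ≫
      (ρ.F g).map ((K.c σ s).inv.app ((τ.F 1).obj Y) ≫
        (ρ.F s).map ((τ.F σ).map (τ.oneIso.hom.app Y))) := by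
  have h : resEntry ζ s Y 1 σ = ∑ π : H, indComp ζ π ((ρ.F s).obj ((τ.F 1).obj Y)) ≫
      (ρ.F g).map ((K.c π s).inv.app ((τ.F 1).obj Y) ≫ (ρ.F s).map (τ.indInv Y π 1 σ)) := by
    refine (charEntry_eq ζ ((K.mat.residual.F s).obj (τ.ind Y)) (1 : H) σ).trans (Finset.sum_congr rfl fun π _ => ?_)
    rw [← invEntry_residual]
    rfl
  rw [h, Finset.sum_eq_single σ, indInv_pos _ _ (mul_one σ), one_right']
  · intro π _ hπ
    rw [indInv_neg _ _ fun h => hπ (by simpa using h), Functor.map_zero,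
      Limits.comp_zero, Functor.map_zero, Limits.comp_zero]
  · simp

/-- The components of `ψ_s(ζ)`. -/
lemma indComp_conj_gcomp {s p q : G} (e : s * g * s⁻¹ = p) (e₁ : p * s = q) (e₂ : s * g = q)
    (ζ : K.mat.residual.Char g) (σ : H) {Y Z : C} (f : Z ⟶ (ρ.F s).obj Y) :
    ρ.gcomp e₁ (indComp (K.mat.residual.conj e ζ) σ Z)
        ((τ.F σ).map f ≫ (K.c σ s).inv.app Y) = ρ.gcomp e₂ f (indComp ζ σ Y) := by
  set ζ' := K.mat.residual.conj e ζ
  have h := resEntry_conj e e₁ e₂ ζ σ Y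
  rw [resEntry_eq] at h
  have n1 := indComp_natural ζ' σ ((ρ.F s).map (τ.oneIso.hom.app Y))
  have n2 := (K.c σ s).inv.naturality (τ.oneIso.hom.app Y)
  have n3 := indComp_natural ζ' σ f
  dsimp [gcomp] at n1 n2 n3 h ⊢
  rw [Functor.map_comp, Category.assoc, reassoc_of% n3.symm]
  congr 1
  -- Row `1` of the induced object starts at `τ(1)(Y)`. Precomposition with the unit isomorphism
  -- brings the claim there, where `h` applies.
  rw [← cancel_epi ((ρ.F s).map (τ.oneIso.hom.app Y)), reassoc_of% n1, ← Functor.map_comp_assoc,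
    n2, ← Functor.map_comp_assoc, oneIso_indComp, ← h]
  simp [ζ']

end Induction

/-! ### The permutation action of `G` on simple objects and the scalars `twist`. -/

section Simples

variable {k : Type u} [Field k] {m : ℕ}

lemma hom_simpleObj_eq_zero {i j : Fin m} (h : i ≠ j) (f : simpleObj k i ⟶ simpleObj k j) :
    f = 0 := by
  refine vectPow_hom_ext fun l x => ?_
  by_cases hl : l = i
  · funext h'
    exact absurd (hl.symm.trans h'.down) h
  · have : x = 0 := by
      funext h'
      exact absurd h'.down hl
    rw [this]
    exact (map_zero _).trans (map_zero _).symm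

lemma simpleFamily_vectPow (k : Type u) [Field k] (m : ℕ) :
    SimpleFamily k (simpleObj k : Fin m → VectPow k m) where
  hom_eq_zero h f := hom_simpleObj_eq_zero h f
  exists_smul _ f := end_simpleObj f
  decomp Y := ⟨Σ i : Fin m, Fin (Module.finrank k (Y.obj i)), inferInstance, fun x => x.1,
    fun x => ofFun ((Module.finBasis k (Y.obj x.1)).coord x.2),
    fun x => ofVec (Module.finBasis k (Y.obj x.1) x.2), by
      rw [sum_ofFun_ofVec Y, Fintype.sum_sigma]⟩

lemma id_simpleObj_ne_zero (i : Fin m) : 𝟙 (simpleObj k i) ≠ 0 := by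
  intro h
  have h1 := congrArg (fun f : simpleObj k i ⟶ simpleObj k i =>
    (show PLift (i = i) → k from (f i).hom.hom (fun _ => (1 : k) : PLift (i = i) → k)) ⟨rfl⟩) h
  exact one_ne_zero (α := k) h1

variable {G : Type*} [Group G] (ρ : TwoRep k G (VectPow k m))

/-- Since `ρ(h)` is an equivalence, the endomorphisms of `ρ(h)(S_j)` are scalars. Its identity is a
sum of composites through simple objects, so one of these is a nonzero scalar, and the simple object
through which it factors is isomorphic to `ρ(h)(S_j)`. -/
lemma exists_iso_simpleObj (h : G) (j : Fin m) :
    ∃ i, Nonempty (simpleObj k i ≅ (ρ.F h).obj (simpleObj k j)) := by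
  have := ρ.isEquivalence h
  set Y := (ρ.F h).obj (simpleObj k j)
  have h1 : 𝟙 Y ≠ 0 := by
    intro h0
    refine id_simpleObj_ne_zero (k := k) j ((ρ.F h).map_injective ?_)
    rw [Functor.map_zero, CategoryTheory.Functor.map_id]
    exact h0
  obtain ⟨ι, _, w, p, q, hY⟩ := (simpleFamily_vectPow k m).decomp Y
  obtain ⟨i, hi⟩ : ∃ i, p i ≫ q i ≠ 0 := by
    by_contra! h0
    exact h1 (by rw [hY]; exact Finset.sum_eq_zero fun i _ => h0 i)
  obtain ⟨f, hf⟩ := (ρ.F h).map_surjective (p i ≫ q i)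
  obtain ⟨c, rfl⟩ := end_simpleObj f
  rw [Functor.map_smul, CategoryTheory.Functor.map_id] at hf
  have hc : c ≠ 0 := by
    rintro rfl
    exact hi (by rw [← hf, zero_smul])
  have hq : q i ≠ 0 := by
    intro h0
    exact hi (by rw [h0, Limits.comp_zero])
  obtain ⟨r, hr⟩ := exists_retraction (q i) hq
  have e1 : (c⁻¹ • p i) ≫ q i = 𝟙 Y := by
    rw [Linear.smul_comp, ← hf, smul_smul, inv_mul_cancel₀ hc, one_smul]
  refine ⟨w i, ⟨⟨q i, c⁻¹ • p i, ?_, e1⟩⟩⟩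
  calc q i ≫ (c⁻¹ • p i) = q i ≫ (c⁻¹ • p i) ≫ q i ≫ r := by rw [hr, Category.comp_id]
    _ = q i ≫ ((c⁻¹ • p i) ≫ q i) ≫ r := by simp only [Category.assoc]
    _ = 𝟙 _ := by rw [e1, Category.id_comp, hr]

/-- The index of the simple object `ρ(h)(S_j)`. -/
def idx (h : G) (j : Fin m) : Fin m := (exists_iso_simpleObj ρ h j).choose

/-- The isomorphism of `ρ(h)(S_j)` with a simple object. -/
def idxIso (h : G) (j : Fin m) : simpleObj k (idx ρ h j) ≅ (ρ.F h).obj (simpleObj k j) :=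
  (exists_iso_simpleObj ρ h j).choose_spec.some

lemma eq_idx {h : G} {i j : Fin m} (f : simpleObj k i ⟶ (ρ.F h).obj (simpleObj k j))
    (hf : f ≠ 0) : i = idx ρ h j := by
  by_contra h0
  apply hf
  rw [← cancel_mono (idxIso ρ h j).inv, hom_simpleObj_eq_zero h0 (f ≫ (idxIso ρ h j).inv),
    Limits.zero_comp]

lemma hom_ne_zero_of_isIso {i : Fin m} {Y : VectPow k m} (f : simpleObj k i ⟶ Y) [IsIso f] :
    f ≠ 0 := by
  intro h
  apply id_simpleObj_ne_zero (k := k) i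
  rw [← IsIso.hom_inv_id f]
  exact (congrArg (· ≫ inv f) h).trans Limits.zero_comp

lemma idx_one (j : Fin m) : idx ρ 1 j = j :=
  have : IsIso (show simpleObj k j ⟶ (ρ.F 1).obj (simpleObj k j) from ρ.oneIso.inv.app _) :=
    inferInstanceAs (IsIso (ρ.oneIso.inv.app _))
  (eq_idx ρ (ρ.oneIso.inv.app (simpleObj k j)) (hom_ne_zero_of_isIso _)).symm

lemma idx_mul (g h : G) (j : Fin m) : idx ρ (g * h) j = idx ρ g (idx ρ h j) := by
  refine (eq_idx ρ ((idxIso ρ g (idx ρ h j)).hom ≫ (ρ.F g).map (idxIso ρ h j).hom ≫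
    (ρ.mulIso g h).hom.app _) (hom_ne_zero_of_isIso _)).symm

/-- The action of `G` on the isomorphism classes of simple objects. -/
def idxPerm : G →* Equiv.Perm (Fin m) :=
  @MulAction.toPermHom G (Fin m) _
    { smul := fun h j => idx ρ h j, one_smul := idx_one ρ, mul_smul := idx_mul ρ }

lemma idxPerm_apply (h : G) (j : Fin m) : idxPerm ρ h j = idx ρ h j := rfl

open scoped Classical in
/-- A basis of the space of morphisms `S_i ⟶ ρ(h)(S_j)`, if it is nonzero. -/
def basisHom (h : G) (i j : Fin m) : simpleObj k i ⟶ (ρ.F h).obj (simpleObj k j) :=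
  if e : i = idxPerm ρ h j then eqToHom (congrArg (simpleObj k) e) ≫ (idxIso ρ h j).hom else 0

lemma basisHom_eq_zero {h : G} {i j : Fin m} (e : i ≠ idxPerm ρ h j) : basisHom ρ h i j = 0 :=
  dif_neg e

lemma isIso_basisHom {h : G} {i j : Fin m} (e : i = idxPerm ρ h j) :
    IsIso (basisHom ρ h i j) := by
  rw [basisHom, dif_pos e]
  exact (eqToIso (congrArg (simpleObj k) e) ≪≫ idxIso ρ h j).isIso_hom

lemma basisHom_ne_zero {h : G} {i j : Fin m} (e : i = idxPerm ρ h j) :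
    basisHom ρ h i j ≠ 0 :=
  have := isIso_basisHom ρ e
  hom_ne_zero_of_isIso _

/-- The morphisms `S_i ⟶ ρ(h)(S_j)` form a space of dimension at most `1`. -/
lemma exists_smul_eq {h : G} {i j : Fin m} (b f : simpleObj k i ⟶ (ρ.F h).obj (simpleObj k j))
    (hb : i = idxPerm ρ h j → b ≠ 0) : ∃ c : k, f = c • b := by
  by_cases e : i = idxPerm ρ h j
  · have key : ∀ f : simpleObj k i ⟶ (ρ.F h).obj (simpleObj k j),
        ∃ c : k, f = c • basisHom ρ h i j := by
      intro f
      have := isIso_basisHom ρ e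
      obtain ⟨c, hc⟩ := end_simpleObj (f ≫ inv (basisHom ρ h i j))
      refine ⟨c, ?_⟩
      rw [← cancel_mono (inv (basisHom ρ h i j)), hc]
      simp
    obtain ⟨c, hc⟩ := key f
    obtain ⟨d, hd⟩ := key b
    have hd0 : d ≠ 0 := by
      rintro rfl
      exact hb e (by rw [hd, zero_smul])
    exact ⟨c * d⁻¹, by rw [hc, hd, smul_smul, mul_assoc, inv_mul_cancel₀ hd0, mul_one]⟩
  · refine ⟨0, ?_⟩
    rw [zero_smul]
    by_contra hf
    exact e (eq_idx ρ f hf)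

lemma exists_coef (h : G) (i j : Fin m) :
    ∃ φ : (simpleObj k i ⟶ (ρ.F h).obj (simpleObj k j)) →ₗ[k] k,
      i = idxPerm ρ h j → φ (basisHom ρ h i j) = 1 := by
  by_cases e : i = idxPerm ρ h j
  · obtain ⟨φ, hφ⟩ := Module.Projective.exists_dual_eq_one k (basisHom_ne_zero ρ e)
    exact ⟨φ, fun _ => hφ⟩
  · exact ⟨0, fun h => absurd h e⟩

/-- The coefficient of a morphism `S_i ⟶ ρ(h)(S_j)` with respect to `basisHom`. -/
def coef (h : G) (i j : Fin m) : (simpleObj k i ⟶ (ρ.F h).obj (simpleObj k j)) →ₗ[k] k :=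
  (exists_coef ρ h i j).choose

lemma coef_basisHom {h : G} {i j : Fin m} (e : i = idxPerm ρ h j) :
    coef ρ h i j (basisHom ρ h i j) = 1 :=
  (exists_coef ρ h i j).choose_spec e

lemma coef_smul_basisHom {h : G} {i j : Fin m}
    (f : simpleObj k i ⟶ (ρ.F h).obj (simpleObj k j)) :
    coef ρ h i j f • basisHom ρ h i j = f := by
  obtain ⟨c, rfl⟩ := exists_smul_eq ρ (basisHom ρ h i j) f (basisHom_ne_zero ρ)
  by_cases e : i = idxPerm ρ h j
  · rw [map_smul, coef_basisHom ρ e, smul_eq_mul, mul_one]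
  · simp [basisHom_eq_zero ρ e]

/-- The functor `ρ(g)` is faithful and the other two factors of the composite are isomorphisms. -/
lemma gcomp_ne_zero {g h p : G} (e : g * h = p) {X Y Z : VectPow k m} (f : X ⟶ (ρ.F g).obj Y)
    [IsIso f] {f' : Y ⟶ (ρ.F h).obj Z} (hf : f' ≠ 0) : ρ.gcomp e f f' ≠ 0 := by
  intro h0
  have := ρ.isEquivalence g
  apply hf
  apply (ρ.F g).map_injective
  rw [gcomp, ← Category.assoc] at h0
  have h1 : f ≫ (ρ.F g).map f' = 0 := by
    rw [← cancel_mono ((ρ.mulIso' e).hom.app Z), h0, Limits.zero_comp]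
  rw [← cancel_epi f, h1, Functor.map_zero, Limits.comp_zero]

section Twist

variable (g : G)

/-- Both composites lie in `Hom(S_a, ρ(gs) S_j)`, which is a line for one value of `a` and zero for
all others. Therefore one scalar serves every `a`. -/
lemma exists_twist (s : G) (hs : s * g = g * s) (j : Fin m) :
    ∃ c : k, ∀ a, ρ.gcomp hs (basisHom ρ s a (idxPerm ρ g j)) (basisHom ρ g (idxPerm ρ g j) j) =
      c • ρ.gcomp rfl (basisHom ρ g a (idxPerm ρ s j)) (basisHom ρ s (idxPerm ρ s j) j) := by
  have hπ : idxPerm ρ s (idxPerm ρ g j) = idxPerm ρ g (idxPerm ρ s j) := by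
    rw [← Equiv.Perm.mul_apply, ← Equiv.Perm.mul_apply, ← map_mul, ← map_mul, hs]
  have := isIso_basisHom ρ (rfl : idxPerm ρ g (idxPerm ρ s j) = _)
  obtain ⟨c, hc⟩ := exists_smul_eq ρ
    (ρ.gcomp rfl (basisHom ρ g (idxPerm ρ g (idxPerm ρ s j)) (idxPerm ρ s j))
      (basisHom ρ s (idxPerm ρ s j) j))
    (ρ.gcomp hs (basisHom ρ s _ (idxPerm ρ g j)) (basisHom ρ g (idxPerm ρ g j) j))
    fun _ => gcomp_ne_zero ρ _ _ (basisHom_ne_zero ρ rfl)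
  refine ⟨c, fun a => ?_⟩
  by_cases ha : a = idxPerm ρ g (idxPerm ρ s j)
  · subst ha
    exact hc
  · rw [basisHom_eq_zero ρ ha, basisHom_eq_zero ρ (hπ ▸ ha), gcomp_zero_left, gcomp_zero_left,
      smul_zero]

lemma centralizer_comm {g : G} (s : Subgroup.centralizer ({g} : Set G)) :
    (s : G) * g = g * s :=
  Subgroup.mem_centralizer_singleton_iff.mp s.2

/-- The scalar by which the two compositions of basis morphisms of degrees `s` and `g` differ. -/
def twist (s : Subgroup.centralizer ({g} : Set G)) (j : Fin m) : k :=
  (exists_twist ρ g s (centralizer_comm s) j).choose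

lemma gcomp_basisHom (s : Subgroup.centralizer ({g} : Set G)) {q : G} (h₁ : (s : G) * g = q)
    (h₂ : g * (s : G) = q) (a j : Fin m) :
    ρ.gcomp h₁ (basisHom ρ s a (idxPerm ρ g j)) (basisHom ρ g (idxPerm ρ g j) j) =
      twist ρ g s j •
        ρ.gcomp h₂ (basisHom ρ g a (idxPerm ρ s j)) (basisHom ρ s (idxPerm ρ s j) j) := by
  subst h₂
  exact (exists_twist ρ g s (centralizer_comm s) j).choose_spec a

/-- For `s = g` the two composites are the same nonzero morphism. This is why `ψ_g` acts on
`X_ρ(g^r)` as a shift without scalars. -/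
lemma twist_self (h : g ∈ Subgroup.centralizer ({g} : Set G)) (j : Fin m) :
    twist ρ g ⟨g, h⟩ j = 1 := by
  have e := gcomp_basisHom ρ g ⟨g, h⟩ rfl rfl (idxPerm ρ g (idxPerm ρ g j)) j
  have := isIso_basisHom ρ (rfl : idxPerm ρ g (idxPerm ρ g j) = _)
  have h0 := gcomp_ne_zero ρ (rfl : g * g = g * g)
    (basisHom ρ g (idxPerm ρ g (idxPerm ρ g j)) (idxPerm ρ g j))
    (basisHom_ne_zero ρ (rfl : idxPerm ρ g j = _))
  have e' : (twist ρ g ⟨g, h⟩ j - 1) • ρ.gcomp (rfl : g * g = g * g)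
      (basisHom ρ g (idxPerm ρ g (idxPerm ρ g j)) (idxPerm ρ g j))
        (basisHom ρ g (idxPerm ρ g j) j) = 0 := by
    rw [sub_smul, one_smul, ← e, sub_self]
  exact sub_eq_zero.mp ((smul_eq_zero.mp e').resolve_right h0)

end Twist

end Simples

/-! ### Bases of function spaces that are constant on fibres. -/

section Coordinates

open scoped Classical in
/-- A space of functions that are constant on the fibres of `ν : P → Q`. -/
lemma exists_basis_of_coords {k M P Q : Type*} [Field k] [AddCommGroup M] [Module k M] [Finite Q]
    (φ : M →ₗ[k] P → k) (ν : P → Q) (hν : Function.Surjective ν) (hφ : Function.Injective φ)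
    (h₁ : ∀ f : Q → k, ∃ x, φ x = f ∘ ν) (h₂ : ∀ x p p', ν p = ν p' → φ x p = φ x p') :
    ∃ b : Module.Basis Q k M, ∀ q p, φ (b q) p = if ν p = q then 1 else 0 := by
  let ψ : M →ₗ[k] Q → k := (LinearMap.funLeft k k (Function.surjInv hν)).comp φ
  have hψ : ∀ x p, ψ x (ν p) = φ x p := fun x p => h₂ x _ _ (Function.surjInv_eq hν _)
  have hb : Function.Bijective ψ := by
    constructor
    · intro x y hxy
      refine hφ (funext fun p => ?_)
      rw [← hψ, ← hψ, hxy]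
    · intro f
      obtain ⟨x, hx⟩ := h₁ f
      refine ⟨x, funext fun q => ?_⟩
      obtain ⟨p, rfl⟩ := hν q
      rw [hψ, hx, Function.comp_apply]
  let e := LinearEquiv.ofBijective ψ hb
  refine ⟨(Pi.basisFun k Q).map e.symm, fun q p => ?_⟩
  rw [← hψ]
  have : ψ (((Pi.basisFun k Q).map e.symm) q) = Pi.single q 1 := by
    rw [Module.Basis.map_apply, Pi.basisFun_apply]
    exact e.apply_symm_apply _
  rw [this, Pi.single_apply]

open scoped Classical in
-- The vector `b q` has the indicator function of the fibre over `q` as its coordinates. As `s` is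
-- surjective, it is enough to compare coordinates at points `s p`, where `hA` gives them.
lemma apply_basis_of_coords {k M P Q : Type*} [Field k] [AddCommGroup M] [Module k M]
    {φ : M →ₗ[k] P → k} {ν : P → Q} (hφ : Function.Injective φ) {b : Q → M}
    (hb : ∀ q p, φ (b q) p = if ν p = q then 1 else 0) (A : M →ₗ[k] M) (s : P → P) (σ : Q → Q)
    (C : Q → k) (hs : Function.Surjective s) (hσ : Function.Injective σ)
    (hν : ∀ p, ν (s p) = σ (ν p)) (hA : ∀ x p, φ (A x) (s p) = C (ν p) * φ x p) (q : Q) :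
    A (b q) = C q • b (σ q) := by
  refine hφ (funext fun p' => ?_)
  obtain ⟨p, rfl⟩ := hs p'
  rw [hA, map_smul, Pi.smul_apply, hb, hb, hν, hσ.eq_iff]
  by_cases h : ν p = q <;> simp [h]

end Coordinates

/-! ### Fixed points of `π ^ r` up to `π`. -/

section Labels

open Equiv.Perm

variable {I : Type*} (π : Equiv.Perm I) (r : ℕ)

/-- The fixed points of `π ^ r` modulo the action of `π`. -/
def Label : Type _ :=
  Quotient ((SameCycle.setoid π).comap (Subtype.val : {i : I // (π ^ r) i = i} → I))

variable {π r}

/-- The class of a fixed point. -/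
def Label.mk (i : I) (h : (π ^ r) i = i) : Label π r := Quotient.mk _ ⟨i, h⟩

lemma Label.exists_rep (t : Label π r) : ∃ i h, Label.mk i h = t := by
  obtain ⟨⟨i, h⟩, rfl⟩ := Quotient.exists_rep t
  exact ⟨i, h, rfl⟩

lemma Label.mk_eq_mk {i j : I} {hi : (π ^ r) i = i} {hj : (π ^ r) j = j} :
    Label.mk i hi = Label.mk j hj ↔ SameCycle π i j :=
  Quotient.eq

instance [Finite I] : Finite (Label π r) := Quotient.finite _

/-- The map of labels induced by a permutation that commutes with `π`. -/
def Label.map (s : Equiv.Perm I) (hs : Commute s π) : Label π r → Label π r :=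
  Quotient.map (fun i => ⟨s i.1, by
    have := congrArg (· i.1) (hs.pow_right r).eq
    simp only [Equiv.Perm.mul_apply] at this
    rw [← this, i.2]⟩) fun i j h => by
      obtain ⟨a, ha⟩ := h
      refine ⟨a, ?_⟩
      have := congrArg (· i.1) (hs.zpow_right a).eq
      simp only [Equiv.Perm.mul_apply] at this
      change (π ^ a) (s i.1) = s j.1
      rw [← this, ha]

lemma Label.map_mk (s : Equiv.Perm I) (hs : Commute s π) (i : I) (hi : (π ^ r) i = i)
    (hi' : (π ^ r) (s i) = s i) : Label.map s hs (Label.mk i hi) = Label.mk (s i) hi' := rfl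

lemma pow_apply_comm {s : Equiv.Perm I} (hs : Commute s π) (r : ℕ) (i : I) :
    (π ^ r) (s i) = s ((π ^ r) i) :=
  (congrArg (· i) (hs.pow_right r).eq).symm

lemma Label.map_injective (s : Equiv.Perm I) (hs : Commute s π) :
    Function.Injective (Label.map (r := r) s hs) := by
  intro t t' h
  obtain ⟨i, hi, rfl⟩ := t.exists_rep
  obtain ⟨j, hj, rfl⟩ := t'.exists_rep
  rw [Label.map_mk s hs i hi (by rw [pow_apply_comm hs, hi]),
    Label.map_mk s hs j hj (by rw [pow_apply_comm hs, hj]), Label.mk_eq_mk] at h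
  rw [Label.mk_eq_mk]
  obtain ⟨a, ha⟩ := h
  have := congrArg (· i) (hs.zpow_right a).eq
  simp only [Equiv.Perm.mul_apply] at this
  exact ⟨a, s.injective (this.trans ha)⟩

/-- The product of the values of a function along the cycle of a fixed point of `π ^ r`. -/
def Label.prod {M : Type*} [CommMonoid M] (f : I → M) (t : Label π r) : M :=
  ∏ a ∈ Finset.range r, f ((π ^ a) t.exists_rep.choose)

/-- A cyclic shift of the factors: the first one reappears at the end because `π ^ r` fixes `i`. -/
lemma prod_range_apply {M : Type*} [CommMonoid M] (f : I → M) {i : I} (hi : (π ^ r) i = i) :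
    ∏ a ∈ Finset.range r, f ((π ^ a) (π i)) = ∏ a ∈ Finset.range r, f ((π ^ a) i) := by
  have h : ∀ a, (π ^ a) (π i) = (π ^ (a + 1)) i := fun a => by
    rw [pow_succ, Equiv.Perm.mul_apply]
  simp only [h]
  cases r with
  | zero => rfl
  | succ r =>
    rw [Finset.prod_range_succ, hi, Finset.prod_range_succ' (fun a => f ((π ^ a) i))]
    rfl

/-- On a finite set the points of a cycle are reached by natural powers. Invariance of `F` is
required only along the forward orbit of `i`, since in the applications it is known only at fixed
points of `π ^ r`. -/
lemma SameCycle.eq_of_forall [Finite I] {X : Type*} (F : I → X) {i j : I} (h : SameCycle π i j)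
    (hF : ∀ a : ℕ, F (π ((π ^ a) i)) = F ((π ^ a) i)) : F i = F j := by
  obtain ⟨a, -, rfl⟩ := h.exists_pow_eq'
  induction a with
  | zero => rfl
  | succ a ih => rw [pow_succ', Equiv.Perm.mul_apply, hF a, ih ⟨a, by simp⟩]

/-- The product does not depend on the starting point. It always has `r` factors: if the orbit of
`i` is shorter than `r`, the product runs around it several times. -/
lemma Label.prod_mk [Finite I] {M : Type*} [CommMonoid M] (f : I → M) (i : I)
    (hi : (π ^ r) i = i) :
    (Label.mk i hi).prod f = ∏ a ∈ Finset.range r, f ((π ^ a) i) := by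
  obtain ⟨h, e⟩ := (Label.mk i hi).exists_rep.choose_spec
  rw [Label.prod]
  refine (SameCycle.eq_of_forall (fun i => ∏ a ∈ Finset.range r, f ((π ^ a) i))
    (Label.mk_eq_mk.mp e.symm) fun a => prod_range_apply f ?_).symm
  rw [← Equiv.Perm.mul_apply, ← pow_add, add_comm, pow_add, Equiv.Perm.mul_apply, hi]

end Labels

/-! ### Generators of the lines `Hom(S_i, ρ(g^r) S_j)`. -/

section Powers

variable {k : Type u} [Field k] {m : ℕ} {G : Type*} [Group G] (ρ : TwoRep k G (VectPow k m))
  (g : G)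

/-- A morphism as a morphism of degree `q = 1`. -/
def degOne {q : G} (hq : q = 1) {X Y : VectPow k m} (f : X ⟶ Y) : X ⟶ (ρ.F q).obj Y :=
  f ≫ ρ.oneIso.inv.app Y ≫ eqToHom (by rw [hq])

lemma gcomp_degOne {q s p : G} (hq : q = 1) (h₁ : s * q = p) (h₂ : q * s = p) {X Y : VectPow k m}
    (f : X ⟶ (ρ.F s).obj Y) :
    ρ.gcomp h₁ f (ρ.degOne hq (𝟙 Y)) = ρ.gcomp h₂ (ρ.degOne hq (𝟙 X)) f := by
  subst hq
  obtain rfl : s = p := by rw [← h₁, mul_one]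
  have e : ∀ Z, ρ.degOne rfl (𝟙 Z) = 𝟙 Z ≫ ρ.oneIso.inv.app Z := fun Z => by simp [degOne]
  rw [e, e, gcomp_one_right, gcomp_one_left]
  simp

/-- The `r`-fold composition of basis morphisms of degree `g`. -/
def powHom : ∀ (r : ℕ) (i j : Fin m), simpleObj k i ⟶ (ρ.F (g ^ r)).obj (simpleObj k j)
  | 0, i, j => open scoped Classical in
      if h : i = j then ρ.degOne (pow_zero g) (eqToHom (congrArg (simpleObj k) h)) else 0
  | r + 1, i, j => ρ.gcomp (pow_succ' g r).symm (basisHom ρ g i ((idxPerm ρ g ^ r) j))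
      (powHom r ((idxPerm ρ g ^ r) j) j)

lemma powHom_zero_self (j : Fin m) : powHom ρ g 0 j j = ρ.degOne (pow_zero g) (𝟙 _) := by
  simp [powHom]

lemma powHom_ne_zero (r : ℕ) (j : Fin m) : powHom ρ g r ((idxPerm ρ g ^ r) j) j ≠ 0 := by
  induction r with
  | zero =>
    have : powHom ρ g 0 j j ≠ 0 := by
      rw [powHom_zero_self, degOne]
      refine hom_ne_zero_of_isIso (Y := (ρ.F (g ^ 0)).obj (simpleObj k j)) _
    exact this
  | succ r ih =>
    have := isIso_basisHom ρ (show (idxPerm ρ g ^ (r + 1)) j = idxPerm ρ g _ by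
      rw [pow_succ', Equiv.Perm.mul_apply])
    exact gcomp_ne_zero ρ _ _ ih

lemma commute_idxPerm {g : G} (s : Subgroup.centralizer ({g} : Set G)) :
    Commute (idxPerm ρ (s : G)) (idxPerm ρ g) := by
  rw [Commute, SemiconjBy, ← map_mul, ← map_mul, centralizer_comm]

/-- A generator of degree `s` is moved past the `r` factors of degree `g` one at a time. Passing the
factor that ends in `S_{π^a j}` costs the scalar `twist ρ g s (π^a j)`. -/
lemma gcomp_powHom (s : Subgroup.centralizer ({g} : Set G)) (r : ℕ) (j : Fin m) {q : G}
    (h₁ : s * g ^ r = q) (h₂ : g ^ r * s = q) :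
    ρ.gcomp h₁ (basisHom ρ s (idxPerm ρ s ((idxPerm ρ g ^ r) j)) _)
        (powHom ρ g r ((idxPerm ρ g ^ r) j) j) =
      (∏ a ∈ Finset.range r, twist ρ g s ((idxPerm ρ g ^ a) j)) •
        ρ.gcomp h₂ (powHom ρ g r (idxPerm ρ s ((idxPerm ρ g ^ r) j)) (idxPerm ρ s j))
          (basisHom ρ s (idxPerm ρ s j) j) := by
  induction r generalizing q with
  | zero =>
    have e1 : powHom ρ g 0 ((idxPerm ρ g ^ 0) j) j = ρ.degOne (pow_zero g) (𝟙 _) :=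
      powHom_zero_self ρ g j
    have e2 : powHom ρ g 0 (idxPerm ρ s ((idxPerm ρ g ^ 0) j)) (idxPerm ρ s j) =
      ρ.degOne (pow_zero g) (𝟙 _) := powHom_zero_self ρ g (idxPerm ρ s j)
    rw [e1, e2, Finset.range_zero, Finset.prod_empty, one_smul]
    exact gcomp_degOne ρ (pow_zero g) h₁ h₂ (basisHom ρ s (idxPerm ρ s j) j)
  | succ r ih =>
    set b := (idxPerm ρ g ^ r) j with hb
    have ha : (idxPerm ρ g ^ (r + 1)) j = idxPerm ρ g b := by
      rw [pow_succ', Equiv.Perm.mul_apply]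
    have hb' : (idxPerm ρ g ^ r) (idxPerm ρ s j) = idxPerm ρ s b :=
      pow_apply_comm (commute_idxPerm ρ s) r j
    have e1 : ∀ a, powHom ρ g (r + 1) a j =
        ρ.gcomp (pow_succ' g r).symm (basisHom ρ g a b) (powHom ρ g r b j) := fun a => rfl
    have e2 : ∀ a, powHom ρ g (r + 1) a (idxPerm ρ s j) =
        ρ.gcomp (pow_succ' g r).symm (basisHom ρ g a (idxPerm ρ s b))
          (powHom ρ g r (idxPerm ρ s b) (idxPerm ρ s j)) := fun a => by
      rw [← hb']; rfl
    rw [ha, e1, e2]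
    -- Rebracket `s (g g^r)` as `(s g) g^r`, exchange `s` and `g`, rebracket as `g (s g^r)` for the
    -- induction hypothesis, and finally as `(g g^r) s`.
    rw [← gcomp_assoc ρ (q := g ^ (r + 1)) (p := s * g) rfl
      (by rw [mul_assoc, ← pow_succ', h₁]) (pow_succ' g r).symm h₁]
    rw [gcomp_basisHom ρ g s rfl (centralizer_comm s).symm, gcomp_smul_left]
    rw [gcomp_assoc ρ (q := s * g ^ r) (p := s * g) _ _ rfl
      (by rw [← mul_assoc, ← centralizer_comm s, mul_assoc, ← pow_succ', h₁])]
    rw [ih rfl ((((Commute.pow_right (centralizer_comm s) r).eq)).symm), gcomp_smul_right,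
      ← gcomp_assoc ρ (p := g ^ (r + 1)) (pow_succ' g r).symm h₂, smul_smul,
      Finset.prod_range_succ, mul_comm]

end Powers

/-! ### Coordinates on `X_ρ(g^r)` and on its invariants. -/

section CharCoords

variable {k : Type u} [Field k] {m : ℕ} {G : Type*} [Group G] (ρ : TwoRep k G (VectPow k m))
  (g : G)

lemma powHom_self_ne_zero {r : ℕ} {i : Fin m} (hi : (idxPerm ρ g ^ r) i = i) :
    powHom ρ g r i i ≠ 0 := by
  have h := powHom_ne_zero ρ g r i
  rwa [hi] at h

/-- A natural transformation is an arbitrary choice of values on the simple objects. At `S_i` the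
value lies in the line spanned by `powHom` if `π^r i = i`, and in the zero space otherwise. -/
lemma exists_charCoords (r : ℕ) :
    ∃ φ : ρ.Char (g ^ r) →ₗ[k] {i : Fin m // (idxPerm ρ g ^ r) i = i} → k,
      Function.Bijective φ ∧ ∀ ξ i, ξ.app (simpleObj k i.1) = φ ξ i • powHom ρ g r i.1 i.1 := by
  classical
  have hφ : ∀ i : {i : Fin m // (idxPerm ρ g ^ r) i = i},
      ∃ φ : (simpleObj k i.1 ⟶ (ρ.F (g ^ r)).obj (simpleObj k i.1)) →ₗ[k] k,
        φ (powHom ρ g r i.1 i.1) = 1 := fun i =>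
    Module.Projective.exists_dual_eq_one k (powHom_self_ne_zero ρ g i.2)
  choose φ hφ using hφ
  have key : ∀ (ξ : ρ.Char (g ^ r)) (i : {i : Fin m // (idxPerm ρ g ^ r) i = i}),
      ξ.app (simpleObj k i.1) = φ i (ξ.app (simpleObj k i.1)) • powHom ρ g r i.1 i.1 := by
    intro ξ i
    obtain ⟨c, hc⟩ := exists_smul_eq ρ (powHom ρ g r i.1 i.1) (ξ.app (simpleObj k i.1))
      fun _ => powHom_self_ne_zero ρ g i.2
    refine hc.trans ?_
    congr 1
    have h1 := (congrArg (φ i) hc).trans (map_smul (φ i) c _)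
    rw [hφ, smul_eq_mul, mul_one] at h1
    exact h1.symm
  refine ⟨{ toFun := fun ξ i => φ i (ξ.app (simpleObj k i.1))
            map_add' := fun ξ η => funext fun i => (φ i).map_add _ _
            map_smul' := fun c ξ => funext fun i => (φ i).map_smul _ _ }, ⟨?_, ?_⟩, key⟩
  · intro ξ η h
    refine NatTrans.ext (funext fun Y => (simpleFamily_vectPow k m).app_ext ξ η (fun i => ?_) Y)
    by_cases hi : (idxPerm ρ g ^ r) i = i
    · rw [key ξ ⟨i, hi⟩, key η ⟨i, hi⟩]
      exact congrArg (· • _) (congrFun h ⟨i, hi⟩)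
    · have h0 : ∀ f : simpleObj k i ⟶ (ρ.F (g ^ r)).obj (simpleObj k i), f = 0 := fun f => by
        by_contra hf
        have := eq_idx ρ f hf
        rw [← idxPerm_apply, map_pow] at this
        exact hi this.symm
      exact (h0 _).trans (h0 _).symm
  · intro f
    obtain ⟨ξ, hξ⟩ := (simpleFamily_vectPow k m).exists_nat (F := ρ.F (g ^ r))
      fun i => if hi : (idxPerm ρ g ^ r) i = i then f ⟨i, hi⟩ • powHom ρ g r i i else 0
    refine ⟨ξ, funext fun i => ?_⟩
    have h1 := hξ i.1
    rw [dif_pos i.2] at h1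
    refine (congrArg (φ i) h1).trans ((map_smul (φ i) _ _).trans ?_)
    rw [hφ]
    simp

/-- Naturality of `ψ_s(ξ)` along the generator `S_{π_s(i)} ⟶ ρ(s)(S_i)` compares its coordinate at
`π_s(i)` with that of `ξ` at `i`. The scalar is the one of `gcomp_powHom`. -/
lemma charCoords_conj (r : ℕ) {φ : ρ.Char (g ^ r) →ₗ[k] {i : Fin m // (idxPerm ρ g ^ r) i = i} → k}
    (hφ : ∀ ξ i, ξ.app (simpleObj k i.1) = φ ξ i • powHom ρ g r i.1 i.1)
    (s : Subgroup.centralizer ({g} : Set G)) (e : (s : G) * g ^ r * (s : G)⁻¹ = g ^ r)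
    (ξ : ρ.Char (g ^ r)) (i : Fin m) (hi : (idxPerm ρ g ^ r) i = i)
    (hi' : (idxPerm ρ g ^ r) (idxPerm ρ s i) = idxPerm ρ s i) :
    φ (ρ.conj e ξ) ⟨idxPerm ρ s i, hi'⟩ =
      (∏ a ∈ Finset.range r, twist ρ g s ((idxPerm ρ g ^ a) i)) * φ ξ ⟨i, hi⟩ := by
  have hc : (s : G) * g ^ r = g ^ r * s := (Commute.pow_right (centralizer_comm s) r).eq
  have h1 := ρ.conj_gcomp e rfl hc ξ (basisHom ρ s (idxPerm ρ s i) i)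
  have h2 := gcomp_powHom ρ g s r i hc rfl
  rw [hi] at h2
  rw [hφ _ ⟨i, hi⟩, hφ _ ⟨idxPerm ρ s i, hi'⟩, gcomp_smul_left, gcomp_smul_right, h2,
    smul_smul] at h1
  have h3 : ρ.gcomp (rfl : g ^ r * s = g ^ r * s)
      (powHom ρ g r (idxPerm ρ s i) (idxPerm ρ s i)) (basisHom ρ s (idxPerm ρ s i) i) ≠ 0 := by
    intro h0
    rw [h0, smul_zero] at h2
    have := isIso_basisHom ρ (rfl : idxPerm ρ (s : G) i = _)
    exact gcomp_ne_zero ρ hc (basisHom ρ (s : G) (idxPerm ρ s i) i)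
      (powHom_self_ne_zero ρ g hi) h2
  have h4 := sub_eq_zero.mpr h1
  rw [← sub_smul] at h4
  rw [sub_eq_zero.mp ((smul_eq_zero.mp h4).resolve_right h3), mul_comm]

/-- A basis of the representation `X_ρ(g^r)^{ℤ/r}` which is permuted up to scalars. -/
lemma exists_basis_cyclicInvariants (r : ℕ) :
    ∃ b : Module.Basis (Label (idxPerm ρ g) r) k (cyclicInvariants ρ g r),
      ∀ s t, (cyclicInvariants ρ g r).ρ s (b t) =
        t.prod (twist ρ g s) • b (t.map (idxPerm ρ s) (commute_idxPerm ρ s)) := by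
  obtain ⟨φ, hb, hφ⟩ := exists_charCoords ρ g r
  have hg : g ∈ Subgroup.centralizer ({g} : Set G) :=
    Subgroup.mem_centralizer_singleton_iff.mpr rfl
  have hfix : ∀ (s : Subgroup.centralizer ({g} : Set G)) {i : Fin m},
      (idxPerm ρ g ^ r) i = i → (idxPerm ρ g ^ r) (idxPerm ρ s i) = idxPerm ρ s i :=
    fun s i hi => by rw [pow_apply_comm (commute_idxPerm ρ s), hi]
  -- As the scalars of `g` itself are `1`, invariance under `ψ_g` means that the coordinates are
  -- constant along `π`.
  have hmem : ∀ ξ : ρ.Char (g ^ r), ξ ∈ (cyclicRep ρ g r).invariants ↔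
      ∀ (i : Fin m) (hi : (idxPerm ρ g ^ r) i = i),
        φ ξ ⟨idxPerm ρ g i, hfix ⟨g, hg⟩ hi⟩ = φ ξ ⟨i, hi⟩ := by
    intro ξ
    rw [mem_cyclic_invariants, ← hb.1.eq_iff]
    have h1 : ∀ (i : Fin m) (hi : (idxPerm ρ g ^ r) i = i),
        φ (ρ.charRep (g ^ r) (genC g r) ξ) ⟨idxPerm ρ g i, hfix ⟨g, hg⟩ hi⟩ = φ ξ ⟨i, hi⟩ := by
      intro i hi
      refine (charCoords_conj ρ g r hφ ⟨g, hg⟩ (conj_eq_of_mem (genC g r)) ξ i hi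
        (hfix ⟨g, hg⟩ hi)).trans ?_
      rw [Finset.prod_eq_one fun a _ => twist_self ρ g hg _, one_mul]
    constructor
    · intro h i hi
      rw [← h1 i hi, h]
    · intro h
      refine funext fun ⟨i, hi⟩ => ?_
      obtain ⟨j, rfl⟩ := (idxPerm ρ g).surjective i
      have hj : (idxPerm ρ g ^ r) j = j := by
        apply (idxPerm ρ g).injective
        rw [← pow_apply_comm (Commute.refl _), hi]
      exact (h1 j hj).trans (h j hj).symm
  let φ' : cyclicInvariants ρ g r →ₗ[k] {i : Fin m // (idxPerm ρ g ^ r) i = i} → k :=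
    φ.comp (cyclicRep ρ g r).invariants.subtype
  have hφ' : Function.Injective φ' := hb.1.comp Subtype.val_injective
  let ν : {i : Fin m // (idxPerm ρ g ^ r) i = i} → Label (idxPerm ρ g) r := fun i => .mk i.1 i.2
  obtain ⟨b, hb'⟩ := exists_basis_of_coords φ' ν
    (fun t => by obtain ⟨i, h, rfl⟩ := t.exists_rep; exact ⟨⟨i, h⟩, rfl⟩) hφ' (fun f => by
      obtain ⟨ξ, hξ⟩ := hb.2 (f ∘ ν)
      refine ⟨⟨ξ, (hmem ξ).mpr fun i hi => ?_⟩, hξ⟩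
      rw [hξ]
      refine congrArg f (Label.mk_eq_mk.mpr ?_)
      exact Equiv.Perm.sameCycle_apply_left.mpr (Equiv.Perm.SameCycle.refl _ _))
    (fun ξ p p' h => by
      have hξ := (hmem ξ.1).mp ξ.2
      classical
      -- The coordinates are extended by zero to all indices. The default value is harmless, because
      -- the orbit of a fixed point of `π^r` consists of such fixed points.
      let F : Fin m → k := fun i => if hi : (idxPerm ρ g ^ r) i = i then φ ξ.1 ⟨i, hi⟩ else 0
      have hF : ∀ i : {i : Fin m // (idxPerm ρ g ^ r) i = i}, F i.1 = φ ξ.1 i := fun i =>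
        dif_pos i.2
      change φ ξ.1 p = φ ξ.1 p'
      rw [← hF, ← hF]
      refine SameCycle.eq_of_forall F (Label.mk_eq_mk.mp h) fun a => ?_
      have ha : (idxPerm ρ g ^ r) ((idxPerm ρ g ^ a) p.1) = (idxPerm ρ g ^ a) p.1 := by
        rw [pow_apply_comm ((Commute.refl (idxPerm ρ g)).pow_left a), p.2]
      exact (hF ⟨_, hfix ⟨g, hg⟩ ha⟩).trans ((hξ _ ha).trans (hF ⟨_, ha⟩).symm))
  refine ⟨b, fun s => ?_⟩
  refine apply_basis_of_coords hφ' hb' ((cyclicInvariants ρ g r).ρ s)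
    (fun i => ⟨idxPerm ρ s i.1, hfix s i.2⟩) _ _ ?_ (Label.map_injective _ _) (fun i => rfl) ?_
  · rintro ⟨i, hi⟩
    obtain ⟨j, rfl⟩ := (idxPerm ρ (s : G)).surjective i
    refine ⟨⟨j, ?_⟩, rfl⟩
    apply (idxPerm ρ (s : G)).injective
    rw [← pow_apply_comm (commute_idxPerm ρ s), hi]
  · intro ξ i
    have h := charCoords_conj ρ g r hφ s (conj_eq_of_mem (centralizerPow g r s)) ξ.1 i.1 i.2
      (hfix s i.2)
    rw [← Label.prod_mk (twist ρ g s) i.1 i.2] at h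
    exact h

end CharCoords

/-! ### Simple families and graded composition for formal tensor products. -/

section WordFamily

open scoped TensorProduct

/-- Apply the product of linear functionals that take the value `1` on the factors. -/
lemma tprod_ne_zero {k ι : Type*} [Field k] [Finite ι] {M : ι → Type*} [∀ a, AddCommGroup (M a)]
    [∀ a, Module k (M a)] (f : ∀ a, M a) (hf : ∀ a, f a ≠ 0) : PiTensorProduct.tprod k f ≠ 0 := by
  have := Fintype.ofFinite ι
  choose φ hφ using fun a => Module.Projective.exists_dual_eq_one k (hf a)
  intro h
  have h1 := congrArg (PiTensorProduct.lift
    ((MultilinearMap.mkPiAlgebra k ι k).compLinearMap φ)) h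
  simp [hφ] at h1

variable {k : Type*} [Field k] {V : Type*} [Category V] [Preadditive V] [Linear k V] {n : ℕ}

lemma pureHom_smul {X Y : TensorWord k V n} (c : Fin n → k) (f : ∀ a, X.X a ⟶ Y.X a) :
    pureHom (X := X) (Y := Y) (fun a => c a • f a) = (∏ a, c a) • pureHom f :=
  (PiTensorProduct.tprod k).map_smul_univ c f

lemma pureHom_eq_zero {X Y : TensorWord k V n} (f : ∀ a, X.X a ⟶ Y.X a) {a : Fin n}
    (h : f a = 0) : pureHom (X := X) (Y := Y) f = 0 :=
  (PiTensorProduct.tprod k).map_coord_zero a h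

lemma hom_ind {X Y : TensorWord k V n} {N : Type*} [AddCommGroup N] [Module k N]
    {p q : (X ⟶ Y) →ₗ[k] N} (h : ∀ f : ∀ a, X.X a ⟶ Y.X a, p (pureHom f) = q (pureHom f))
    (x : X ⟶ Y) : p x = q x :=
  word_ind h x

lemma hom_mem {X Y : TensorWord k V n} (N : Submodule k (X ⟶ Y))
    (h : ∀ f : ∀ a, X.X a ⟶ Y.X a, pureHom f ∈ N) (x : X ⟶ Y) : x ∈ N :=
  (Submodule.Quotient.mk_eq_zero N).mp (hom_ind (p := N.mkQ) (q := 0)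
    (fun f => (Submodule.Quotient.mk_eq_zero N).mpr (h f)) x)

/-- Tensor products of scalars are scalars, and a single zero factor kills a tensor. Decompositions
of the identities of the factors multiply out to a decomposition indexed by choice functions. -/
lemma SimpleFamily.word {W : Type*} {S : W → V} (hS : SimpleFamily k S) (n : ℕ) :
    SimpleFamily k (fun w : Fin n → W => (⟨fun a => S (w a)⟩ : TensorWord k V n)) where
  hom_eq_zero {w w'} hw f := by
    obtain ⟨a, ha⟩ := Function.ne_iff.mp hw
    exact hom_ind (p := LinearMap.id) (q := 0) (fun f => pureHom_eq_zero f
      (hS.hom_eq_zero ha (f a))) f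
  exists_smul w f := by
    let Y : TensorWord k V n := ⟨fun a => S (w a)⟩
    have key : f ∈ Submodule.span k {𝟙 Y} := by
      refine hom_mem (X := Y) (Y := Y) _ (fun f => ?_) f
      choose c hc using fun a => hS.exists_smul (w a) (f a)
      refine Submodule.mem_span_singleton.mpr ⟨∏ a, c a, ?_⟩
      refine (pureHom_smul (X := Y) (Y := Y) c fun a => 𝟙 (S (w a))).symm.trans ?_
      exact congrArg pureHom (funext fun a => (hc a).symm)
    obtain ⟨c, hc⟩ := Submodule.mem_span_singleton.mp key
    exact ⟨c, hc.symm⟩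
  decomp Y := by
    choose ι hι w p q hY using fun a => hS.decomp (Y.X a)
    refine ⟨∀ a, ι a, inferInstance, fun x a => w a (x a), fun x => pureHom fun a => p a (x a),
      fun x => pureHom fun a => q a (x a), ?_⟩
    have h1 : 𝟙 Y = pureHom (X := Y) (Y := Y) fun a => ∑ i, p a i ≫ q a i := by
      rw [← pureHom_id]
      exact congrArg pureHom (funext hY)
    rw [h1]
    refine ((PiTensorProduct.tprod k).map_sum fun a i => p a i ≫ q a i).trans ?_
    exact Finset.sum_congr rfl fun x _ => (pureHom_comp (X := Y) (Y := ⟨fun a => S (w a (x a))⟩)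
      (Z := Y) (fun a => p a (x a)) fun a => q a (x a)).symm

lemma permRep_mulIso'_hom {σ τ q : Equiv.Perm (Fin n)} (h : σ * τ = q) (X : TensorWord k V n) :
    ((permRep k V n).mulIso' h).hom.app X =
      pureHom (X := ((permRep k V n).F τ ⋙ (permRep k V n).F σ).obj X)
        (Y := ((permRep k V n).F q).obj X)
        fun a => eqToHom (by subst h; rfl : X.X (τ⁻¹ (σ⁻¹ a)) = X.X (q⁻¹ a)) := by
  subst h
  rw [mulIso'_rfl]
  rfl

lemma wordRep_mulIso'_hom {G : Type*} [Group G] (ρ : TwoRep k G V) {g h p : G} (e : g * h = p)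
    (X : TensorWord k V n) :
    ((wordRep ρ n).mulIso' e).hom.app X =
      pureHom (X := ((wordRep ρ n).F h ⋙ (wordRep ρ n).F g).obj X) (Y := ((wordRep ρ n).F p).obj X)
        fun a => (ρ.mulIso' e).hom.app (X.X a) := by
  subst e
  simp only [mulIso'_rfl]
  rfl

lemma word_gcomp {G : Type*} [Group G] (ρ : TwoRep k G V) {g h p : G} (e : g * h = p)
    {X Y Z : TensorWord k V n} (f : ∀ a, X.X a ⟶ (ρ.F g).obj (Y.X a))
    (f' : ∀ a, Y.X a ⟶ (ρ.F h).obj (Z.X a)) :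
    (wordRep ρ n).gcomp e (pureHom (Y := ((wordRep ρ n).F g).obj Y) f)
        (pureHom (Y := ((wordRep ρ n).F h).obj Z) f') =
      pureHom (X := X) (Y := ((wordRep ρ n).F p).obj Z) fun a => ρ.gcomp e (f a) (f' a) := by
  have h1 : ((wordRep ρ n).F g).map (pureHom (X := Y) (Y := ((wordRep ρ n).F h).obj Z) f') =
      pureHom (X := ((wordRep ρ n).F g).obj Y)
        (Y := ((wordRep ρ n).F h ⋙ (wordRep ρ n).F g).obj Z) fun a => (ρ.F g).map (f' a) :=
    wordMap_pureHom (ρ.F g) (X := Y) (Y := ((wordRep ρ n).F h).obj Z) f'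
  rw [gcomp, wordRep_mulIso'_hom, h1]
  refine (congrArg (_ ≫ ·) (pureHom_comp (X := ((wordRep ρ n).F g).obj Y)
    (Y := ((wordRep ρ n).F h ⋙ (wordRep ρ n).F g).obj Z) (Z := ((wordRep ρ n).F p).obj Z)
    (fun a => (ρ.F g).map (f' a)) _)).trans ?_
  exact pureHom_comp (X := X) (Y := ((wordRep ρ n).F g).obj Y) (Z := ((wordRep ρ n).F p).obj Z)
    f fun a => (ρ.F g).map (f' a) ≫ (ρ.mulIso' e).hom.app (Z.X a)

/-- Invariance of a family of natural transformations can be checked on a simple family. -/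
lemma SimpleFamily.invariant {H G : Type*} [Group H] [Group G] {B : Type*} [Category B]
    [Preadditive B] [Linear k B] {W : Type*} {S : W → B} (hS : SimpleFamily k S)
    {τ : TwoRep k H B} {ρ : TwoRep k G B} (K : Commuting τ ρ) {g : G}
    (Θ : ∀ σ : H, 𝟭 B ⟶ τ.F σ ⋙ ρ.F g)
    (h : ∀ {π σ σ' q : H} (h : σ' * π = q) (h' : π * σ = q) (w : W),
      (Θ σ').app ((τ.F π).obj (S w)) ≫ (ρ.F g).map ((τ.mulIso' h).hom.app (S w)) =
        (τ.F π).map ((Θ σ).app (S w)) ≫ (K.c π g).inv.app ((τ.F σ).obj (S w)) ≫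
          (ρ.F g).map ((τ.mulIso' h').hom.app (S w))) : Invariant K Θ := by
  intro π σ σ' q h₁ h₂ Y
  let α : τ.F π ⟶ τ.F q ⋙ ρ.F g :=
    Functor.whiskerLeft (τ.F π) (Θ σ') ≫ Functor.whiskerRight (τ.mulIso' h₁).hom (ρ.F g)
  let β : τ.F π ⟶ τ.F q ⋙ ρ.F g :=
    Functor.whiskerRight (Θ σ) (τ.F π) ≫ Functor.whiskerLeft (τ.F σ) (K.c π g).inv ≫
      Functor.whiskerRight (τ.mulIso' h₂).hom (ρ.F g)
  have := hS.app_ext α β (fun w => by simpa [α, β] using h h₁ h₂ w) Y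
  simpa [α, β] using this

end WordFamily

/-! ### Words of simple objects. -/

section Words

variable {k : Type u} [Field k] {m : ℕ} {G : Type*} [Group G] (ρ : TwoRep k G (VectPow k m))
  (g : G) {n : ℕ}

/-- The formal tensor product of simple objects with indices `w`. -/
def simpleWord (k : Type u) [Field k] {m n : ℕ} (w : Fin n → Fin m) :
    TensorWord k (VectPow k m) n :=
  ⟨fun a => simpleObj k (w a)⟩

/-- The tensor product of the morphisms `basisHom`. -/
def wordBasis (h : G) (w w' : Fin n → Fin m) :
    simpleWord k w ⟶ ((wordRep ρ n).F h).obj (simpleWord k w') :=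
  pureHom (X := simpleWord k w) (Y := ((wordRep ρ n).F h).obj (simpleWord k w'))
    fun a => basisHom ρ h (w a) (w' a)

/-- The coefficient of a morphism with respect to `wordBasis`. -/
def wordCoef (h : G) (w w' : Fin n → Fin m) :
    (simpleWord k w ⟶ ((wordRep ρ n).F h).obj (simpleWord k w')) →ₗ[k] k :=
  PiTensorProduct.lift ((MultilinearMap.mkPiAlgebra k (Fin n) k).compLinearMap
    fun a => coef ρ h (w a) (w' a))

lemma wordCoef_pureHom (h : G) (w w' : Fin n → Fin m)
    (f : ∀ a, simpleObj k (w a) ⟶ (ρ.F h).obj (simpleObj k (w' a))) :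
    wordCoef ρ h w w' (pureHom (X := simpleWord k w)
      (Y := ((wordRep ρ n).F h).obj (simpleWord k w')) f) = ∏ a, coef ρ h (w a) (w' a) (f a) :=
  (PiTensorProduct.lift.tprod f).trans rfl

lemma wordCoef_smul (h : G) (w w' : Fin n → Fin m)
    (f : simpleWord k w ⟶ ((wordRep ρ n).F h).obj (simpleWord k w')) :
    wordCoef ρ h w w' f • wordBasis ρ h w w' = f := by
  refine hom_ind (p := (LinearMap.toSpanSingleton k _ (wordBasis ρ h w w')).comp
    (wordCoef ρ h w w')) (q := LinearMap.id) (fun f => ?_) f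
  change wordCoef ρ h w w' (pureHom f) • wordBasis ρ h w w' = pureHom f
  refine (congrArg (· • wordBasis ρ h w w') (wordCoef_pureHom ρ h w w' f)).trans ?_
  refine (pureHom_smul (X := simpleWord k w) (Y := ((wordRep ρ n).F h).obj (simpleWord k w'))
    _ _).symm.trans ?_
  exact congrArg pureHom (funext fun a => coef_smul_basisHom ρ (f a))

lemma wordBasis_ne_zero {h : G} {w w' : Fin n → Fin m} (e : ∀ a, w a = idxPerm ρ h (w' a)) :
    wordBasis ρ h w w' ≠ 0 :=
  tprod_ne_zero _ fun a => basisHom_ne_zero ρ (e a)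

lemma word_hom_eq_zero {h : G} {w w' : Fin n → Fin m} (e : ¬ ∀ a, w a = idxPerm ρ h (w' a))
    (f : simpleWord k w ⟶ ((wordRep ρ n).F h).obj (simpleWord k w')) : f = 0 := by
  obtain ⟨a, ha⟩ := not_forall.mp e
  rw [← wordCoef_smul ρ h w w' f]
  have : wordBasis ρ h w w' = 0 := pureHom_eq_zero _ (basisHom_eq_zero ρ ha)
  rw [this, smul_zero]

lemma basisHom_eqToHom {h : G} {i j j' : Fin m} (e : j = j')
    (e' : simpleObj k j = simpleObj k j') :
    basisHom ρ h i j ≫ (ρ.F h).map (eqToHom e') = basisHom ρ h i j' := by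
  subst e
  simp

/-- The structure isomorphisms of the `S_n`-action are identities, so permutations carry the chosen
generators to each other without scalars. -/
lemma wordBasis_mulIso' (w : Fin n → Fin m) {α σ q : Equiv.Perm (Fin n)} (h : σ * α = q) :
    wordBasis ρ g (w ∘ ⇑α⁻¹) ((w ∘ ⇑α⁻¹) ∘ ⇑σ⁻¹) ≫ ((wordRep ρ n).F g).map
        (((permRep k (VectPow k m) n).mulIso' h).hom.app (simpleWord k w)) =
      wordBasis ρ g (w ∘ ⇑α⁻¹) (w ∘ ⇑q⁻¹) := by
  rw [permRep_mulIso'_hom]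
  refine (congrArg (_ ≫ ·) (wordMap_pureHom (ρ.F g) _)).trans ((pureHom_comp _ _).trans ?_)
  refine congrArg pureHom (funext fun a => basisHom_eqToHom ρ ?_ _)
  subst h
  rfl

lemma map_wordBasis_mulIso' (w : Fin n → Fin m) {α σ q : Equiv.Perm (Fin n)} (h : α * σ = q) :
    ((permRep k (VectPow k m) n).F α).map (wordBasis ρ g w (w ∘ ⇑σ⁻¹)) ≫
        ((wordCommuting ρ n).c α g).inv.app
          (((permRep k (VectPow k m) n).F σ).obj (simpleWord k w)) ≫
        ((wordRep ρ n).F g).map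
          (((permRep k (VectPow k m) n).mulIso' h).hom.app (simpleWord k w)) =
      wordBasis ρ g (w ∘ ⇑α⁻¹) (w ∘ ⇑q⁻¹) := by
  rw [permRep_mulIso'_hom]
  refine (congrArg₂ (· ≫ ·) (wordPerm_pureHom α _) (congrArg (_ ≫ ·)
    (wordMap_pureHom (ρ.F g) _))).trans ?_
  refine (congrArg (_ ≫ ·) (pureHom_comp _ _)).trans ((pureHom_comp _ _).trans ?_)
  refine congrArg pureHom (funext fun a => ?_)
  refine (congrArg (_ ≫ ·) (Category.id_comp _)).trans (basisHom_eqToHom ρ ?_ _)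
  subst h
  rfl

lemma map_wordBasis_comm (h : G) (w w' : Fin n → Fin m) (σ : Equiv.Perm (Fin n)) :
    ((permRep k (VectPow k m) n).F σ).map (wordBasis ρ h w w') ≫
        ((wordCommuting ρ n).c σ h).inv.app (simpleWord k w') =
      wordBasis ρ h (w ∘ ⇑σ⁻¹) (w' ∘ ⇑σ⁻¹) := by
  refine (congrArg (· ≫ _) (wordPerm_pureHom σ _)).trans ((pureHom_comp _ _).trans ?_)
  exact congrArg pureHom (funext fun a => Category.comp_id _)

lemma gcomp_wordBasis (s : Subgroup.centralizer ({g} : Set G)) {q : G} (h₁ : (s : G) * g = q)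
    (h₂ : g * (s : G) = q) (w w' : Fin n → Fin m) (hw : ∀ a, w a = idxPerm ρ g (w' a)) :
    (wordRep ρ n).gcomp h₁ (wordBasis ρ s (idxPerm ρ s ∘ w) w) (wordBasis ρ g w w') =
      (∏ a, twist ρ g s (w' a)) • (wordRep ρ n).gcomp h₂
        (wordBasis ρ g (idxPerm ρ s ∘ w) (idxPerm ρ s ∘ w'))
        (wordBasis ρ s (idxPerm ρ s ∘ w') w') := by
  obtain rfl : w = idxPerm ρ g ∘ w' := funext hw
  refine (word_gcomp ρ h₁ (X := simpleWord k (idxPerm ρ s ∘ idxPerm ρ g ∘ w'))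
    (Y := simpleWord k (idxPerm ρ g ∘ w')) (Z := simpleWord k w') _ _).trans ?_
  refine Eq.trans ?_ (congrArg (_ • ·) (word_gcomp ρ h₂
    (X := simpleWord k (idxPerm ρ s ∘ idxPerm ρ g ∘ w'))
    (Y := simpleWord k (idxPerm ρ s ∘ w')) (Z := simpleWord k w') _ _).symm)
  refine Eq.trans ?_ (pureHom_smul _ _)
  exact congrArg pureHom (funext fun a => gcomp_basisHom ρ g s h₁ h₂ _ _)

lemma gcomp_wordBasis_ne_zero {s q : G} (h₁ : s * g = q) (w w' : Fin n → Fin m)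
    (hw : ∀ a, w a = idxPerm ρ g (w' a)) :
    (wordRep ρ n).gcomp h₁ (wordBasis ρ s (idxPerm ρ s ∘ w) w) (wordBasis ρ g w w') ≠ 0 := by
  intro h0
  have h1 := (word_gcomp ρ h₁ (X := simpleWord k (idxPerm ρ s ∘ w))
    (Y := simpleWord k w) (Z := simpleWord k w') (fun a => basisHom ρ s _ _)
      fun a => basisHom ρ g _ _).symm.trans h0
  refine tprod_ne_zero _ (fun a => ?_) h1
  have := isIso_basisHom ρ (rfl : idxPerm ρ s (w a) = _)
  exact gcomp_ne_zero ρ h₁ (basisHom ρ s (idxPerm ρ s (w a)) (w a)) (basisHom_ne_zero ρ (hw a))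

end Words

/-- Words `w` in `I` with a permutation `σ` of the letters such that `w ∘ σ = π ∘ w`. -/
def EqWord {I : Type*} (π : Equiv.Perm I) (n : ℕ) : Type _ :=
  {p : (Fin n → I) × Equiv.Perm (Fin n) // ∀ a, p.1 (p.2 a) = π (p.1 a)}

/-- The second form is the condition under which `wordBasis` of degree `g` from `w` to `w ∘ σ⁻¹` is
nonzero, for `π` the permutation of `g`. -/
lemma EqWord.apply_inv {I : Type*} {π : Equiv.Perm I} {n : ℕ} {w : Fin n → I}
    {σ : Equiv.Perm (Fin n)} : (∀ a, w (σ a) = π (w a)) ↔ ∀ a, w a = π ((w ∘ ⇑σ⁻¹) a) := by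
  constructor
  · intro h a
    rw [Function.comp_apply, ← h]
    simp
  · intro h a
    rw [h (σ a), Function.comp_apply]
    simp

/-! ### Coordinates on the character of `Sym^n(ρ)`. -/

section SymCoords

variable {k : Type u} [Field k] {m : ℕ} {G : Type*} [Group G] (ρ : TwoRep k G (VectPow k m))
  (g : G) {n : ℕ}

lemma simpleFamily_word (k : Type u) [Field k] (m n : ℕ) :
    SimpleFamily k (simpleWord k : (Fin n → Fin m) → TensorWord k (VectPow k m) n) :=
  (simpleFamily_vectPow k m).word n

/-- The coordinates of a natural transformation on `Sym^n(V)`. -/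
def symCoord (ζ : (wordCommuting ρ n).mat.residual.Char g) (w : Fin n → Fin m)
    (σ : Equiv.Perm (Fin n)) : k :=
  wordCoef ρ g w (w ∘ ⇑σ⁻¹) (indComp ζ σ (simpleWord k w))

lemma symCoord_smul (ζ : (wordCommuting ρ n).mat.residual.Char g) (w : Fin n → Fin m)
    (σ : Equiv.Perm (Fin n)) :
    indComp ζ σ (simpleWord k w) = symCoord ρ g ζ w σ • wordBasis ρ g w (w ∘ ⇑σ⁻¹) :=
  (wordCoef_smul ρ g w (w ∘ ⇑σ⁻¹) (indComp ζ σ (simpleWord k w))).symm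

/-- A component of a natural transformation on `Sym^n(V)` as a natural transformation. -/
def indNat {H : Type} [Group H] [Fintype H] {C : Type*} [Category C] [Preadditive C] [Linear k C]
    {τ : TwoRep k H C} {ρ : TwoRep k G C} {K : Commuting τ ρ} {g : G}
    (ζ : K.mat.residual.Char g) (σ : H) : 𝟭 C ⟶ τ.F σ ⋙ ρ.F g where
  app Y := indComp ζ σ Y
  naturality _ _ f := indComp_natural ζ σ f

/-- The components determine `ζ` by `charEntry_eq`. Being natural, they are determined on words of
simple objects, where they vanish unless `w ∘ σ = π ∘ w`. -/
lemma symCoord_ext {ζ ζ' : (wordCommuting ρ n).mat.residual.Char g}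
    (h : ∀ (w : Fin n → Fin m) (σ : Equiv.Perm (Fin n)), (∀ a, w (σ a) = idxPerm ρ g (w a)) →
      symCoord ρ g ζ w σ = symCoord ρ g ζ' w σ) : ζ = ζ' := by
  refine char_ext_entry fun X i j => ?_
  rw [charEntry_eq, charEntry_eq]
  refine Finset.sum_congr rfl fun σ _ => congrArg (· ≫ _) ?_
  refine (simpleFamily_word k m n).app_ext (indNat ζ σ) (indNat ζ' σ) (fun w => ?_) _
  by_cases hw : ∀ a, w (σ a) = idxPerm ρ g (w a)
  · refine (symCoord_smul ρ g ζ w σ).trans (Eq.trans ?_ (symCoord_smul ρ g ζ' w σ).symm)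
    rw [h w σ hw]
  · rw [EqWord.apply_inv] at hw
    exact (word_hom_eq_zero ρ hw _).trans (word_hom_eq_zero ρ hw _).symm

lemma smul_wordBasis_inj {h : G} {w w' : Fin n → Fin m} (e : ∀ a, w a = idxPerm ρ h (w' a))
    {c d : k} (h : c • wordBasis ρ h w w' = d • wordBasis ρ h w w') : c = d := by
  have h1 := sub_eq_zero.mpr h
  rw [← sub_smul] at h1
  exact sub_eq_zero.mp ((smul_eq_zero.mp h1).resolve_right (wordBasis_ne_zero ρ e))

lemma smul_wordBasis_mulIso' {α σ' q : Equiv.Perm (Fin n)} (w : Fin n → Fin m)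
    (h : σ' * α = q) (c : k) :
    (c • wordBasis ρ g (w ∘ ⇑α⁻¹) ((w ∘ ⇑α⁻¹) ∘ ⇑σ'⁻¹)) ≫ ((wordRep ρ n).F g).map
      (((permRep k (VectPow k m) n).mulIso' h).hom.app (simpleWord k w)) =
    c • wordBasis ρ g (w ∘ ⇑α⁻¹) (w ∘ ⇑q⁻¹) :=
  (Linear.smul_comp _ _ _ _ _ _).trans (congrArg (c • ·) (wordBasis_mulIso' ρ g w h))

lemma map_smul_wordBasis_mulIso' {α σ q : Equiv.Perm (Fin n)} (w : Fin n → Fin m)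
    (h : α * σ = q) (c : k) :
    ((permRep k (VectPow k m) n).F α).map (c • wordBasis ρ g w (w ∘ ⇑σ⁻¹)) ≫
        ((wordCommuting ρ n).c α g).inv.app
          (((permRep k (VectPow k m) n).F σ).obj (simpleWord k w)) ≫
        ((wordRep ρ n).F g).map
          (((permRep k (VectPow k m) n).mulIso' h).hom.app (simpleWord k w)) =
      c • wordBasis ρ g (w ∘ ⇑α⁻¹) (w ∘ ⇑q⁻¹) :=
  (congrArg (· ≫ _) (Functor.map_smul ((permRep k (VectPow k m) n).F α)
    c (wordBasis ρ g w (w ∘ ⇑σ⁻¹)))).trans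
    ((Linear.smul_comp _ _ _ _ _ _).trans (congrArg (c • ·) (map_wordBasis_mulIso' ρ g w h)))

/-- This is `indComp_conj` on a word of simple objects. Both sides are multiples of one generator,
nonzero by `hw`. -/
lemma symCoord_conj_perm (ζ : (wordCommuting ρ n).mat.residual.Char g) (w : Fin n → Fin m)
    (σ α : Equiv.Perm (Fin n)) (hw : ∀ a, w (σ a) = idxPerm ρ g (w a)) :
    symCoord ρ g ζ (w ∘ ⇑α⁻¹) (α * σ * α⁻¹) = symCoord ρ g ζ w σ := by
  have h1 : α * σ * α⁻¹ * α = α * σ := by group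
  have e := indComp_conj ζ h1 rfl (simpleWord k w)
  have e0 : indComp ζ (α * σ * α⁻¹) (((permRep k (VectPow k m) n).F α).obj (simpleWord k w)) =
      symCoord ρ g ζ (w ∘ ⇑α⁻¹) (α * σ * α⁻¹) •
        wordBasis ρ g (w ∘ ⇑α⁻¹) ((w ∘ ⇑α⁻¹) ∘ ⇑(α * σ * α⁻¹)⁻¹) :=
    symCoord_smul ρ g ζ (w ∘ ⇑α⁻¹) (α * σ * α⁻¹)
  have e2 := (smul_wordBasis_mulIso' ρ g w h1 _).symm.trans
    ((congrArg (· ≫ _) e0).symm.trans (e.trans ((congrArg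
      (((permRep k (VectPow k m) n).F α).map · ≫ _) (symCoord_smul ρ g ζ w σ)).trans
        (map_smul_wordBasis_mulIso' ρ g w rfl _))))
  refine smul_wordBasis_inj ρ (fun a => ?_) e2
  rw [EqWord.apply_inv] at hw
  exact hw (α⁻¹ a)

/-- The values of `f` define each `Θ_σ` on words of simple objects, hence everywhere. Conjugation
invariance of `f` makes the family invariant, so that it comes from some `ζ`. -/
lemma exists_symCoord_eq (f : (Fin n → Fin m) → Equiv.Perm (Fin n) → k)
    (hf : ∀ (w : Fin n → Fin m) (σ α : Equiv.Perm (Fin n)), (∀ a, w (σ a) = idxPerm ρ g (w a)) →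
      f (w ∘ ⇑α⁻¹) (α * σ * α⁻¹) = f w σ) :
    ∃ ζ : (wordCommuting ρ n).mat.residual.Char g, ∀ (w : Fin n → Fin m) (σ : Equiv.Perm (Fin n)),
      (∀ a, w (σ a) = idxPerm ρ g (w a)) → symCoord ρ g ζ w σ = f w σ := by
  have hΘ := fun σ : Equiv.Perm (Fin n) => (simpleFamily_word k m n).exists_nat
    (F := (permRep k (VectPow k m) n).F σ ⋙ (wordRep ρ n).F g)
    fun w => f w σ • wordBasis ρ g w (w ∘ ⇑σ⁻¹)
  choose Θ hΘ using hΘ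
  have inv : Invariant (wordCommuting ρ n) Θ := by
    refine (simpleFamily_word k m n).invariant _ Θ ?_
    intro α σ σ' q h h' w
    have e0 : (Θ σ').app (((permRep k (VectPow k m) n).F α).obj (simpleWord k w)) =
      f (w ∘ ⇑α⁻¹) σ' • wordBasis ρ g (w ∘ ⇑α⁻¹) ((w ∘ ⇑α⁻¹) ∘ ⇑σ'⁻¹) := hΘ σ' (w ∘ ⇑α⁻¹)
    refine (congrArg (· ≫ _) e0).trans ((smul_wordBasis_mulIso' ρ g w h _).trans (Eq.trans ?_
      ((congrArg (((permRep k (VectPow k m) n).F α).map · ≫ _) (hΘ σ w)).trans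
        (map_smul_wordBasis_mulIso' ρ g w h' _)).symm))
    by_cases hw : ∀ a, w (σ a) = idxPerm ρ g (w a)
    · have hσ : σ' = α * σ * α⁻¹ := by rw [h', ← h]; group
      rw [hσ, hf w σ α hw]
    -- For a pair with `w ∘ σ ≠ π ∘ w` the target space is zero, so nothing is required of `f`
    -- there.
    · have h0 : wordBasis ρ g (w ∘ ⇑α⁻¹) (w ∘ ⇑q⁻¹) = 0 := by
        refine word_hom_eq_zero ρ (fun h2 => hw ?_) _
        rw [EqWord.apply_inv]
        intro a
        have h3 := h2 (α a)
        subst h'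
        simpa using h3
      rw [h0, smul_zero, smul_zero]
  obtain ⟨ζ, hζ⟩ := exists_indComp_eq inv
  refine ⟨ζ, fun w σ hw => ?_⟩
  have e1 := (symCoord_smul ρ g ζ w σ).symm.trans ((hζ σ (simpleWord k w)).trans (hΘ σ w))
  rw [EqWord.apply_inv] at hw
  exact smul_wordBasis_inj ρ hw e1

lemma eq_of_smul_eq_smul {M : Type*} [AddCommGroup M] [Module k M] {a b c : k} {x y : M}
    (h : y = c • x) (hy : y ≠ 0) (h' : a • x = b • x) : a = b := by
  refine smul_left_injective k (fun h0 => hy ?_) h'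
  rw [h, h0, smul_zero]

/-- Naturality of `ψ_s(ζ)` along the generator of degree `s` between words, as in `charCoords_conj`,
now with one scalar for each letter. -/
lemma symCoord_conj (s : Subgroup.centralizer ({g} : Set G)) (e : (s : G) * g * (s : G)⁻¹ = g)
    (ζ : (wordCommuting ρ n).mat.residual.Char g) (w : Fin n → Fin m)
    (σ : Equiv.Perm (Fin n)) (hw : ∀ a, w (σ a) = idxPerm ρ g (w a)) :
    symCoord ρ g ((wordCommuting ρ n).mat.residual.conj e ζ) (idxPerm ρ s ∘ w) σ =
      (∏ a, twist ρ g s (w a)) * symCoord ρ g ζ w σ := by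
  have h := indComp_conj_gcomp e rfl (centralizer_comm s) ζ σ
    (wordBasis ρ s (idxPerm ρ s ∘ w) w)
  have hw' := EqWord.apply_inv.mp hw
  have h2 := (congrArg _ (map_wordBasis_comm ρ (s : G) (idxPerm ρ s ∘ w) w σ)).symm.trans h
  rw [symCoord_smul, symCoord_smul] at h2
  have h3 := (gcomp_smul_left (wordRep ρ n) _ _ _ _).symm.trans
    (h2.trans (gcomp_smul_right (wordRep ρ n) _ _ _ _))
  have h4 := gcomp_wordBasis ρ g s (centralizer_comm s) rfl w (w ∘ ⇑σ⁻¹) hw'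
  have h5 := h3.trans ((congrArg (symCoord ρ g ζ w σ • ·) h4).trans (smul_smul _ _ _))
  have h6 := gcomp_wordBasis_ne_zero ρ g (centralizer_comm s) w (w ∘ ⇑σ⁻¹) hw'
  have h9 := eq_of_smul_eq_smul h4 h6 h5
  rw [h9, mul_comm]
  congr 1
  -- The exchange of generators produces the scalars at the letters of `w ∘ σ⁻¹`, which are those of
  -- `w` in another order.
  exact Equiv.prod_comp σ⁻¹ fun a => twist ρ g s (w a)

end SymCoords

/-! ### Equivariant words up to conjugation are multisets of cycles. -/

section OrbitLabels

open Equiv.Perm (SameCycle)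

/-- The multiplicity of a value is the size of its fibre, so corresponding fibres are in bijection.
-/
lemma exists_equiv_of_map_univ_eq {A B X : Type*} [Fintype A] [Fintype B] {f : A → X} {h : B → X}
    (e : (Finset.univ.val : Multiset A).map f = (Finset.univ.val : Multiset B).map h) :
    ∃ E : A ≃ B, ∀ a, h (E a) = f a := by
  classical
  have key : ∀ c, Nonempty ({a // f a = c} ≃ {b // h b = c}) := fun c => by
    refine ⟨Fintype.equivOfCardEq ?_⟩
    have := congrArg (Multiset.count c) e
    rw [Multiset.count_map, Multiset.count_map] at this
    rw [Fintype.card_subtype, Fintype.card_subtype]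
    simpa [Finset.card_def, eq_comm] using this
  exact ⟨Equiv.ofFiberEquiv fun c => (key c).some, fun a => Equiv.ofFiberEquiv_map _ a⟩

variable {I : Type*} {π : Equiv.Perm I} {A : Type*} {w : A → I} {σ : Equiv.Perm A}

lemma apply_zpow (hw : ∀ a, w (σ a) = π (w a)) (j : ℤ) (a : A) :
    w ((σ ^ j) a) = (π ^ j) (w a) := by
  have hn : ∀ (n : ℕ) (a : A), w ((σ ^ n) a) = (π ^ n) (w a) := fun n a => by
    induction n with
    | zero => rfl
    | succ n ih => rw [pow_succ', Equiv.Perm.mul_apply, hw, ih, pow_succ', Equiv.Perm.mul_apply]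
  obtain ⟨n, rfl | rfl⟩ := j.eq_nat_or_neg
  · simpa using hn n a
  · rw [zpow_neg, zpow_neg, zpow_natCast, zpow_natCast, Equiv.Perm.eq_inv_iff_eq, ← hn]
    simp

lemma pow_period_apply (hw : ∀ a, w (σ a) = π (w a)) (a : A) :
    (π ^ MulAction.period σ a) (w a) = w a := by
  have := apply_zpow hw (MulAction.period σ a) a
  rw [zpow_natCast, zpow_natCast] at this
  rw [← this]
  exact congrArg w (MulAction.pow_period_smul σ a)

lemma sigma_mk_eq {r r' : ℕ+} {i i' : I} {hi : (π ^ (r : ℕ)) i = i}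
    {hi' : (π ^ (r' : ℕ)) i' = i'} :
    (⟨r, Label.mk i hi⟩ : Σ r : ℕ+, Label π r) = ⟨r', Label.mk i' hi'⟩ ↔
      (r : ℕ) = r' ∧ SameCycle π i i' := by
  constructor
  · intro h
    obtain ⟨rfl, h2⟩ := Sigma.mk.inj_iff.mp h
    exact ⟨rfl, Label.mk_eq_mk.mp (eq_of_heq h2)⟩
  · rintro ⟨h1, h2⟩
    obtain rfl := PNat.coe_injective h1
    rw [Label.mk_eq_mk.mpr h2]

variable [Finite A]

lemma period_pos (σ : Equiv.Perm A) (a : A) : 0 < MulAction.period σ a :=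
  MulAction.period_pos_of_orderOf_pos (orderOf_pos σ) a

/-- The powers of `σ` below the period list a cycle exactly once from its chosen representative. In
the form with `Multiplicative ℕ` this also serves to count letters. -/
lemma prod_eq_prod_orbits [Fintype A] (σ : Equiv.Perm A)
    [Fintype (Quotient (SameCycle.setoid σ))] {M : Type*} [CommMonoid M] (h : A → M) :
    ∏ a, h a = ∏ o : Quotient (SameCycle.setoid σ),
      ∏ j ∈ Finset.range (MulAction.period σ o.out), h ((σ ^ j) o.out) := by
  classical
  rw [← Finset.prod_fiberwise Finset.univ (fun a => Quotient.mk (SameCycle.setoid σ) a) h]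
  refine Finset.prod_congr rfl fun o _ => ?_
  rw [← Finset.prod_image (f := h) (g := fun j => (σ ^ j) o.out)]
  · refine Finset.prod_congr ?_ fun _ _ => rfl
    ext a
    simp only [Finset.mem_filter, Finset.mem_univ, true_and, Finset.mem_image, Finset.mem_range]
    constructor
    · rintro rfl
      obtain ⟨z, hz⟩ := Quotient.mk_out (s := SameCycle.setoid σ) a
      set b := (Quotient.mk (SameCycle.setoid σ) a).out
      have hp : (0 : ℤ) < MulAction.period σ b := by exact_mod_cast period_pos σ b
      refine ⟨(z % MulAction.period σ b).toNat, ?_, ?_⟩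
      · have := Int.emod_lt_of_pos z hp
        have := Int.emod_nonneg z hp.ne'
        omega
      · rw [← zpow_natCast, Int.toNat_of_nonneg (Int.emod_nonneg z hp.ne'), ← hz]
        exact MulAction.zpow_mod_period_smul (g := σ) (a := b) z
    · rintro ⟨j, -, rfl⟩
      refine Eq.trans (Quotient.sound ?_) (Quotient.out_eq o)
      exact ⟨-j, by simp⟩
  · intro i hi j hj hij
    have hi' : i < MulAction.period σ o.out := by simpa using hi
    have hj' : j < MulAction.period σ o.out := by simpa using hj
    wlog hle : i ≤ j generalizing i j
    · exact (this hj hi hij.symm hj' hi' (by omega)).symm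
    have h1 : (σ ^ (j - i)) • (o.out : A) = o.out := by
      have : (σ ^ i) ((σ ^ (j - i)) o.out) = (σ ^ i) o.out := by
        rw [← Equiv.Perm.mul_apply, ← pow_add, Nat.add_sub_cancel' hle]
        exact hij.symm
      exact (σ ^ i).injective this
    rw [MulAction.pow_smul_eq_iff_period_dvd] at h1
    have := Nat.eq_zero_of_dvd_of_lt h1 (by omega)
    omega

/-- The length of the cycle of a letter and the cycle of its image. -/
def pointLabel (hw : ∀ a, w (σ a) = π (w a)) (a : A) : Σ r : ℕ+, Label π r :=
  ⟨⟨MulAction.period σ a, period_pos σ a⟩, Label.mk (w a) (pow_period_apply hw a)⟩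

lemma pointLabel_apply (hw : ∀ a, w (σ a) = π (w a)) (a b : A) (h : SameCycle σ a b) :
    pointLabel hw a = pointLabel hw b := by
  obtain ⟨z, rfl⟩ := h
  refine sigma_mk_eq.mpr ⟨?_, z, (apply_zpow hw z a).symm⟩
  have key : ∀ n : ℕ, (σ ^ n) • a = a ↔ (σ ^ n) • ((σ ^ z) a) = (σ ^ z) a := fun n => by
    rw [Equiv.Perm.smul_def, Equiv.Perm.smul_def, ← Equiv.Perm.mul_apply,
      (Commute.pow_left (Commute.zpow_right (Commute.refl σ) z) n).eq, Equiv.Perm.mul_apply,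
      EmbeddingLike.apply_eq_iff_eq]
  simp only [MulAction.pow_smul_eq_iff_period_dvd] at key
  exact Nat.dvd_antisymm ((key _).mpr dvd_rfl) ((key _).mp dvd_rfl)

/-- The label of a cycle of letters. -/
def orbitLabel (hw : ∀ a, w (σ a) = π (w a)) :
    Quotient (SameCycle.setoid σ) → Σ r : ℕ+, Label π r :=
  Quotient.lift (pointLabel hw) (pointLabel_apply hw)

/-- The labels of all cycles of letters. -/
def cycleLabels (hw : ∀ a, w (σ a) = π (w a)) : Multiset (Σ r : ℕ+, Label π r) :=
  letI := Fintype.ofFinite (Quotient (SameCycle.setoid σ))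
  (Finset.univ.val : Multiset (Quotient (SameCycle.setoid σ))).map (orbitLabel hw)

lemma orbitLabel_out (hw : ∀ a, w (σ a) = π (w a)) (o : Quotient (SameCycle.setoid σ)) :
    orbitLabel hw o = pointLabel hw o.out := by
  conv_lhs => rw [← Quotient.out_eq o]
  rfl

/-- Along a `σ`-cycle of length `r` the word runs through `i, π i, …, π^{r-1} i`, which is the
product attached to the label of the cycle. -/
lemma prod_cycleLabels [Fintype A] [Finite I] (hw : ∀ a, w (σ a) = π (w a)) {M : Type*}
    [CommMonoid M] (f : I → M) :
    ((cycleLabels hw).map fun t => t.2.prod f).prod = ∏ a, f (w a) := by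
  let := Fintype.ofFinite (Quotient (SameCycle.setoid σ))
  rw [prod_eq_prod_orbits σ, cycleLabels, Multiset.map_map]
  refine Finset.prod_congr rfl fun o _ => ?_
  rw [Function.comp_apply, orbitLabel_out]
  refine (Label.prod_mk f _ _).trans (Finset.prod_congr rfl fun j _ => congrArg f ?_)
  have := apply_zpow hw j o.out
  rw [zpow_natCast, zpow_natCast] at this
  exact this.symm

lemma sum_cycleLabels (hw : ∀ a, w (σ a) = π (w a)) :
    ((cycleLabels hw).map fun t => (t.1 : ℕ)).sum = Nat.card A := by
  let := Fintype.ofFinite (Quotient (SameCycle.setoid σ))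
  let := Fintype.ofFinite A
  have := prod_eq_prod_orbits σ fun _ => Multiplicative.ofAdd 1
  have h2 := congrArg Multiplicative.toAdd this
  simp only [toAdd_prod, toAdd_ofAdd, Finset.sum_const, smul_eq_mul, mul_one, Finset.card_range,
    Finset.card_univ] at h2
  rw [Nat.card_eq_fintype_card, h2, cycleLabels, Multiset.map_map]
  refine Finset.sum_congr rfl fun o _ => ?_
  rw [Function.comp_apply, orbitLabel_out]
  rfl

open scoped Classical in
-- A cycle with label `t` has `t.1` letters, all with `pointLabel` equal to `t`. Counting letters
-- thus avoids handling the quotient by `σ`.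
lemma count_cycleLabels (hw : ∀ a, w (σ a) = π (w a)) (t : Σ r : ℕ+, Label π r) :
    (cycleLabels hw).count t * t.1 = Nat.card {a // pointLabel hw a = t} := by
  let := Fintype.ofFinite (Quotient (SameCycle.setoid σ))
  let := Fintype.ofFinite A
  have := prod_eq_prod_orbits σ fun a =>
    Multiplicative.ofAdd (if pointLabel hw a = t then 1 else 0)
  have h2 := congrArg Multiplicative.toAdd this
  simp only [toAdd_prod, toAdd_ofAdd] at h2
  rw [Nat.card_eq_fintype_card, Fintype.card_subtype, Finset.card_filter, h2, cycleLabels,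
    Multiset.count_map, ← Finset.filter_val, Finset.card_val, Finset.card_filter, Finset.sum_mul]
  refine Finset.sum_congr rfl fun o _ => ?_
  have h3 : ∀ j ∈ Finset.range (MulAction.period σ o.out),
      (if pointLabel hw ((σ ^ j) o.out) = t then 1 else 0) = if t = orbitLabel hw o then 1 else 0 :=
    fun j _ => by
      rw [orbitLabel_out, pointLabel_apply hw o.out ((σ ^ j) o.out) ⟨j, by simp⟩]
      exact if_congr eq_comm rfl rfl
  rw [Finset.sum_congr rfl h3, Finset.sum_const, Finset.card_range, smul_eq_mul, mul_comm]
  split_ifs with h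
  · subst h
    rw [orbitLabel_out]
    rfl
  · simp

/-- Lengths are positive, so the numbers of letters recover the multiplicities of the labels. -/
lemma cycleLabels_unique (hw : ∀ a, w (σ a) = π (w a)) (M : Multiset (Σ r : ℕ+, Label π r))
    (h : open scoped Classical in
      ∀ t, M.count t * t.1 = Nat.card {a // pointLabel hw a = t}) : cycleLabels hw = M := by
  classical
  refine Multiset.ext.mpr fun t => ?_
  have := (count_cycleLabels hw t).trans (h t).symm
  exact Nat.eq_of_mul_eq_mul_right t.1.pos (by convert this)

lemma cycleLabels_conj {B : Type*} [Finite B] (α : A ≃ B) {w' : B → I} {σ' : Equiv.Perm B}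
    (hw : ∀ a, w (σ a) = π (w a)) (hw' : ∀ a, w' (σ' a) = π (w' a))
    (h1 : ∀ a, w' (α a) = w a) (h2 : ∀ a, α (σ a) = σ' (α a)) :
    cycleLabels hw' = cycleLabels hw := by
  classical
  refine cycleLabels_unique hw' _ fun t => ?_
  refine Eq.trans (by convert count_cycleLabels hw t) (Nat.card_congr (α.subtypeEquiv fun a => ?_))
  suffices pointLabel hw a = pointLabel hw' (α a) by rw [this]
  refine sigma_mk_eq.mpr ⟨?_, by rw [h1]⟩
  have hn : ∀ (n : ℕ) (a : A), α ((σ ^ n) a) = (σ' ^ n) (α a) := fun n a => by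
    induction n with
    | zero => rfl
    | succ n ih => rw [pow_succ', Equiv.Perm.mul_apply, h2, ih, pow_succ', Equiv.Perm.mul_apply]
  have key : ∀ n : ℕ, (σ ^ n) • a = a ↔ (σ' ^ n) • (α a) = α a := fun n => by
    rw [Equiv.Perm.smul_def, Equiv.Perm.smul_def, ← hn, EmbeddingLike.apply_eq_iff_eq]
  simp only [MulAction.pow_smul_eq_iff_period_dvd] at key
  exact Nat.dvd_antisymm ((key _).mpr dvd_rfl) ((key _).mp dvd_rfl)

/-- Match the cycles of `σ` and `σ'` with equal labels, choose base points with the same image in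
`I`, and extend equivariantly along the cycles. -/
lemma exists_conj_of_cycleLabels_eq {w' : A → I} {σ' : Equiv.Perm A}
    (hw : ∀ a, w (σ a) = π (w a)) (hw' : ∀ a, w' (σ' a) = π (w' a))
    (h : cycleLabels hw = cycleLabels hw') :
    ∃ α : Equiv.Perm A, w' = w ∘ ⇑α⁻¹ ∧ σ' = α * σ * α⁻¹ := by
  let := Fintype.ofFinite (Quotient (SameCycle.setoid σ))
  let := Fintype.ofFinite (Quotient (SameCycle.setoid σ'))
  obtain ⟨E, hE⟩ := exists_equiv_of_map_univ_eq h
  -- Equal labels give images that agree only up to a power `π^z`. Moving the representative of the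
  -- matched cycle by `σ'^z` makes them equal.
  have base : ∀ o, ∃ b, Quotient.mk (SameCycle.setoid σ') b = E o ∧
      MulAction.period σ' b = MulAction.period σ o.out ∧ w' b = w o.out := fun o => by
    have h1 := hE o
    rw [orbitLabel_out, orbitLabel_out] at h1
    obtain ⟨-, z, hz⟩ := sigma_mk_eq.mp h1
    have h3 : SameCycle σ' (E o).out ((σ' ^ z) (E o).out) := ⟨z, rfl⟩
    refine ⟨(σ' ^ z) (E o).out, ?_, ?_, ?_⟩
    · exact (Quotient.sound h3.symm).trans (Quotient.out_eq _)
    · rw [pointLabel_apply hw' _ _ h3] at h1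
      exact (sigma_mk_eq.mp h1).1
    · rw [apply_zpow hw', hz]
  choose b hb1 hb2 hb3 using base
  have rep : ∀ a, ∃ z : ℤ, (σ ^ z) (Quotient.mk (SameCycle.setoid σ) a).out = a := fun a =>
    Quotient.mk_out (s := SameCycle.setoid σ) a
  choose z hz using rep
  let f : A → A := fun a => (σ' ^ z a) (b (Quotient.mk _ a))
  -- Whether two powers agree at a point depends only on the period there, which is the same for
  -- both base points. Hence `f` does not depend on the chosen exponents.
  have zp : ∀ (o) (i j : ℤ), (σ ^ i) o.out = (σ ^ j) o.out ↔ (σ' ^ i) (b o) = (σ' ^ j) (b o) := by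
    intro o i j
    have e : ∀ {x : A} (τ : Equiv.Perm A), (τ ^ i) x = (τ ^ j) x ↔
        (MulAction.period τ x : ℤ) ∣ i - j := fun {x} τ => by
      rw [← MulAction.zpow_smul_eq_iff_period_dvd, Equiv.Perm.smul_def, sub_eq_neg_add, zpow_add,
        zpow_neg, Equiv.Perm.mul_apply, Equiv.Perm.inv_eq_iff_eq, eq_comm, eq_comm]
    rw [e, e, hb2]
  have mk_zpow : ∀ (o) (i : ℤ), Quotient.mk (SameCycle.setoid σ) ((σ ^ i) o.out) = o :=
    fun o i =>
    (Quotient.sound (show SameCycle σ _ _ from ⟨-i, by simp⟩)).trans (Quotient.out_eq o)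
  have hf : ∀ (o) (i : ℤ), f ((σ ^ i) o.out) = (σ' ^ i) (b o) := by
    intro o i
    have h1 := hz ((σ ^ i) o.out)
    change (σ' ^ z _) (b (Quotient.mk _ ((σ ^ i) o.out))) = _
    rw [mk_zpow] at h1 ⊢
    exact (zp o _ _).mp h1
  have f_inj : Function.Injective f := by
    intro a a' h
    have h1 : Quotient.mk (SameCycle.setoid σ) a = Quotient.mk _ a' := by
      apply E.injective
      rw [← hb1, ← hb1]
      refine Quotient.sound ⟨-z a' + z a, ?_⟩
      rw [zpow_add, Equiv.Perm.mul_apply]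
      change (σ' ^ (-z a')) (f a) = _
      rw [h]
      simp [f]
    rw [← hz a, ← hz a', h1]
    refine (zp _ _ _).mpr ?_
    rw [← h1]
    refine Eq.trans h ?_
    rw [h1]
  let α : Equiv.Perm A := Equiv.ofBijective f (Finite.injective_iff_bijective.mp f_inj)
  have hα : ∀ a, α a = f a := fun a => rfl
  have h1 : ∀ a, w' (α a) = w a := fun a => by
    conv_rhs => rw [← hz a, apply_zpow hw, ← hb3]
    exact apply_zpow hw' _ _
  have h2 : ∀ a, α (σ a) = σ' (α a) := fun a => by
    have h3 : σ a = (σ ^ (1 + z a)) (Quotient.mk (SameCycle.setoid σ) a).out := by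
      rw [zpow_one_add, Equiv.Perm.mul_apply, hz]
    rw [h3, hα, hf, zpow_one_add]
    rfl
  refine ⟨α, funext fun a => ?_, Equiv.ext fun a => ?_⟩
  · rw [Function.comp_apply, ← h1]
    simp
  · rw [Equiv.Perm.mul_apply, Equiv.Perm.mul_apply, h2]
    simp

/-- A label of length `r` represented by `i` is realized on `ZMod r` with the shift by `1` and the
letters `π^x i`. The required word is the disjoint union of these cycles, transported to `Fin` of
the total length. -/
lemma exists_cycleLabels_eq (M : Multiset (Σ r : ℕ+, Label π r)) :
    ∃ (w : Fin (M.map fun t => (t.1 : ℕ)).sum → I) (σ : Equiv.Perm _)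
      (hw : ∀ a, w (σ a) = π (w a)), cycleLabels hw = M := by
  classical
  obtain ⟨N, κ, rfl⟩ : ∃ (N : ℕ) (κ : Fin N → Σ r : ℕ+, Label π r),
      (Finset.univ.val : Multiset (Fin N)).map κ = M := by
    obtain ⟨l, rfl⟩ := Quot.exists_rep M
    exact ⟨l.length, l.get, (Fin.univ_val_map l.get).trans (congrArg _ (List.ofFn_get l))⟩
  have rep : ∀ t : Σ r : ℕ+, Label π r, ∃ i, ∃ h : (π ^ (t.1 : ℕ)) i = i, ⟨t.1, Label.mk i h⟩ = t :=
    fun t => by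
      obtain ⟨i, h, e⟩ := t.2.exists_rep
      exact ⟨i, h, by rw [e]⟩
  choose i hi ei using rep
  let B := Σ j : Fin N, ZMod (κ j).1
  have hne : ∀ r : ℕ+, NeZero (r : ℕ) := fun r => ⟨r.pos.ne'⟩
  let _ : Fintype B := inferInstanceAs (Fintype (Σ j : Fin N, ZMod (κ j).1))
  let τ : Equiv.Perm B := Equiv.sigmaCongrRight fun j => Equiv.addRight 1
  let v : B → I := fun x => (π ^ x.2.val) (i (κ x.1))
  have hv : ∀ x, v (τ x) = π (v x) := by
    rintro ⟨j, x⟩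
    change (π ^ (x + 1).val) (i (κ j)) = π ((π ^ x.val) (i (κ j)))
    rw [← Equiv.Perm.mul_apply, ← pow_succ']
    -- The representative of `x + 1` may wrap around to `0`. Only residues of exponents matter,
    -- since `π` to the length of the cycle fixes the chosen point.
    have h1 : (x + 1).val % (κ j).1 = (x.val + 1) % (κ j).1 := by
      rw [← ZMod.natCast_eq_natCast_iff']
      simp
    have h2 : ∀ a b : ℕ, a % (κ j).1 = b % (κ j).1 → (π ^ a) (i (κ j)) = (π ^ b) (i (κ j)) := by
      have h3 : ∀ a : ℕ, (π ^ a) (i (κ j)) = (π ^ (a % (κ j).1)) (i (κ j)) := fun a => by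
        conv_lhs => rw [← Nat.mod_add_div a (κ j).1, pow_add, pow_mul, Equiv.Perm.mul_apply]
        refine congrArg _ ?_
        exact Function.IsFixedPt.perm_pow (e := π ^ ((κ j).1 : ℕ)) (hi (κ j)) _
      intro a b hab
      rw [h3 a, h3 b, hab]
    exact h2 _ _ h1
  have hτ : ∀ (n : ℕ) (x : B), (τ ^ n) x = ⟨x.1, x.2 + n⟩ := fun n x => by
    induction n with
    | zero => simp
    | succ n ih =>
      rw [pow_succ', Equiv.Perm.mul_apply, ih]
      change (⟨x.1, x.2 + n + 1⟩ : B) = _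
      rw [add_assoc, Nat.cast_succ]
  have hp : ∀ x : B, MulAction.period τ x = (κ x.1).1 := fun x => by
    have key : ∀ n : ℕ, MulAction.period τ x ∣ n ↔ ((κ x.1).1 : ℕ) ∣ n := fun n => by
      rw [← MulAction.pow_smul_eq_iff_period_dvd, Equiv.Perm.smul_def, hτ,
        ← ZMod.natCast_eq_zero_iff]
      constructor
      · intro h
        have := eq_of_heq (Sigma.mk.inj_iff.mp h).2
        simpa using this
      · intro h
        rw [h, add_zero]
    exact Nat.dvd_antisymm ((key _).mpr dvd_rfl) ((key _).mp dvd_rfl)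
  have hl : ∀ x : B, pointLabel hv x = κ x.1 := fun x => by
    rw [← ei (κ x.1)]
    exact sigma_mk_eq.mpr ⟨hp x, SameCycle.symm ⟨(x.2.val : ℕ), by rw [zpow_natCast]⟩⟩
  have hM : cycleLabels hv = (Finset.univ.val : Multiset (Fin N)).map κ := by
    refine cycleLabels_unique hv _ fun t => ?_
    simp only [hl]
    rw [Nat.card_eq_fintype_card, Fintype.card_subtype, Finset.card_filter, Fintype.sum_sigma,
      Multiset.count_map, ← Finset.filter_val, Finset.card_val, Finset.card_filter, Finset.sum_mul]
    refine Finset.sum_congr rfl fun j _ => ?_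
    have h1 : ∑ _y : ZMod (κ j).1, (if κ j = t then 1 else 0) =
        ((κ j).1 : ℕ) * if κ j = t then 1 else 0 := by
      rw [Finset.sum_const, Finset.card_univ, ZMod.card, smul_eq_mul]
    refine Eq.trans ?_ h1.symm
    by_cases h : t = κ j
    · subst h
      simp
    · simp [h, Ne.symm h]
  have hcard := sum_cycleLabels hv
  rw [hM] at hcard
  let e : B ≃ Fin (((Finset.univ.val : Multiset (Fin N)).map κ).map fun t => (t.1 : ℕ)).sum :=
    (Finite.equivFin B).trans (finCongr hcard.symm)
  refine ⟨v ∘ e.symm, e.permCongr τ, fun a => ?_, ?_⟩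
  · simpa [Equiv.permCongr_apply] using hv (e.symm a)
  · exact (cycleLabels_conj e hv _ (fun a => by simp) fun a => by simp [Equiv.permCongr_apply]).trans
      hM

end OrbitLabels

/-! ### Monomial bases from coordinates. -/

section MonomialBases

/-- A representation with a basis `b` such that `s (b q) = C s q • b (σ s q)`. -/
def HasMonomialBasis {k H M Q : Type*} [Field k] [Group H] [AddCommMonoid M] [Module k M]
    (R : Representation k H M) (σ : H → Q → Q) (C : H → Q → k) : Prop :=
  ∃ b : Module.Basis Q k M, ∀ s q, R s (b q) = C s q • b (σ s q)

lemma HasMonomialBasis.of_coords {k H M P Q : Type*} [Field k] [Group H] [AddCommGroup M]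
    [Module k M] [Finite Q] {R : Representation k H M} {φ : M →ₗ[k] P → k} {ν : P → Q}
    (hφ : Function.Injective φ) (hν : Function.Surjective ν) (h₁ : ∀ f : Q → k, ∃ x, φ x = f ∘ ν)
    (h₂ : ∀ x p p', ν p = ν p' → φ x p = φ x p') {σP : H → P → P} {σ : H → Q → Q}
    {C : H → Q → k} (hP : ∀ s, Function.Surjective (σP s)) (hQ : ∀ s, Function.Injective (σ s))
    (hσ : ∀ s p, ν (σP s p) = σ s (ν p))
    (hR : ∀ s x p, φ (R s x) (σP s p) = C s (ν p) * φ x p) : HasMonomialBasis R σ C := by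
  obtain ⟨b, hb⟩ := exists_basis_of_coords φ ν hν hφ h₁ h₂
  exact ⟨b, fun s => apply_basis_of_coords hφ hb (R s) (σP s) (σ s) (C s) (hP s) (hQ s) (hσ s)
    (hR s)⟩

end MonomialBases

/-! ### Multisets of cycles of total length `n`. -/

section CycleMultisets

variable {I : Type*} {π : Equiv.Perm I}

/-- The map of cycles of all lengths induced by a permutation that commutes with `π`. -/
def sigmaMap (s : Equiv.Perm I) (hs : Commute s π) :
    (Σ r : ℕ+, Label π r) → Σ r : ℕ+, Label π r :=
  fun t => ⟨t.1, t.2.map s hs⟩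

lemma sigmaMap_injective (s : Equiv.Perm I) (hs : Commute s π) :
    Function.Injective (sigmaMap s hs) := by
  rintro ⟨r, t⟩ ⟨r', t'⟩ h
  obtain ⟨(rfl : r = r'), h⟩ := Sigma.mk.inj_iff.mp h
  exact congrArg (Sigma.mk r) (Label.map_injective s hs (eq_of_heq h))

variable (π) in
/-- The multisets of cycles of total length `n`. -/
def CycleMultiset (n : ℕ) : Type _ :=
  {M : Multiset (Σ r : ℕ+, Label π r) // (M.map fun t => (t.1 : ℕ)).sum = n}

/-- The map of multisets of cycles induced by a permutation that commutes with `π`. -/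
def CycleMultiset.map {n : ℕ} (s : Equiv.Perm I) (hs : Commute s π) (M : CycleMultiset π n) :
    CycleMultiset π n :=
  ⟨M.1.map (sigmaMap s hs), by
    rw [Multiset.map_map]
    exact M.2⟩

lemma CycleMultiset.map_injective {n : ℕ} (s : Equiv.Perm I) (hs : Commute s π) :
    Function.Injective (CycleMultiset.map (n := n) s hs) := fun _ _ h =>
  Subtype.ext (Multiset.map_injective (sigmaMap_injective s hs) (congrArg Subtype.val h))

/-- The multiset of cycles of a word. -/
def EqWord.cycles {n : ℕ} (p : EqWord π n) : CycleMultiset π n :=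
  ⟨cycleLabels p.2, by rw [sum_cycleLabels, Nat.card_fin]⟩

lemma EqWord.cycles_surjective (n : ℕ) :
    Function.Surjective (EqWord.cycles : EqWord π n → CycleMultiset π n) := by
  rintro ⟨M, rfl⟩
  obtain ⟨w, σ, hw, h⟩ := exists_cycleLabels_eq M
  exact ⟨⟨(w, σ), hw⟩, Subtype.ext h⟩

instance [Finite I] (n : ℕ) : Finite (CycleMultiset π n) :=
  have : Finite (EqWord π n) := Subtype.finite
  Finite.of_surjective _ (EqWord.cycles_surjective n)

/-- The map of words induced by a permutation that commutes with `π`. -/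
def EqWord.map {n : ℕ} (s : Equiv.Perm I) (hs : Commute s π) (p : EqWord π n) : EqWord π n :=
  ⟨(s ∘ p.1.1, p.1.2), fun a =>
    (congrArg s (p.2 a)).trans (congrArg (· (p.1.1 a)) hs.eq)⟩

lemma EqWord.map_surjective {n : ℕ} (s : Equiv.Perm I) (hs : Commute s π) :
    Function.Surjective (EqWord.map (n := n) s hs) := by
  rintro ⟨⟨w, σ⟩, hw⟩
  refine ⟨EqWord.map s⁻¹ hs.inv_left ⟨(w, σ), hw⟩, Subtype.ext (Prod.ext (funext fun a => ?_) rfl)⟩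
  exact s.apply_symm_apply (w a)

/-- The permutation of the letters is unchanged, so the cycles stay the same and only their images
in `I` move. -/
lemma EqWord.cycles_map {n : ℕ} (s : Equiv.Perm I) (hs : Commute s π) (p : EqWord π n) :
    (p.map s hs).cycles = p.cycles.map s hs := by
  refine Subtype.ext ?_
  change cycleLabels _ = (cycleLabels p.2).map (sigmaMap s hs)
  rw [cycleLabels, cycleLabels, Multiset.map_map]
  refine Multiset.map_congr rfl fun o _ => ?_
  induction o using Quotient.inductionOn
  rfl

end CycleMultisets

/-! ### The monomial basis of the character of `Sym^n(ρ)`. -/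

section SymBasis

variable {k : Type u} [Field k] {m : ℕ} {G : Type*} [Group G] (ρ : TwoRep k G (VectPow k m))
  (g : G) (n : ℕ)

/-- The coordinates of a natural transformation on `Sym^n(V)`, as a linear map. -/
def symCoords : (symPow ρ n).Char g →ₗ[k] EqWord (idxPerm ρ g) n → k where
  toFun ζ p := symCoord ρ g ζ p.1.1 p.1.2
  map_add' ζ ζ' := funext fun p => (congrArg (wordCoef ρ g p.1.1 _) (indComp_add ζ ζ' _ _)).trans
    (map_add _ _ _)
  map_smul' c ζ := funext fun p => (congrArg (wordCoef ρ g p.1.1 _) (indComp_smul c ζ _ _)).trans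
    (map_smul _ _ _)

lemma symCoords_injective : Function.Injective (symCoords ρ g n) := fun _ _ h =>
  symCoord_ext ρ g fun w σ hw => congrFun h ⟨(w, σ), hw⟩

lemma exists_symCoords_eq (f : CycleMultiset (idxPerm ρ g) n → k) :
    ∃ ζ, symCoords ρ g n ζ = f ∘ EqWord.cycles := by
  classical
  obtain ⟨ζ, hζ⟩ := exists_symCoord_eq ρ g (n := n)
    (fun w σ => if hw : ∀ a, w (σ a) = idxPerm ρ g (w a) then
      f (EqWord.cycles ⟨(w, σ), hw⟩) else 0) fun w σ α hw => by
    have hw' : ∀ a, (w ∘ ⇑α⁻¹) ((α * σ * α⁻¹) a) = idxPerm ρ g ((w ∘ ⇑α⁻¹) a) := fun a => by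
      rw [Function.comp_apply, Function.comp_apply, ← hw]
      simp
    rw [dif_pos hw, dif_pos hw']
    refine congrArg f (Subtype.ext ?_)
    exact cycleLabels_conj α hw hw' (fun a => by simp) fun a => by simp
  exact ⟨ζ, funext fun p => (hζ _ _ p.2).trans (dif_pos p.2)⟩

lemma symCoords_eq_of_cycles_eq (ζ : (symPow ρ n).Char g) (p p' : EqWord (idxPerm ρ g) n)
    (h : p.cycles = p'.cycles) : symCoords ρ g n ζ p = symCoords ρ g n ζ p' := by
  obtain ⟨α, h1, h2⟩ := exists_conj_of_cycleLabels_eq p.2 p'.2 (congrArg Subtype.val h)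
  have := symCoord_conj_perm ρ g ζ p.1.1 p.1.2 α p.2
  rw [← h1, ← h2] at this
  exact this.symm

lemma symCoords_charRep (s : Subgroup.centralizer ({g} : Set G)) (ζ : (symPow ρ n).Char g)
    (p : EqWord (idxPerm ρ g) n) :
    symCoords ρ g n ((symPow ρ n).charRep g s ζ)
        (p.map (idxPerm ρ s) (commute_idxPerm ρ s)) =
      (p.cycles.1.map fun t => t.2.prod (twist ρ g s)).prod * symCoords ρ g n ζ p := by
  refine (symCoord_conj ρ g s (conj_eq_of_mem s) ζ p.1.1 p.1.2 p.2).trans ?_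
  exact congrArg (· * symCoords ρ g n ζ p) (prod_cycleLabels p.2 (twist ρ g s)).symm

/-- The character of `Sym^n(ρ)` has a basis indexed by multisets of cycles, on which the
centralizer acts monomially. -/
lemma hasMonomialBasis_symPow :
    HasMonomialBasis ((symPow ρ n).charRep g)
      (fun s => CycleMultiset.map (n := n) (idxPerm ρ s) (commute_idxPerm ρ s))
      fun s M => (M.1.map fun t => t.2.prod (twist ρ g s)).prod :=
  .of_coords (symCoords_injective ρ g n)
    (EqWord.cycles_surjective n) (exists_symCoords_eq ρ g n) (symCoords_eq_of_cycles_eq ρ g n)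
    (σP := fun (s : Subgroup.centralizer ({g} : Set G)) => EqWord.map (idxPerm ρ s) (commute_idxPerm ρ s))
    (fun _ => EqWord.map_surjective _ _) (fun _ => CycleMultiset.map_injective _ _)
    (fun _ => EqWord.cycles_map _ _) (symCoords_charRep ρ g n)

end SymBasis

/-! ### Symmetric powers, sums and tensor products of monomial bases. -/

section MonomialConstructions

open scoped TensorProduct DirectSum

variable {k : Type u} [Field k] {H : Type v} [Group H]

/-- A representation with a monomial basis, as an object of the category of representations. -/
def IsMonomial {Q : Type*} (W : Rep.{w} k H) (σ : H → Q → Q) (C : H → Q → k) : Prop :=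
  HasMonomialBasis W.ρ σ C

lemma IsMonomial.reindex {W : Rep.{w} k H} {Q Q' : Type*} {σ : H → Q → Q} {C : H → Q → k}
    (h : IsMonomial W σ C)
    (e : Q → Q') (he : Function.Bijective e) {σ' : H → Q' → Q'} {C' : H → Q' → k}
    (hσ : ∀ s q, e (σ s q) = σ' s (e q)) (hC : ∀ s q, C s q = C' s (e q)) :
    IsMonomial W σ' C' := by
  obtain ⟨b, hb⟩ := h
  refine ⟨b.reindex (Equiv.ofBijective e he), fun s q => ?_⟩
  obtain ⟨q, rfl⟩ := he.2 q
  have h1 : ∀ q, b.reindex (Equiv.ofBijective e he) (e q) = b q := fun q =>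
    (b.reindex_apply _ _).trans (congrArg b ((Equiv.ofBijective e he).symm_apply_apply q))
  rw [h1, hb, hC, ← h1, hσ]

/-- Representations with monomial bases of the same shape are isomorphic. -/
lemma IsMonomial.nonempty_iso {W W' : Rep.{w} k H} {Q : Type*} {σ : H → Q → Q}
    {C : H → Q → k} (h : IsMonomial W σ C) (h' : IsMonomial W' σ C) :
    Nonempty (W ≅ W') := by
  obtain ⟨b, hb⟩ := h
  obtain ⟨b', hb'⟩ := h'
  refine ⟨Rep.mkIso (Representation.Equiv.mk (b.equiv b' (Equiv.refl Q)) fun s => ?_)⟩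
  refine b.ext fun q => ?_
  simp [hb, hb']

/-- A basis of a quotient that identifies basis vectors. -/
lemma exists_basis_quotient {V P Q : Type*} [AddCommGroup V] [Module k V]
    (b : Module.Basis P k V) (N : Submodule k V) (ν : P → Q) (hν : Function.Surjective ν)
    (h₁ : ∀ x ∈ N, b.constr k (fun p => Finsupp.single (ν p) (1 : k)) x = 0)
    (h₂ : ∀ p p', ν p = ν p' → b p - b p' ∈ N) :
    ∃ c : Module.Basis Q k (V ⧸ N), ∀ p, c (ν p) = N.mkQ (b p) := by
  let f : (V ⧸ N) →ₗ[k] Q →₀ k := N.liftQ (b.constr k fun p => Finsupp.single (ν p) (1 : k)) h₁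
  let f' : (Q →₀ k) →ₗ[k] V ⧸ N :=
    Finsupp.linearCombination k fun q => N.mkQ (b (Function.surjInv hν q))
  have e : ∀ p, N.mkQ (b (Function.surjInv hν (ν p))) = N.mkQ (b p) := fun p => by
    refine (Submodule.Quotient.eq N).mpr (h₂ _ _ ?_)
    exact Function.surjInv_eq hν (ν p)
  have hf : ∀ p, f (N.mkQ (b p)) = Finsupp.single (ν p) 1 := fun p =>
    (N.liftQ_apply _ _).trans (b.constr_basis k _ p)
  have h3 : f' ∘ₗ f = LinearMap.id := by
    refine Submodule.linearMap_qext _ (b.ext fun p => ?_)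
    change f' (f (N.mkQ (b p))) = N.mkQ (b p)
    rw [hf]
    simpa [f'] using e p
  have h4 : f ∘ₗ f' = LinearMap.id := by
    refine Finsupp.lhom_ext' fun q => LinearMap.ext_ring ?_
    change f (f' (Finsupp.single q 1)) = Finsupp.single q 1
    have : f' (Finsupp.single q 1) = N.mkQ (b (Function.surjInv hν q)) := by simp [f']
    rw [this, hf, Function.surjInv_eq hν]
  refine ⟨Module.Basis.ofRepr (LinearEquiv.ofLinearMap f f' h4 h3), fun p => ?_⟩
  change f' (Finsupp.single (ν p) 1) = _
  rw [← hf]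
  exact LinearMap.congr_fun h3 _

/-- The unordered word of a word. -/
def toSym {Q : Type*} {m : ℕ} (q : Fin m → Q) : Sym Q m :=
  ⟨(Finset.univ.val : Multiset (Fin m)).map q, by simp⟩

lemma toSym_surjective {Q : Type*} {m : ℕ} : Function.Surjective (toSym : (Fin m → Q) → Sym Q m) := by
  rintro ⟨M, hM⟩
  obtain ⟨l, rfl⟩ := Quot.exists_rep M
  obtain rfl : l.length = m := hM
  exact ⟨l.get, Subtype.ext ((Fin.univ_val_map l.get).trans (congrArg _ (List.ofFn_get l)))⟩

lemma toSym_comp {Q : Type*} {m : ℕ} (q : Fin m → Q) (σ : Equiv.Perm (Fin m)) :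
    toSym (q ∘ σ) = toSym q := by
  refine Subtype.ext ?_
  change (Finset.univ.val : Multiset (Fin m)).map (q ∘ σ) = _
  rw [← Multiset.map_map, Multiset.map_univ_val_equiv]
  rfl

/-- Permuting tensor positions permutes the words in the basis vectors, and two words are related
exactly when their multisets of letters agree. As `sym^m` is a quotient, unordered words index a
basis without any division by `m!`. -/
lemma IsMonomial.symRep {W : Rep.{w} k H} {Q : Type*} {σ : H → Q → Q}
    {C : H → Q → k} (h : IsMonomial W σ C) (m : ℕ) :
    IsMonomial (TwoRep.symRep W m) (fun s (q : Sym Q m) => q.map (σ s))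
      fun s q => (q.1.map (C s)).prod := by
  obtain ⟨b, hb⟩ := h
  let B := Basis.piTensorProduct fun _ : Fin m => b
  have hB : ∀ q : Fin m → Q, B q = ⨂ₜ[k] a, b (q a) := fun q => Basis.piTensorProduct_apply _ q
  have hre : ∀ (τ : Equiv.Perm (Fin m)) (q : Fin m → Q),
      PiTensorProduct.reindex k (fun _ => (W : Type w)) τ (B q) = B (q ∘ τ.symm) := fun τ q => by
    rw [hB, hB]
    exact PiTensorProduct.reindex_tprod τ _
  obtain ⟨c, hc⟩ := exists_basis_quotient B (symRel k W m) toSym toSym_surjective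
    (fun x hx => by
      rw [← LinearMap.mem_ker]
      refine (Submodule.span_le.mpr ?_ : symRel k W m ≤ _) hx
      rintro _ ⟨⟨τ, x⟩, rfl⟩
      rw [SetLike.mem_coe, LinearMap.mem_ker, map_sub, sub_eq_zero]
      refine LinearMap.congr_fun (f := (B.constr k fun p => Finsupp.single (toSym p) (1 : k)) ∘ₗ
        (PiTensorProduct.reindex k (fun _ => (W : Type w)) τ).toLinearMap) (B.ext fun q => ?_) x
      rw [LinearMap.comp_apply, LinearEquiv.coe_coe, hre, B.constr_basis, B.constr_basis,
        toSym_comp])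
    (fun q q' hq => by
      obtain ⟨τ, hτ⟩ := exists_equiv_of_map_univ_eq (f := q) (h := q') (congrArg Subtype.val hq)
      refine Submodule.subset_span ⟨(τ.symm, B q'), ?_⟩
      change PiTensorProduct.reindex k (fun _ => (W : Type w)) τ.symm (B q') - B q' = _
      rw [hre, Equiv.symm_symm, show q' ∘ τ = q from funext hτ])
  have key : ∀ (s : H) (q : Sym Q m), (symRel k W m).mapQ _ (PiTensorProduct.map fun _ => W.ρ s)
      (symRel_le_comap m (W.ρ s)) (c q) = (q.1.map (C s)).prod • c (q.map (σ s)) := by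
    intro s q
    obtain ⟨q, rfl⟩ := toSym_surjective q
    have h1 : (toSym q).map (σ s) = toSym (σ s ∘ q) :=
      Subtype.ext (Multiset.map_map (σ s) q Finset.univ.val)
    have h2 : PiTensorProduct.map (fun _ : Fin m => W.ρ s) (B q) =
        (∏ a, C s (q a)) • B (σ s ∘ q) := by
      rw [hB, hB, PiTensorProduct.map_tprod]
      simp only [hb]
      exact MultilinearMap.map_smul_univ _ _ _
    rw [h1, hc, hc]
    refine (congrArg (symRel k W m).mkQ h2).trans ((map_smul _ _ _).trans ?_)
    refine congrArg (· • _) ?_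
    exact congrArg Multiset.prod (Multiset.map_map (C s) q Finset.univ.val).symm
  exact ⟨c, key⟩

lemma IsMonomial.sumRep {ι : Type} {W : ι → Rep.{w} k H} {Q : ι → Type*}
    {σ : ∀ i, H → Q i → Q i} {C : ∀ i, H → Q i → k}
    (h : ∀ i, IsMonomial (W i) (σ i) (C i)) :
    IsMonomial (TwoRep.sumRep W) (fun s (q : Σ i, Q i) => ⟨q.1, σ q.1 s q.2⟩)
      fun s q => C q.1 s q.2 := by
  classical
  choose b hb using h
  let B : Module.Basis (Σ i, Q i) k (⨁ i, W i) := DFinsupp.basis b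
  have hB : ∀ i q, B ⟨i, q⟩ = DirectSum.lof k ι (fun i => W i) i (b i q) := fun i q => by
    apply B.repr.injective
    rw [B.repr_self]
    refine Finsupp.ext fun x => ?_
    obtain ⟨j, r⟩ := x
    change _ = (b j).repr (DirectSum.lof k ι (fun i => W i) i (b i q) j) r
    by_cases hij : i = j
    · subst hij
      rw [DirectSum.lof_apply, Module.Basis.repr_self, Finsupp.single_apply, Finsupp.single_apply]
      simp
    · have h0 : DirectSum.lof k ι (fun i => W i) i (b i q) j = 0 :=
        DirectSum.of_eq_of_ne _ _ _ (Ne.symm hij)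
      rw [h0, map_zero, Finsupp.single_apply, if_neg fun h => hij (congrArg Sigma.fst h)]
      rfl
  have key : ∀ (s : H) (q : Σ i, Q i), DirectSum.lmap (fun i => (W i).ρ s) (B q) =
      C q.1 s q.2 • B ⟨q.1, σ q.1 s q.2⟩ := by
    rintro s ⟨i, q⟩
    rw [hB, hB, DirectSum.lmap_lof, hb, map_smul]
  exact ⟨B, key⟩

lemma IsMonomial.tensorRep {ι : Type} [Fintype ι] {W : ι → Rep.{w} k H} {Q : ι → Type*}
    {σ : ∀ i, H → Q i → Q i} {C : ∀ i, H → Q i → k}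
    (h : ∀ i, IsMonomial (W i) (σ i) (C i)) :
    IsMonomial (TwoRep.tensorRep W) (fun s (q : ∀ i, Q i) i => σ i s (q i))
      fun s q => ∏ i, C i s (q i) := by
  choose b hb using h
  have key : ∀ (s : H) (q : ∀ i, Q i), PiTensorProduct.map (fun i => (W i).ρ s)
      (Basis.piTensorProduct b q) =
        (∏ i, C i s (q i)) • Basis.piTensorProduct b fun i => σ i s (q i) := by
    intro s q
    rw [Basis.piTensorProduct_apply, Basis.piTensorProduct_apply, PiTensorProduct.map_tprod]
    simp only [hb]
    exact MultilinearMap.map_smul_univ _ _ _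
  exact ⟨Basis.piTensorProduct b, key⟩

end MonomialConstructions

/-! ### Indices of the graded tensor product as multisets of labels. -/

section TensorIndices

/-- The index set of the monomial basis of a graded tensor product of symmetric powers. -/
abbrev TensorIndex (Q : ℕ+ → Type*) (n : ℕ) : Type _ :=
  Σ d : {d : ℕ+ →₀ ℕ // (d.sum fun _ e => e) = n}, ∀ r : d.1.support,
    Σ a : {a : ℕ // ((r : ℕ+) : ℕ) * a = d.1 r}, Sym (Q r) a.1

variable {Q : ℕ+ → Type*} {n : ℕ}

/-- The multiset of all the labels that occur in an index. -/
def TensorIndex.labels (x : TensorIndex Q n) : Multiset (Σ r, Q r) :=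
  ∑ r : x.1.1.support, (x.2 r).2.1.map (Sigma.mk r.1)

lemma TensorIndex.map_labels (x : TensorIndex Q n) {X : Type*} (f : (Σ r, Q r) → X) :
    x.labels.map f = ∑ r : x.1.1.support, (x.2 r).2.1.map fun q => f ⟨r.1, q⟩ := by
  refine (map_sum (Multiset.mapAddMonoidHom f)
    (fun r : x.1.1.support => (x.2 r).2.1.map (Sigma.mk r.1)) Finset.univ).trans ?_
  exact Finset.sum_congr rfl fun r _ => Multiset.map_map _ _ _

lemma TensorIndex.sum_labels (x : TensorIndex Q n) :
    (x.labels.map fun t => (t.1 : ℕ)).sum = n := by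
  rw [map_labels, Multiset.sum_sum]
  refine Eq.trans (Finset.sum_congr rfl fun r _ => ?_)
    ((Finset.sum_coe_sort x.1.1.support fun r => x.1.1 r).trans x.1.2)
  change ((x.2 r).2.1.map fun _ => ((r : ℕ+) : ℕ)).sum = _
  rw [Multiset.map_const', Multiset.sum_replicate, smul_eq_mul, mul_comm]
  exact (congrArg _ (x.2 r).2.2).trans (x.2 r).1.2

/-- The labels of length `r` of an index. -/
def TensorIndex.part (x : TensorIndex Q n) (r : ℕ+) : Multiset (Q r) :=
  if h : r ∈ x.1.1.support then (x.2 ⟨r, h⟩).2.1 else 0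

open scoped Classical in
lemma TensorIndex.count_labels (x : TensorIndex Q n) (t : Σ r, Q r) :
    x.labels.count t = (x.part t.1).count t.2 := by
  obtain ⟨r, q⟩ := t
  have h0 : ∀ r' : x.1.1.support, r'.1 ≠ r →
      ((x.2 r').2.1.map (Sigma.mk r'.1)).count ⟨r, q⟩ = 0 := fun r' h => by
    rw [Multiset.count_eq_zero, Multiset.mem_map]
    rintro ⟨q', -, h'⟩
    exact h (congrArg Sigma.fst h')
  rw [labels, Multiset.count_sum', part]
  split_ifs with h
  · rw [Finset.sum_eq_single ⟨r, h⟩ (fun r' _ hr' => h0 r' fun e => hr' (Subtype.ext e))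
      (fun h' => absurd (Finset.mem_univ _) h')]
    exact Multiset.count_map_eq_count' _ _ sigma_mk_injective _
  · rw [Multiset.count_zero]
    exact Finset.sum_eq_zero fun r' _ => h0 r' fun e => h (e ▸ r'.2)

lemma TensorIndex.card_part (x : TensorIndex Q n) (r : ℕ+) :
    (r : ℕ) * Multiset.card (x.part r) = x.1.1 r := by
  rw [part]
  split_ifs with h
  · exact (congrArg _ (x.2 ⟨r, h⟩).2.2).trans (x.2 ⟨r, h⟩).1.2
  · rw [Multiset.card_zero, mul_zero, Finsupp.notMem_support_iff.mp h]

/-- The labels of length `r` form the factor in `r`, and their number times `r` is the degree `d_r`.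
So the multiset of labels determines both the degrees and the factors. -/
lemma TensorIndex.labels_injective :
    Function.Injective (TensorIndex.labels : TensorIndex Q n → Multiset (Σ r, Q r)) := by
  classical
  intro x y h
  have hp : ∀ r, x.part r = y.part r := fun r => Multiset.ext.mpr fun q => by
    have := congrArg (Multiset.count ⟨r, q⟩) h
    have h1 := count_labels x ⟨r, q⟩
    have h2 := count_labels y ⟨r, q⟩
    convert h1.symm.trans (Eq.trans (by convert this) h2)
  obtain ⟨d, x⟩ := x
  obtain ⟨d', y⟩ := y
  obtain rfl : d = d' := Subtype.ext (Finsupp.ext fun r => by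
    have h1 := card_part ⟨d, x⟩ r
    rw [hp, card_part] at h1
    exact h1.symm)
  refine congrArg (Sigma.mk d) (funext fun r => ?_)
  have h1 := hp r.1
  simp only [part, dif_pos r.2] at h1
  -- Once the multisets agree the exponents agree as well, being their cardinalities. Generalizing
  -- makes this substitution possible.
  generalize x r = a at h1 ⊢
  generalize y r = b at h1 ⊢
  obtain ⟨⟨m, hm⟩, s, hs⟩ := a
  obtain ⟨⟨m', hm'⟩, s', hs'⟩ := b
  obtain rfl : s = s' := h1
  obtain rfl : m = m' := hs.symm.trans hs'
  rfl

lemma TensorIndex.exists_labels_eq (M : Multiset (Σ r, Q r))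
    (hM : (M.map fun t => (t.1 : ℕ)).sum = n) : ∃ x : TensorIndex Q n, x.labels = M := by
  classical
  subst hM
  let y : ∀ r, Multiset (Q r) := fun r => Finsupp.toMultiset
    (Finsupp.comapDomain (Sigma.mk r) (Multiset.toFinsupp M) sigma_mk_injective.injOn)
  have hy : ∀ r q, (y r).count q = M.count ⟨r, q⟩ := fun r q => by
    rw [Finsupp.count_toMultiset, Finsupp.comapDomain_apply, Multiset.toFinsupp_apply]
  -- The degree in `r` is `r` times the number of labels of length `r`. It is nonzero only for
  -- lengths that occur in `M`.
  let d : ℕ+ →₀ ℕ := Finsupp.onFinset (M.map Sigma.fst).toFinset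
    (fun r => (r : ℕ) * Multiset.card (y r)) fun r hr => by
      have h1 : y r ≠ 0 := fun h0 => hr (by rw [h0, Multiset.card_zero, mul_zero])
      obtain ⟨q, hq⟩ := Multiset.exists_mem_of_ne_zero h1
      rw [← Multiset.count_pos, hy, Multiset.count_pos] at hq
      rw [Multiset.mem_toFinset]
      exact Multiset.mem_map_of_mem _ hq
  let x : TensorIndex Q (d.sum fun _ e => e) :=
    ⟨⟨d, rfl⟩, fun r => ⟨⟨Multiset.card (y r), rfl⟩, ⟨y r, rfl⟩⟩⟩
  have hx : x.labels = M := Multiset.ext.mpr fun t => by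
    have h1 : x.part t.1 = y t.1 := by
      rw [part]
      split_ifs with h
      · rfl
      -- Outside the support the degree is zero. As the length is positive, no label of that length
      -- occurs.
      · have h2 : (t.1 : ℕ) * Multiset.card (y t.1) = 0 := Finsupp.notMem_support_iff.mp h
        exact (Multiset.card_eq_zero.mp ((mul_eq_zero.mp h2).resolve_left t.1.ne_zero)).symm
    have h3 := count_labels x t
    rw [h1] at h3
    refine Eq.trans (by convert h3) (Eq.trans (by convert hy t.1 t.2) rfl)
  have hn := sum_labels x
  rw [hx] at hn
  rw [hn]
  exact ⟨x, hx⟩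

end TensorIndices

/-! ### The monomial basis of the graded tensor product. -/

section GradedTensor

variable {k : Type u} [Field k] {H : Type v} [Group H]

lemma IsMonomial.totalSym {W : Rep.{w} k H} {Q : Type*} {σ : H → Q → Q} {C : H → Q → k}
    (h : IsMonomial W σ C) (r : ℕ+) (d : ℕ) :
    IsMonomial (TwoRep.totalSym r W d)
      (fun s (q : Σ a : {a : ℕ // (r : ℕ) * a = d}, Sym Q a.1) => ⟨q.1, q.2.map (σ s)⟩)
      fun s q => (q.2.1.map (C s)).prod :=
  IsMonomial.sumRep (σ := fun (a : {a : ℕ // (r : ℕ) * a = d}) s (q : Sym Q a.1) => q.map (σ s))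
    (C := fun _ s q => (q.1.map (C s)).prod) fun a => h.symRep a.1

lemma IsMonomial.gradedTensor {W : ℕ+ → Rep.{w} k H} {Q : ℕ+ → Type*}
    {σ : ∀ r, H → Q r → Q r} {C : ∀ r, H → Q r → k}
    (h : ∀ r, IsMonomial (W r) (σ r) (C r)) (n : ℕ) :
    IsMonomial (TwoRep.gradedTensor (fun r => TwoRep.totalSym r (W r)) n)
      (fun s (x : TensorIndex Q n) => ⟨x.1, fun r => ⟨(x.2 r).1, (x.2 r).2.map (σ r.1 s)⟩⟩)
      fun s x => ∏ r, ((x.2 r).2.1.map (C r.1 s)).prod :=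
  IsMonomial.sumRep (Q := fun d : {d : ℕ+ →₀ ℕ // (d.sum fun _ e => e) = n} =>
      ∀ r : d.1.support, Σ a : {a : ℕ // ((r : ℕ+) : ℕ) * a = d.1 r}, Sym (Q r) a.1)
    (σ := fun _ s x r => ⟨(x r).1, (x r).2.map (σ r.1 s)⟩)
    (C := fun _ s x => ∏ r, ((x r).2.1.map (C r.1 s)).prod)
    fun d => IsMonomial.tensorRep
      (Q := fun r : d.1.support => Σ a : {a : ℕ // ((r : ℕ+) : ℕ) * a = d.1 r}, Sym (Q r) a.1)
      (σ := fun r s x => ⟨x.1, x.2.map (σ r.1 s)⟩)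
      (C := fun r s x => (x.2.1.map (C r.1 s)).prod) fun r => (h r.1).totalSym r.1 (d.1 r)

end GradedTensor

/-! ### Comparison of the two monomial bases. -/

section Comparison

variable {k : Type u} [Field k] {m : ℕ} {G : Type v} [Group G] (ρ : TwoRep k G (VectPow k m))
  (g : G) (n : ℕ)

lemma isMonomial_cyclicInvariants (r : ℕ) :
    IsMonomial (cyclicInvariants ρ g r)
      (fun s => Label.map (r := r) (idxPerm ρ s) (commute_idxPerm ρ s))
      fun s t => t.prod (twist ρ g s) :=
  exists_basis_cyclicInvariants ρ g r

/-- The index of a basis vector is a degree function with one unordered word of labels for each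
length in its support. Pooling all these labels gives the multiset, and the scalars multiply
accordingly. -/
lemma isMonomial_gradedTensor :
    IsMonomial (gradedTensor (fun r : ℕ+ => totalSym r (cyclicInvariants ρ g r)) n)
      (fun s => CycleMultiset.map (n := n) (idxPerm ρ s) (commute_idxPerm ρ s))
      fun s M => (M.1.map fun t => t.2.prod (twist ρ g s)).prod := by
  refine (IsMonomial.gradedTensor
    (fun r : ℕ+ => isMonomial_cyclicInvariants ρ g r) n).reindex
    (fun x => ⟨x.labels, x.sum_labels⟩) ⟨fun x y h => ?_, fun M => ?_⟩ (fun s x => ?_) fun s x => ?_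
  · exact TensorIndex.labels_injective (congrArg Subtype.val h)
  · obtain ⟨x, hx⟩ := TensorIndex.exists_labels_eq M.1 M.2
    exact ⟨x, Subtype.ext hx⟩
  · refine Subtype.ext ?_
    refine Eq.trans ?_ (x.map_labels _).symm
    exact Finset.sum_congr rfl fun r _ => Multiset.map_map _ _ _
  · change _ = (x.labels.map _).prod
    rw [x.map_labels, Multiset.prod_sum]

lemma isMonomial_symCharacters :
    IsMonomial (symCharacters ρ g n)
      (fun s => CycleMultiset.map (n := n) (idxPerm ρ s) (commute_idxPerm ρ s))
      fun s M => (M.1.map fun t => t.2.prod (twist ρ g s)).prod :=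
  hasMonomialBasis_symPow ρ g n

lemma nonempty_iso_symCharacters :
    Nonempty (symCharacters ρ g n ≅
      gradedTensor (fun r : ℕ+ => totalSym r (cyclicInvariants ρ g r)) n) :=
  IsMonomial.nonempty_iso (isMonomial_symCharacters ρ g n)
    (isMonomial_gradedTensor ρ g n)

end Comparison

end

end TwoRep

theorem mainTheorem3 {k : Type*} [Field k] [IsAlgClosed k] {G : Type*} [Group G] (m : ℕ)
    (ρ : TwoRep k G (VectPow k m)) (g : G) :
    Nonempty (TwoRep.symCharacters ρ g ≅
      TwoRep.gradedTensor fun r : ℕ+ => TwoRep.totalSym r (TwoRep.cyclicInvariants ρ g r)) :=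
  ⟨GradedObject.isoMk _ _ fun n => (TwoRep.nonempty_iso_symCharacters ρ g n).some⟩
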